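/- **Conventions.** Let $k$ be a field of characteristic $0$ and $(A,\{m_n\}_{n\ge 1})$ a finite-dimensional strict ($m_0=0$) $\mathbb Z$-graded $A_\infty$-algebra over $k$, in the shifted sign convention: $|a|'$ is the degree in $A[1]$, each $m_n:A[1]^{\otimes n}\to A[1]$ has degree one, and $\sum(-1)^{|a_1|'+\dots+|a_{i-1}|'}m(a_1,\dots,m(a_i,\dots),\dots,a_n)=0$. Fix a homogeneous basis $\{e_i\}$ of $A$ and $D\in\mathbb Z$. A *pre-bimodule map* $\phi:A\to A^*$ of degree $D$ is a family of multilinear maps $\phi_{p,q}:A[1]^{\otimes p}\otimes A[1]\otimes A[1]^{\otimes q}\to A[1]^*$ such that $\phi(\vec a,v,\vec b)(w)\ne0$ only if the shifted degrees of $\vec a,v,\vec b,w$ sum to $-D$. A functional $\xi\in A^*$ has degree $|\xi|'=r$ if it is nonzero only on shifted degree $-r-D$. The map $\phi$ is an *$A_\infty$-bimodule map* if $\phi\circ\hat b=b^*\circ\hat\phi$, where $b_{p,q}=m_{p+q+1}$ and $$b^*(\vec x,\xi,\vec y)(w)=(-1)^{1+|\xi|'+|\vec x|'(|\xi|'+|\vec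 y|'+|w|')}\,\xi\big(m(\vec y,w,\vec x)\big).$$ It is a *strong homotopy inner product* if it is an $A_\infty$-bimodule map and there are an $A_\infty$-algebra $B$ with a cyclic symmetric inner product $\langle\,,\rangle$ of shifted degree $D$ and an $A_\infty$-quasi-isomorphism $f:A\to B$ with $\phi=g^*\circ\psi\circ g$, where $g_{p,q}=f_{p+q+1}$, $\psi_{0,0}(b)(b')=\langle b,b'\rangle$, all other $\psi_{p,q}=0$, and $g^*(\vec x,\xi,\vec y)(w)=(-1)^{|\vec x|'(|\xi|'+|\vec y|'+|w|')}\xi(g(\vec y,w,\vec x))$. Here a cyclic symmetric inner product is a non-degenerate bilinear form that is skew symmetric, $\langle a,b\rangle=-(-1)^{|a|'|b|'}\langle b,a\rangle$, and satisfies $\langle m(x_1,\dots,x_n),x_{n+1}\rangle=(-1)^{|x_1|'(|x_2|'+\dots+|x_{n+1}|')}\langle m(x_2,\dots,x_{n+1}),x_1\rangle$. A pre-bimodule map $\phi$ is *non-degenerate at chain level* if the bilinear form $\phi_{0,0}(v)(w)$ on $A$ is non-degenerate. It is *skew symmetric* if $$\phi(\vec a,v,\vec b)(w)=-(-1)^{(|\vec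 a|'+|v|')(|\vec b|'+|w|')}\phi(\vec b,w,\vec a)(v),$$ and *closed* if for every family $(a_1,\dots,a_n)$ of homogeneous elements and all $i<j<l$ $$[a_i,a_j]+[a_j,a_l]+[a_l,a_i]=0,$$ where $[a_i,a_j]=(-1)^{(|a_1|'+\dots+|a_j|')(|a_{j+1}|'+\dots+|a_n|')}\phi(a_{j+1},\dots,a_i,\dots,a_{j-1})(a_j)$, the arguments being in cyclic order with $a_i$ in the module slot. The formal non-commutative supermanifold $X$ of $A$ has non-commuting coordinates $x_i$ of degree $-|e_i|'$ and the vector field $\delta$ with $\delta x_j=\sum_I m^j_I x^I$, where $m(e_{i_1},\dots,e_{i_n})=\sum_j m^j_{i_1\cdots i_n}e_j$. Its cyclic differential forms are formal series in words in the letters $x_i,dx_i$, taken up to signed cyclic rotation, written $(\cdots)_c$; exchanging two words costs $(-1)^{(\text{product of internal degrees})+(\text{product of form degrees})}$. The operator $d$ is the de Rham differential ($dx_i$ is the image of $x_i$), $d(pq)=(dp)q+(-1)^{\text{form degree of }p}p\,(dq)$, and $L_\delta$ is the Lie derivative, the odd derivation with $L_\delta x_j=\delta x_j$, $L_\delta dx_j=d(\delta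 x_j)$ and $L_\delta(pq)=(L_\delta p)q+(-1)^{\text{internal degree of }p}p\,(L_\delta q)$. A (non-constant) *symplectic form* of degree $D$ on $X$ is a cyclic two-form $\omega$ of internal degree $D$ with $d\omega=0$ that is non-degenerate, meaning that the bilinear form given by its $dx_i\,dx_j$ part is non-degenerate. To a pre-bimodule map $\phi$ of degree $D$ associate $$\omega_\phi=\sum_{i,j,I,J}\omega_{ij,IJ}\,(x^I dx_i\,x^J dx_j)_c,\qquad \omega_{ij,IJ}=\phi(e_I,e_i,e_J)(e_j).$$ **Theorem 6.1.** 1. The assignment $\phi\mapsto\omega_\phi$ is a bijection from the set of strong homotopy inner products of degree $D$ on $A$ that are non-degenerate at chain level onto the set of symplectic forms $\omega$ of degree $D$ on $X$ with $L_\delta\omega=0$. 2. An $A_\infty$-bimodule map $\phi:A\to A^*$ of degree $D$ is a strong homotopy inner product that is non-degenerate at chain level if and only if its coefficients are skew symmetric, $\omega_{ij,IJ}=-(-1)^{(|e_I|'+|e_i|')(|e_J|'+|e_j|')}\omega_{ji,JI}$, and $\omega_\phi$ is a symplectic form of degree $D$. 3. The assignment $\phi\mapsto\omega_\phi$ is a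 bijection from the skew symmetric pre-bimodule maps of degree $D$ onto the cyclic two-forms of degree $D$. A pre-bimodule map $\phi$ is skew symmetric if and only if its coefficients $\omega_{ij,IJ}$ are. For skew symmetric $\phi$: $\phi$ is closed if and only if $d\omega_\phi=0$; $\phi$ is non-degenerate at chain level if and only if $\omega_\phi$ is non-degenerate; and $\phi$ is an $A_\infty$-bimodule map if and only if $L_\delta\omega_\phi=0$. -/

import Mathlib

universe u v w

namespace AInfinity

/-! ## Cutting words into consecutive blocks -/

/-- The sum of `F u t` over all ways of cutting a word `l = u ++ t` (empty blocks allowed). -/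
def sum2 {α : Type*} {N : Type*} [AddCommMonoid N] :
    List α → (List α → List α → N) → N
  | [], F => F [] []
  | a :: l, F => F [] (a :: l) + sum2 l (fun p t => F (a :: p) t)

/-- The sum of `F u s t` over all ways of cutting a word `l = u ++ s ++ t` (empty blocks
allowed). -/
def sum3 {α : Type*} {N : Type*} [AddCommMonoid N]
    (l : List α) (F : List α → List α → List α → N) : N :=
  sum2 l (fun p r => sum2 r (fun s t => F p s t))

theorem sum2_congr {α N : Type*} [AddCommMonoid N] (l : List α)
    (F G : List α → List α → N) (h : ∀ p t, p ++ t = l → F p t = G p t) :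
    sum2 l F = sum2 l G := by
  induction l generalizing F G with
  | nil => exact h _ _ rfl
  | cons a l ih =>
    simp only [sum2]
    rw [h [] (a :: l) rfl, ih _ (fun p t => G (a :: p) t)
      (fun p t hpt => h _ _ (by rw [List.cons_append, hpt]))]

theorem sum3_congr {α N : Type*} [AddCommMonoid N] (l : List α)
    (F G : List α → List α → List α → N)
    (h : ∀ p s t, p ++ (s ++ t) = l → F p s t = G p s t) :
    sum3 l F = sum3 l G :=
  sum2_congr _ _ _ fun p r hp => sum2_congr _ _ _ fun s t hs => h p s t (by rw [hs, hp])

theorem sum2_snoc {α N : Type*} [AddCommMonoid N] (l : List α) (a : α)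
    (F : List α → List α → N) :
    sum2 (l ++ [a]) F = sum2 l (fun p t => F p (t ++ [a])) + F (l ++ [a]) [] := by
  induction l generalizing F with
  | nil => simp [sum2]
  | cons b l ih => simp only [List.cons_append, sum2, ih, add_assoc]

theorem sum2_add {α N : Type*} [AddCommMonoid N] (l : List α)
    (F G : List α → List α → N) :
    sum2 l (fun p t => F p t + G p t) = sum2 l F + sum2 l G := by
  induction l generalizing F G with
  | nil => rfl
  | cons b l ih => simp only [sum2, ih]; abel

theorem sum3_add {α N : Type*} [AddCommMonoid N] (l : List α)
    (F G : List α → List α → List α → N) :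
    sum3 l (fun p s t => F p s t + G p s t) = sum3 l F + sum3 l G := by
  simp only [sum3, sum2_add]

theorem sum2_mul {α R : Type*} [CommSemiring R] (l : List α) (r : R)
    (F : List α → List α → R) :
    sum2 l (fun p t => r * F p t) = r * sum2 l F := by
  induction l generalizing F with
  | nil => rfl
  | cons b l ih => simp only [sum2, ih, mul_add]

theorem sum3_mul {α R : Type*} [CommSemiring R] (l : List α) (r : R)
    (F : List α → List α → List α → R) :
    sum3 l (fun p s t => r * F p s t) = r * sum3 l F := by
  simp only [sum3, sum2_mul]

theorem sum3_cons {α N : Type*} [AddCommMonoid N] (a : α) (l : List α)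
    (F : List α → List α → List α → N) :
    sum3 (a :: l) F = sum2 (a :: l) (F []) + sum3 l (fun p s t => F (a :: p) s t) := rfl

theorem sum3_snoc {α N : Type*} [AddCommMonoid N] (l : List α) (a : α)
    (F : List α → List α → List α → N) :
    sum3 (l ++ [a]) F =
      sum3 l (fun p s t => F p s (t ++ [a])) + sum2 (l ++ [a]) (fun p s => F p s []) := by
  simp only [sum3, sum2_snoc, sum2_add, sum2, add_assoc]

/-! ## Graded vector spaces and multilinear operations

A graded vector space is a vector space `A` with a family `𝒜 : ℤ → Submodule k A` that is an
internal direct sum. Throughout, `𝒜` is the *shifted* grading, that of `A[1]`: an element of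
`𝒜 n` has shifted degree `n`. -/

section Graded

variable {k : Type v} [Field k] {A : Type u} [AddCommGroup A] [Module k A]

/-- A homogeneous element together with its (shifted) degree. -/
abbrev HElt (𝒜 : ℤ → Submodule k A) : Type u := Σ n : ℤ, 𝒜 n

/-- The total degree of a word of homogeneous elements. -/
def wdeg {𝒜 : ℤ → Submodule k A} (x : List (HElt 𝒜)) : ℤ := (x.map Sigma.fst).sum

/-- The underlying word of elements. -/
def vals {𝒜 : ℤ → Submodule k A} (x : List (HElt 𝒜)) : List A := x.map fun h => (h.2 : A)

/-- A family of multilinear maps `A^{⊗ n} → B`, `n ≥ 0`. -/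
abbrev MultiFamily (k : Type v) [Field k] (A : Type u) [AddCommGroup A] [Module k A]
    (B : Type w) [AddCommGroup B] [Module k B] : Type (max u w) :=
  ∀ n : ℕ, MultilinearMap k (fun _ : Fin n => A) B

/-- The value of a family of multilinear maps on a word. -/
def MultiFamily.ap {B : Type w} [AddCommGroup B] [Module k B] (F : MultiFamily k A B)
    (x : List A) : B := F x.length x.get

/-- A (strict, `m₀ = 0`) `A_∞`-algebra, in the shifted sign convention: operations
`m_n : A[1]^{⊗ n} → A[1]` of degree one with
`∑ (-1)^{|x₁|' + ⋯ + |x_{i-1}|'} m (x₁, …, x_{i-1}, m (x_i, …), …, x_n) = 0`. -/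
structure AInfAlgebra (𝒜 : ℤ → Submodule k A) where
  m : MultiFamily k A A
  strict : m 0 = 0
  degree_one : ∀ x : List (HElt 𝒜), m.ap (vals x) ∈ 𝒜 (wdeg x + 1)
  relation : ∀ x : List (HElt 𝒜),
    sum3 x (fun p s t =>
      (-1 : k) ^ wdeg p • m.ap (vals p ++ m.ap (vals s) :: vals t)) = 0

/-- An `A_∞`-homomorphism: maps `f_n : A[1]^{⊗ n} → B[1]` (`n ≥ 1`) of degree zero with
`∑ m^B (f (x₁, …), …, f (…, x_n)) = ∑ ± f (x₁, …, m^A (x_i, …), …, x_n)`. The sum on the left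
runs over all ways of cutting the word into nonempty blocks. -/
structure AInfHom {𝒜 : ℤ → Submodule k A} (MA : AInfAlgebra 𝒜)
    {B : Type u} [AddCommGroup B] [Module k B] {ℬ : ℤ → Submodule k B}
    (MB : AInfAlgebra ℬ) where
  f : MultiFamily k A B
  strict : f 0 = 0
  degree_zero : ∀ x : List (HElt 𝒜), f.ap (vals x) ∈ ℬ (wdeg x)
  relation : ∀ x : List (HElt 𝒜),
    (∑ c : Composition x.length,
      MB.m.ap ((x.splitWrtComposition c).map fun s => f.ap (vals s))) =
    sum3 x (fun p s t =>
      (-1 : k) ^ wdeg p • f.ap (vals p ++ MA.m.ap (vals s) :: vals t))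

/-- `f` is a quasi-isomorphism: `f₁` induces a bijection (injective and surjective, in this
order) between the cohomologies of `m₁^A` and `m₁^B`. -/
def AInfHom.IsQuasiIso {𝒜 : ℤ → Submodule k A} {MA : AInfAlgebra 𝒜}
    {B : Type u} [AddCommGroup B] [Module k B] {ℬ : ℤ → Submodule k B}
    {MB : AInfAlgebra ℬ} (F : AInfHom MA MB) : Prop :=
  (∀ a : A, MA.m.ap [a] = 0 → (∃ b : B, F.f.ap [a] = MB.m.ap [b]) →
    ∃ a' : A, a = MA.m.ap [a']) ∧
  (∀ b : B, MB.m.ap [b] = 0 →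
    ∃ a : A, MA.m.ap [a] = 0 ∧ ∃ b' : B, b = F.f.ap [a] + MB.m.ap [b'])

/-- A cyclic symmetric inner product of (shifted) degree `D` on an `A_∞`-algebra. -/
structure CyclicInnerProduct {𝒜 : ℤ → Submodule k A} (M : AInfAlgebra 𝒜) (D : ℤ) where
  pairing : A →ₗ[k] A →ₗ[k] k
  degree : ∀ x y : HElt 𝒜, pairing x.2 y.2 ≠ 0 → x.1 + y.1 + D = 0
  skew : ∀ x y : HElt 𝒜,
    pairing x.2 y.2 = -((-1 : k) ^ (x.1 * y.1) * pairing y.2 x.2)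
  nondegenerate : pairing.Nondegenerate
  /-- `⟨m (x₁, …, x_n), x_{n+1}⟩ = ± ⟨m (x₂, …, x_{n+1}), x₁⟩`, with `t = x₂, …, x_n` and
  `z = x_{n+1}`. -/
  cyclic : ∀ (x : HElt 𝒜) (t : List (HElt 𝒜)) (z : HElt 𝒜),
    pairing (M.m.ap ((x.2 : A) :: vals t)) z.2 =
      (-1 : k) ^ (x.1 * (wdeg t + z.1)) * pairing (M.m.ap (vals t ++ [(z.2 : A)])) x.2

/-! ## Bimodule maps `A → A^*` and strong homotopy inner products -/

/-- Families of maps `φ_{p,q} : A[1]^{⊗ p} ⊗ A[1] ⊗ A[1]^{⊗ q} → A[1]^*`, `p, q ≥ 0`. -/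
abbrev BiFamily (k : Type v) [Field k] (A : Type u) [AddCommGroup A] [Module k A] :
    Type (max u v) :=
  ∀ p q : ℕ, MultilinearMap k (fun _ : Fin p => A)
    (A →ₗ[k] MultilinearMap k (fun _ : Fin q => A) (Module.Dual k A))

/-- `φ_{p,q}(a₁, …, a_p, v, b₁, …, b_q)(w)`, the module element being `v`. -/
def BiFamily.ap (φ : BiFamily k A) (a : List A) (x : A) (b : List A) (y : A) : k :=
  φ a.length b.length a.get x b.get y

/-- A pre-bimodule map `A[1] → A[1]^*` that has degree zero when `A[1]^*` is shifted by `D`: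
a functional `ξ` has degree `n` when it is nonzero only on elements of degree `-n - D`. No
compatibility with an `A_∞`-structure is included. -/
structure PreBimoduleMap (𝒜 : ℤ → Submodule k A) (D : ℤ) where
  φ : BiFamily k A
  degree : ∀ (a : List (HElt 𝒜)) (x : HElt 𝒜) (b : List (HElt 𝒜)) (y : HElt 𝒜),
    φ.ap (vals a) x.2 (vals b) y.2 ≠ 0 → wdeg a + x.1 + wdeg b + y.1 + D = 0

variable {𝒜 : ℤ → Submodule k A} {D : ℤ}

/-- The value `φ(a, v, b)(w)` on homogeneous elements. -/
def PreBimoduleMap.ev (Φ : PreBimoduleMap 𝒜 D) (a : List (HElt 𝒜)) (x : HElt 𝒜)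
    (b : List (HElt 𝒜)) (y : HElt 𝒜) : k :=
  Φ.φ.ap (vals a) x.2 (vals b) y.2

/-- The bimodule structure of the dual: for a functional `ξ` of degree `n`,
`b^*(x, ξ, y)(z) = (-1)^{1 + n + |x|' (n + |y|' + |z|')} ξ (m (y, z, x))`. -/
def dualOp (M : AInfAlgebra 𝒜) (x : List (HElt 𝒜)) (n : ℤ) (ξ : A → k)
    (y : List (HElt 𝒜)) (z : HElt 𝒜) : k :=
  (-1 : k) ^ (1 + n + wdeg x * (n + wdeg y + z.1)) *
    ξ (M.m.ap (vals y ++ (z.2 : A) :: vals x))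

/-- `Φ` is an `A_∞`-bimodule homomorphism `A → A^*`, i.e. `φ ∘ b̂ = b^* ∘ φ̂`, where the bimodule
structure of `A` is `b_{p,q} = m_{p+q+1}`. -/
def PreBimoduleMap.IsBimoduleMap (Φ : PreBimoduleMap 𝒜 D) (M : AInfAlgebra 𝒜) : Prop :=
  ∀ (a : List (HElt 𝒜)) (x : HElt 𝒜) (b : List (HElt 𝒜)) (y : HElt 𝒜),
    sum3 a (fun p s t => (-1 : k) ^ wdeg p *
        Φ.φ.ap (vals p ++ M.m.ap (vals s) :: vals t) x.2 (vals b) y.2) +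
    sum2 a (fun p s => sum2 b (fun s' t => (-1 : k) ^ wdeg p *
        Φ.φ.ap (vals p) (M.m.ap (vals s ++ (x.2 : A) :: vals s')) (vals t) y.2)) +
    sum3 b (fun p s t => (-1 : k) ^ (wdeg a + x.1 + wdeg p) *
        Φ.φ.ap (vals a) x.2 (vals p ++ M.m.ap (vals s) :: vals t) y.2) =
    sum2 a (fun p s => sum2 b (fun s' t =>
        dualOp M p (wdeg s + x.1 + wdeg s')
          (fun z => Φ.φ.ap (vals s) x.2 (vals s') z) t y))

/-- Skew symmetry. -/
def PreBimoduleMap.IsSkew (Φ : PreBimoduleMap 𝒜 D) : Prop :=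
  ∀ (a : List (HElt 𝒜)) (x : HElt 𝒜) (b : List (HElt 𝒜)) (y : HElt 𝒜),
    Φ.ev a x b y =
      -((-1 : k) ^ ((wdeg a + x.1) * (wdeg b + y.1)) * Φ.ev b y a x)

/-- Closedness. The family is `P, x, Q, y, R, z, S`, with three chosen members `x, y, z` in this
order; each sign is the Koszul sign of the cyclic rotation that brings the family to the order
in which it is fed into `φ`. -/
def PreBimoduleMap.IsClosed (Φ : PreBimoduleMap 𝒜 D) : Prop :=
  ∀ (P : List (HElt 𝒜)) (x : HElt 𝒜) (Q : List (HElt 𝒜)) (y : HElt 𝒜)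
    (R : List (HElt 𝒜)) (z : HElt 𝒜) (S : List (HElt 𝒜)),
    (-1 : k) ^ ((wdeg P + x.1 + wdeg Q + y.1) * (wdeg R + z.1 + wdeg S)) *
        Φ.ev (R ++ z :: S ++ P) x Q y +
    (-1 : k) ^ ((wdeg P + x.1 + wdeg Q + y.1 + wdeg R + z.1) * wdeg S) *
        Φ.ev (S ++ P ++ x :: Q) y R z +
    (-1 : k) ^ ((wdeg P + x.1) * (wdeg Q + y.1 + wdeg R + z.1 + wdeg S)) *
        Φ.ev (Q ++ y :: R) z (S ++ P) x = 0

/-- Chain-level non-degeneracy: the bilinear form `φ_{0,0}(v)(w)` on `A` is non-degenerate. -/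
def PreBimoduleMap.IsNondegenerate (Φ : PreBimoduleMap 𝒜 D) : Prop :=
  (∀ x : A, (∀ y : A, Φ.φ.ap [] x [] y = 0) → x = 0) ∧
  (∀ y : A, (∀ x : A, Φ.φ.ap [] x [] y = 0) → y = 0)

/-- The composite `g^* ∘ ψ ∘ g : A → A^*`, where `g_{p,q} = f_{p+q+1}` is the bimodule map
`A → B` induced by `f`, where `ψ : B → B^*` has only the component
`ψ_{0,0}(b)(b') = ⟨b, b'⟩`, and where
`g^*_{p,q}(x, ξ, y)(w) = (-1)^{|x|' (|ξ|' + |y|' + |w|')} ξ (g_{q,p}(y, w, x))`. -/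
def pullback {B : Type u} [AddCommGroup B] [Module k B] (𝒜 : ℤ → Submodule k A)
    (f : MultiFamily k A B) (ψ : B →ₗ[k] B →ₗ[k] k)
    (a : List (HElt 𝒜)) (x : HElt 𝒜) (b : List (HElt 𝒜)) (y : HElt 𝒜) : k :=
  sum2 a (fun p s => sum2 b (fun s' t =>
    (-1 : k) ^ (wdeg p * (wdeg s + x.1 + wdeg s' + wdeg t + y.1)) *
      ψ (f.ap (vals s ++ (x.2 : A) :: vals s')) (f.ap (vals t ++ (y.2 : A) :: vals p))))

/-- `Φ` is a strong homotopy inner product on the `A_∞`-algebra: it is an `A_∞`-bimodule map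
`A → A^*`, and there are a cyclic symmetric `A_∞`-algebra `B` with `ψ : B → B^*` and an
`A_∞`-quasi-isomorphism `f : A → B` with `φ = g^* ∘ ψ ∘ g`. -/
def PreBimoduleMap.IsStrongHomotopyInnerProduct (Φ : PreBimoduleMap 𝒜 D)
    (M : AInfAlgebra 𝒜) : Prop :=
  Φ.IsBimoduleMap M ∧
  ∃ (B : Type u) (_ : AddCommGroup B) (_ : Module k B) (ℬ : ℤ → Submodule k B)
    (_ : DirectSum.IsInternal ℬ) (MB : AInfAlgebra ℬ) (ψ : CyclicInnerProduct MB D)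
    (F : AInfHom M MB), F.IsQuasiIso ∧
      ∀ (a : List (HElt 𝒜)) (x : HElt 𝒜) (b : List (HElt 𝒜)) (y : HElt 𝒜),
        Φ.ev a x b y = pullback 𝒜 F.f ψ.pairing a x b y

end Graded

/-! ## Cyclic differential forms on a formal non-commutative supermanifold

Coordinates `x_i` (`i : ι`) of degree `-deg i`, dual to a homogeneous basis `e_i` of degree
`deg i`. Differential forms are formal series in words in the non-commuting letters `x_i`, `dx_i`;
a letter has an internal degree (that of `x_i`) and a form degree (`0` or `1`), and exchanging two
words costs the sign of the product of their internal degrees times the sign of the product of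
their form degrees. -/

inductive Letter (ι : Type w) : Type w
  | x (i : ι) : Letter ι
  | dx (i : ι) : Letter ι

section Forms

variable {ι : Type w} (k : Type v) [Field k] (deg : ι → ℤ)

/-- The internal degree of a letter. -/
def Letter.ideg : Letter ι → ℤ
  | .x i => -deg i
  | .dx i => -deg i

/-- The form degree of a letter. -/
def Letter.fdeg : Letter ι → ℤ
  | .x _ => 0
  | .dx _ => 1

/-- The internal degree of a word. -/
def ideg (l : List (Letter ι)) : ℤ := (l.map (Letter.ideg deg)).sum

/-- The form degree of a word. -/
def fdeg (l : List (Letter ι)) : ℤ := (l.map Letter.fdeg).sum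

/-- The sign of exchanging two words. -/
def exSign (p q : List (Letter ι)) : k := (-1 : k) ^ (ideg deg p * ideg deg q + fdeg p * fdeg q)

/-- Formal series in the letters `x_i`, `dx_i`, given by their coefficients. -/
abbrev Series (ι : Type w) (k : Type v) : Type (max v w) := List (Letter ι) → k

/-- Signed cyclic rotation: the linear operator on series that replaces every word `p y`, with
last letter `y`, by `± y p`. -/
def rot : Series ι k →ₗ[k] Series ι k where
  toFun c
    | [] => c []
    | y :: p => exSign k deg [y] p * c (p ++ [y])
  map_add' c c' := by
    funext l
    cases l <;> simp [mul_add]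
  map_smul' r c := by
    funext l
    cases l
    · simp
    · simp; ring

/-- The closed span of the graded commutators `p q - (± q p)`; since letters generate, it is the
set of all series `c - rot c`. -/
def commutators : Submodule k (Series ι k) := LinearMap.range (LinearMap.id - rot k deg)

/-- Cyclic differential forms: formal series in words `(⋯)_c` taken up to signed cyclic
rotation. -/
abbrev CyclicForm : Type (max v w) := Series ι k ⧸ commutators k deg

/-- The class of a series in the cyclic differential forms. -/
def cyc (c : Series ι k) : CyclicForm k deg := (commutators k deg).mkQ c

variable {k}

/-- The coefficient of a word in `d c`, where `d` is the derivation with `d x_i = dx_i`,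
`d dx_i = 0` and `d (p q) = (d p) q + (-1)^{fdeg p} p (d q)`. -/
def dCoeff : List (Letter ι) → Series ι k → k
  | [], _ => 0
  | .x i :: l, c => dCoeff l (fun t => c (.x i :: t))
  | .dx i :: l, c => c (.x i :: l) - dCoeff l (fun t => c (.dx i :: t))

theorem dCoeff_add (l : List (Letter ι)) (c c' : Series ι k) :
    dCoeff l (fun t => c t + c' t) = dCoeff l c + dCoeff l c' := by
  induction l generalizing c c' with
  | nil => simp [dCoeff]
  | cons y l ih =>
    cases y
    · simp only [dCoeff, ih]
    · simp only [dCoeff, ih]; ring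

theorem dCoeff_smul (l : List (Letter ι)) (r : k) (c : Series ι k) :
    dCoeff l (fun t => r * c t) = r * dCoeff l c := by
  induction l generalizing c with
  | nil => simp [dCoeff]
  | cons y l ih =>
    cases y
    · simp only [dCoeff, ih]
    · simp only [dCoeff, ih]; ring

theorem dCoeff_congr (l : List (Letter ι)) (c c' : Series ι k)
    (h : ∀ t, ideg deg t = ideg deg l → fdeg t + 1 = fdeg l → c t = c' t) :
    dCoeff l c = dCoeff l c' := by
  induction l generalizing c c' with
  | nil => rfl
  | cons y l ih =>
    have key : dCoeff l (fun t => c (y :: t)) = dCoeff l (fun t => c' (y :: t)) := by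
      refine ih _ _ fun t h1 h2 => h _ ?_ ?_
      · simpa [ideg] using h1
      · simp only [fdeg, List.map_cons, List.sum_cons] at h2 ⊢
        omega
    cases y with
    | x i => exact key
    | dx i =>
      simp only [dCoeff, key]
      rw [h (.x i :: l) (by simp [ideg, Letter.ideg])
        (by simp [fdeg, Letter.fdeg, add_comm])]

theorem sgn_congr {a b : ℤ} (h : Even (a - b)) : (-1 : k) ^ a = (-1 : k) ^ b := by
  have hk : (-1 : k) ≠ 0 := neg_ne_zero.mpr one_ne_zero
  have : a = b + (a - b) := by ring
  rw [this, zpow_add₀ hk, h.neg_one_zpow, mul_one]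

theorem sgn_mul (a b : ℤ) : (-1 : k) ^ a * (-1 : k) ^ b = (-1 : k) ^ (a + b) :=
  (zpow_add₀ (neg_ne_zero.mpr one_ne_zero) a b).symm

theorem dCoeff_snoc (l : List (Letter ι)) (y : Letter ι) (c : Series ι k) :
    dCoeff (l ++ [y]) c = dCoeff l (fun t => c (t ++ [y])) +
      (match y with
        | .x _ => 0
        | .dx i => (-1 : k) ^ fdeg l * c (l ++ [.x i])) := by
  induction l generalizing c with
  | nil => cases y <;> simp [dCoeff, fdeg]
  | cons z l ih =>
    cases z with
    | x i =>
      simp only [List.cons_append, dCoeff, ih]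
      cases y <;> simp [fdeg, Letter.fdeg]
    | dx i =>
      simp only [List.cons_append, dCoeff, ih]
      cases y with
      | x j => simp
      | dx j =>
        have hk : (-1 : k) ≠ 0 := neg_ne_zero.mpr one_ne_zero
        have : (-1 : k) ^ fdeg (Letter.dx i :: l) = -(-1 : k) ^ fdeg l := by
          simp [fdeg, Letter.fdeg, zpow_add₀ hk]
        simp only [this]
        ring

variable (k) in
/-- The de Rham differential on series. -/
def dSeries : Series ι k →ₗ[k] Series ι k where
  toFun c l := dCoeff l c
  map_add' c c' := funext fun l => dCoeff_add l c c'
  map_smul' r c := funext fun l => dCoeff_smul l r c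

theorem dSeries_rot (c : Series ι k) :
    dSeries k (rot k deg c) = rot k deg (dSeries k c) := by
  funext l
  cases l with
  | nil => rfl
  | cons y l =>
    change dCoeff (y :: l) (rot k deg c) = exSign k deg [y] l * dCoeff (l ++ [y]) c
    rw [dCoeff_snoc]
    cases y with
    | x i =>
      simp only [dCoeff, add_zero]
      rw [← dCoeff_smul]
      refine dCoeff_congr deg _ _ _ fun t h1 h2 => ?_
      change exSign k deg [.x i] t * _ = _
      rw [exSign, exSign, h1]
      simp [fdeg, Letter.fdeg]
    | dx i =>
      simp only [dCoeff]
      have e1 : dCoeff l (fun t => rot k deg c (.dx i :: t)) =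
          -exSign k deg [.dx i] l * dCoeff l (fun t => c (t ++ [.dx i])) := by
        rw [← dCoeff_smul]
        refine dCoeff_congr deg _ _ _ fun t h1 h2 => ?_
        change exSign k deg [.dx i] t * _ = _
        rw [exSign, exSign, h1, ← h2]
        have : -(-1 : k) ^ (ideg deg [Letter.dx i] * ideg deg l +
            fdeg [Letter.dx i] * (fdeg t + 1)) = (-1 : k) ^ (1 : ℤ) * (-1 : k) ^
            (ideg deg [Letter.dx i] * ideg deg l + fdeg [Letter.dx i] * (fdeg t + 1)) := by
          simp
        rw [this, sgn_mul]
        congr 1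
        refine sgn_congr ⟨-1, ?_⟩
        simp [fdeg, Letter.fdeg]
        ring
      have e2 : rot k deg c (.x i :: l) =
          exSign k deg [.dx i] l * ((-1 : k) ^ fdeg l * c (l ++ [.x i])) := by
        change exSign k deg [.x i] l * _ = _
        rw [← mul_assoc]
        congr 1
        rw [exSign, exSign, sgn_mul]
        refine sgn_congr ⟨-fdeg l, ?_⟩
        simp [ideg, Letter.ideg]
        simp [fdeg, Letter.fdeg]
        ring
      rw [e1, e2]
      ring

variable (k) in
/-- The de Rham differential on cyclic forms. -/
def extD : CyclicForm k deg →ₗ[k] CyclicForm k deg :=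
  (commutators k deg).mapQ (commutators k deg) (dSeries k) (by
    rintro _ ⟨c, rfl⟩
    exact ⟨dSeries k c, by simp [dSeries_rot]⟩)

/-- The letters of a word that contains no `dx_i`. -/
def pureWord : List (Letter ι) → Option (List ι)
  | [] => some []
  | .x i :: l => (pureWord l).map (i :: ·)
  | .dx _ :: _ => none

theorem pureWord_spec (l : List (Letter ι)) (I : List ι) (h : pureWord l = some I) :
    fdeg l = 0 ∧ ideg deg l = -(I.map deg).sum := by
  induction l generalizing I with
  | nil => cases h; simp [fdeg, ideg]
  | cons y l ih =>
    cases y with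
    | dx i => cases h
    | x i =>
      simp only [pureWord, Option.map_eq_some_iff] at h
      obtain ⟨J, hJ, rfl⟩ := h
      obtain ⟨h1, h2⟩ := ih J hJ
      simp only [fdeg, ideg, List.map_cons, List.sum_cons] at h1 h2 ⊢
      refine ⟨by simp [Letter.fdeg, h1], by simp [Letter.ideg, h2]; ring⟩

variable (k) in
/-- A vector field of degree one: the derivation with `x_j ↦ ∑_I comp j I • x^I`. -/
structure OddVectorField where
  comp : ι → List ι → k
  degree_one : ∀ j I, comp j I ≠ 0 → -(I.map deg).sum = -deg j + 1

variable {deg}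

/-- The image `δ x_j`, as a series. -/
def OddVectorField.onCoord (δ : OddVectorField k deg) (j : ι) : Series ι k := fun l =>
  match pureWord l with
  | some I => δ.comp j I
  | none => 0

/-- The image `L_δ y` of a letter: `L_δ x_j = δ x_j` and `L_δ dx_j = d (δ x_j)`. -/
def OddVectorField.onLetter (δ : OddVectorField k deg) : Letter ι → Series ι k
  | .x j => δ.onCoord j
  | .dx j => dSeries k (δ.onCoord j)

theorem OddVectorField.onCoord_ne (δ : OddVectorField k deg) (j : ι) (l : List (Letter ι))
    (h : δ.onCoord j l ≠ 0) : ideg deg l = -deg j + 1 ∧ fdeg l = 0 := by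
  unfold onCoord at h
  split at h
  · rename_i I hI
    obtain ⟨h1, h2⟩ := pureWord_spec deg l I hI
    exact ⟨h2.trans (δ.degree_one j I h), h1⟩
  · exact absurd rfl h

theorem OddVectorField.onLetter_ne (δ : OddVectorField k deg) (y : Letter ι)
    (l : List (Letter ι)) (h : δ.onLetter y l ≠ 0) :
    ideg deg l = y.ideg deg + 1 ∧ fdeg l = y.fdeg := by
  cases y with
  | x j => exact δ.onCoord_ne j l h
  | dx j =>
    by_contra hc
    refine h ?_
    have h0 : dCoeff l (fun _ => (0 : k) * 0) = 0 := by
      rw [dCoeff_smul l 0 (fun _ => 0), zero_mul]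
    change dCoeff l (δ.onCoord j) = 0
    rw [← h0]
    refine dCoeff_congr deg _ _ _ fun t h1 h2 => ?_
    by_contra hne
    have hne' : δ.onCoord j t ≠ 0 := by simpa using hne
    obtain ⟨h3, h4⟩ := δ.onCoord_ne j t hne'
    refine hc ⟨?_, ?_⟩
    · rw [← h1, h3]; rfl
    · rw [← h2, h4]; rfl

theorem ideg_append (p q : List (Letter ι)) : ideg deg (p ++ q) = ideg deg p + ideg deg q := by
  simp [ideg]

theorem fdeg_append (p q : List (Letter ι)) : fdeg (p ++ q) = fdeg p + fdeg q := by
  simp [fdeg]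

theorem ideg_cons (y : Letter ι) (q : List (Letter ι)) :
    ideg deg (y :: q) = y.ideg deg + ideg deg q := by
  simp [ideg]

theorem fdeg_cons (y : Letter ι) (q : List (Letter ι)) : fdeg (y :: q) = y.fdeg + fdeg q := by
  simp [fdeg]

theorem rot_cons (c : Series ι k) (y : Letter ι) (p : List (Letter ι)) :
    rot k deg c (y :: p) = exSign k deg [y] p * c (p ++ [y]) := rfl

variable [Fintype ι]

/-- `∑_y (coefficient of the word s in L_δ y) • g y`, over all letters `y`. -/
def OddVectorField.contract (δ : OddVectorField k deg) (s : List (Letter ι))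
    (g : Letter ι → k) : k :=
  ∑ j, δ.onLetter (.x j) s * g (.x j) + ∑ j, δ.onLetter (.dx j) s * g (.dx j)

theorem OddVectorField.contract_add (δ : OddVectorField k deg) (s : List (Letter ι))
    (g g' : Letter ι → k) :
    δ.contract s (fun y => g y + g' y) = δ.contract s g + δ.contract s g' := by
  simp only [contract, mul_add, Finset.sum_add_distrib]
  ring

theorem OddVectorField.contract_mul (δ : OddVectorField k deg) (s : List (Letter ι))
    (r : k) (g : Letter ι → k) :
    δ.contract s (fun y => r * g y) = r * δ.contract s g := by
  simp only [contract, mul_add, Finset.mul_sum]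
  congr 1 <;> exact Finset.sum_congr rfl fun j _ => by ring

theorem OddVectorField.contract_congr (δ : OddVectorField k deg) (s : List (Letter ι))
    (g g' : Letter ι → k)
    (h : ∀ y : Letter ι, ideg deg s = y.ideg deg + 1 → fdeg s = y.fdeg → g y = g' y) :
    δ.contract s g = δ.contract s g' := by
  have key : ∀ y, δ.onLetter y s * g y = δ.onLetter y s * g' y := fun y => by
    by_cases h0 : δ.onLetter y s = 0
    · simp [h0]
    · obtain ⟨h1, h2⟩ := δ.onLetter_ne y s h0
      rw [h y h1 h2]
  simp only [contract, key]

/-- The Lie derivative along an odd vector field on series: the derivation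
`L_δ (p q) = (L_δ p) q + (-1)^{ideg p} p (L_δ q)`. The coefficient of a word collects all
ways of cutting it as `p s t` and of obtaining the block `s` from a letter. -/
def OddVectorField.lieSeries (δ : OddVectorField k deg) : Series ι k →ₗ[k] Series ι k where
  toFun c l := sum3 l (fun p s t =>
    (-1 : k) ^ ideg deg p * δ.contract s (fun y => c (p ++ y :: t)))
  map_add' c c' := by
    funext l
    simp only [Pi.add_apply, contract_add, mul_add, sum3_add]
  map_smul' r c := by
    funext l
    simp only [Pi.smul_apply, smul_eq_mul, contract_mul, RingHom.id_apply]
    rw [← sum3_mul]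
    exact sum3_congr _ _ _ fun _ _ _ _ => by ring

/-- The terms of `L_δ c` in which the block is a final one. -/
def OddVectorField.lastPart (δ : OddVectorField k deg) (c : Series ι k) : Series ι k := fun l =>
  sum2 l (fun p s => (-1 : k) ^ ideg deg p * δ.contract s (fun y => c (p ++ [y])))

/-- The terms of `L_δ c` in which the block is an initial one. -/
def OddVectorField.firstPart (δ : OddVectorField k deg) (c : Series ι k) : Series ι k := fun l =>
  sum2 l (fun s t => δ.contract s (fun y => c (y :: t)))

theorem OddVectorField.lieSeries_apply (δ : OddVectorField k deg) (c : Series ι k)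
    (l : List (Letter ι)) : δ.lieSeries c l = sum3 l (fun p s t =>
      (-1 : k) ^ ideg deg p * δ.contract s (fun y => c (p ++ y :: t))) := rfl

theorem OddVectorField.firstPart_apply (δ : OddVectorField k deg) (c : Series ι k)
    (l : List (Letter ι)) : δ.firstPart c l =
      sum2 l (fun s t => δ.contract s (fun y => c (y :: t))) := rfl

theorem OddVectorField.lastPart_apply (δ : OddVectorField k deg) (c : Series ι k)
    (l : List (Letter ι)) : δ.lastPart c l =
      sum2 l (fun p s => (-1 : k) ^ ideg deg p * δ.contract s (fun y => c (p ++ [y]))) := rfl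

theorem OddVectorField.lie_sub_last (δ : OddVectorField k deg) (c : Series ι k) :
    δ.lieSeries (rot k deg c) - δ.firstPart (rot k deg c) =
      rot k deg (δ.lieSeries c - δ.lastPart c) := by
  funext l
  cases l with
  | nil =>
    simp [lieSeries, firstPart, lastPart, rot, sum3, sum2, exSign, ideg, fdeg]
  | cons a l =>
    simp only [Pi.sub_apply, lieSeries_apply, firstPart_apply]
    rw [rot_cons]
    simp only [Pi.sub_apply, lieSeries_apply, lastPart_apply]
    rw [sum3_cons, sum3_snoc]
    have e1 : sum2 (a :: l) (fun s t => (-1 : k) ^ ideg deg ([] : List (Letter ι)) *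
          δ.contract s (fun y => rot k deg c ([] ++ y :: t))) =
        sum2 (a :: l) (fun s t => δ.contract s (fun y => rot k deg c (y :: t))) := by
      simp [ideg]
    rw [e1, add_sub_cancel_left, add_sub_cancel_right, ← sum3_mul]
    refine sum3_congr _ _ _ fun p s t hl => ?_
    rw [mul_left_comm, ← contract_mul, ← contract_mul, ← contract_mul]
    refine δ.contract_congr _ _ _ fun y h1 h2 => ?_
    change _ * (exSign k deg [a] (p ++ y :: t) * c ((p ++ y :: t) ++ [a])) = _
    rw [← mul_assoc, ← mul_assoc, ← hl]
    simp only [List.append_assoc, List.cons_append]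
    congr 1
    rw [exSign, exSign, sgn_mul, sgn_mul]
    refine sgn_congr ⟨0, ?_⟩
    simp only [ideg_append, ideg_cons, fdeg_append, fdeg_cons, h1, h2]
    simp only [ideg, fdeg, List.map_nil, List.sum_nil]
    ring

/-- An auxiliary term: the word `q ++ p ++ s` is a rotation of `p ++ (s ++ q)`, whose final block
`s ++ q` comes from a letter. -/
def OddVectorField.rotTerm (δ : OddVectorField k deg) (c : Series ι k)
    (q p s : List (Letter ι)) : k :=
  exSign k deg q (p ++ s) *
    ((-1 : k) ^ ideg deg p * δ.contract (s ++ q) (fun y => c (p ++ [y])))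

theorem OddVectorField.rotTerm_cons (δ : OddVectorField k deg) (c : Series ι k)
    (a : Letter ι) (q p s : List (Letter ι)) :
    δ.rotTerm c (a :: q) p s = exSign k deg [a] (q ++ (p ++ s)) * δ.rotTerm c q p (s ++ [a]) := by
  have h : exSign k deg (a :: q) (p ++ s) =
      exSign k deg [a] (q ++ (p ++ s)) * exSign k deg q (p ++ (s ++ [a])) := by
    rw [exSign, exSign, exSign, sgn_mul]
    refine sgn_congr ⟨-(a.ideg deg * ideg deg q + a.fdeg * fdeg q), ?_⟩
    simp only [ideg_append, ideg_cons, fdeg_append, fdeg_cons]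
    simp only [ideg, fdeg, List.map_nil, List.sum_nil]
    ring
  simp only [rotTerm, h, List.append_assoc, List.singleton_append, mul_assoc]

/-- The sum of the auxiliary terms with nonempty last block. -/
def OddVectorField.rotSum (δ : OddVectorField k deg) (c : Series ι k) : Series ι k := fun l =>
  sum3 l (δ.rotTerm c) - sum2 l (fun q p => δ.rotTerm c q p [])

theorem OddVectorField.rotSum_sub_rot (δ : OddVectorField k deg) (c : Series ι k) :
    δ.rotSum c - rot k deg (δ.rotSum c) = δ.lastPart c - δ.firstPart (rot k deg c) := by
  have hlast : ∀ l, sum2 l (δ.rotTerm c []) = δ.lastPart c l := fun l => by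
    rw [lastPart_apply]
    refine sum2_congr _ _ _ fun p s _ => ?_
    simp [rotTerm, exSign, ideg, fdeg]
  have hfirst : ∀ l, sum2 l (fun q p => δ.rotTerm c q p []) =
      δ.firstPart (rot k deg c) l := fun l => by
    rw [firstPart_apply]
    refine sum2_congr _ _ _ fun q p _ => ?_
    simp only [rotTerm, List.append_nil, List.nil_append, ← contract_mul]
    refine δ.contract_congr _ _ _ fun y h1 h2 => ?_
    rw [rot_cons, ← mul_assoc]
    congr 1
    rw [exSign, exSign, sgn_mul, h1, h2]
    refine sgn_congr ⟨ideg deg p, ?_⟩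
    simp only [ideg_cons, fdeg_cons]
    simp only [ideg, fdeg, List.map_nil, List.sum_nil]
    ring
  funext l
  cases l with
  | nil =>
    have h := hlast []
    have h' := hfirst []
    simp only [sum2] at h h'
    simp only [Pi.sub_apply, ← h, ← h']
    change _ - δ.rotSum c [] = _
    simp
  | cons a l =>
    have key : rot k deg (δ.rotSum c) (a :: l) =
        sum3 l (fun q p s => δ.rotTerm c (a :: q) p s) := by
      rw [rot_cons]
      simp only [rotSum, sum3_snoc, add_sub_cancel_right]
      rw [← sum3_mul]
      refine sum3_congr _ _ _ fun q p s hl => ?_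
      rw [rotTerm_cons, hl]
    rw [Pi.sub_apply, Pi.sub_apply, key, rotSum, sum3_cons, hlast, hfirst]
    ring

variable (k) in
theorem OddVectorField.lie_commutators (δ : OddVectorField k deg) :
    commutators k deg ≤ (commutators k deg).comap δ.lieSeries := by
  rintro _ ⟨c, rfl⟩
  refine ⟨δ.lieSeries c - δ.lastPart c + δ.rotSum c, ?_⟩
  have h1 := δ.lie_sub_last c
  have h2 := δ.rotSum_sub_rot c
  simp only [LinearMap.sub_apply, LinearMap.id_apply, map_add, map_sub] at h1 h2 ⊢
  rw [h2, sub_eq_iff_eq_add.mp h1]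
  abel

/-- The Lie derivative along an odd vector field on cyclic forms. -/
def OddVectorField.lieD (δ : OddVectorField k deg) : CyclicForm k deg →ₗ[k] CyclicForm k deg :=
  (commutators k deg).mapQ (commutators k deg) δ.lieSeries δ.lie_commutators

variable (k deg) in
/-- The bilinear form at the origin of a cyclic two-form: its coefficients at `dx_i dx_j`, signed
and antisymmetrised so as to depend only on the class up to cyclic rotation. -/
def originMatrix : CyclicForm k deg →ₗ[k] Matrix ι ι k :=
  (commutators k deg).liftQ
    { toFun := fun c => Matrix.of fun i j =>
        c [.dx i, .dx j] + exSign k deg [.dx i] [.dx j] * c [.dx j, .dx i]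
      map_add' := fun c c' => by
        ext i j
        simp only [Pi.add_apply, Matrix.of_apply, Matrix.add_apply]
        ring
      map_smul' := fun r c => by
        ext i j
        simp only [Pi.smul_apply, smul_eq_mul, Matrix.of_apply, Matrix.smul_apply,
          RingHom.id_apply]
        ring } (by
    rintro _ ⟨c, rfl⟩
    rw [LinearMap.mem_ker]
    ext i j
    have h : exSign k deg [.dx i] [.dx j] * exSign k deg [.dx j] [.dx i] = 1 := by
      rw [exSign, exSign, sgn_mul]
      refine (sgn_congr (b := 0) ⟨ideg deg [.dx i] * ideg deg [.dx j] +
        fdeg [Letter.dx i] * fdeg [Letter.dx j], by ring⟩).trans (zpow_zero _)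
    simp only [LinearMap.sub_apply, LinearMap.id_apply, LinearMap.coe_mk, AddHom.coe_mk,
      Pi.sub_apply, rot_cons, List.singleton_append, Matrix.of_apply, Matrix.zero_apply]
    linear_combination -c [.dx i, .dx j] * h)

variable (k deg) in
/-- The cyclic `p`-forms of internal degree `D`. -/
def formsOfDegree (p D : ℤ) : Submodule k (CyclicForm k deg) :=
  Submodule.map (commutators k deg).mkQ
    { carrier := {c | ∀ l, c l ≠ 0 → fdeg l = p ∧ ideg deg l = D}
      add_mem' := fun {c c'} hc hc' l h => by
        by_cases h0 : c l = 0
        · exact hc' l (by simpa [h0] using h)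
        · exact hc l h0
      zero_mem' := fun l h => absurd rfl h
      smul_mem' := fun r c hc l h => hc l fun h0 => h (by simp [h0]) }

/-- A (non-constant) symplectic form of degree `D`: a cyclic two-form of internal degree `D` that is
closed and non-degenerate (at the origin). -/
structure IsSymplectic (D : ℤ) (ω : CyclicForm k deg) : Prop where
  mem : ω ∈ formsOfDegree k deg 2 D
  closed : extD k deg ω = 0
  nondegenerate : (originMatrix k deg ω).Nondegenerate

/-- Coefficients `ω_{ij,IJ}` (arguments in the order `I i J j`) of the series
`∑ ω_{ij,IJ} x^I dx_i x^J dx_j`. -/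
abbrev TwoFormCoeff (ι : Type w) (k : Type v) : Type (max v w) := List ι → ι → List ι → ι → k

/-- Skew symmetry `ω_{ij,IJ} = - ± ω_{ji,JI}` of coefficients, with the Koszul sign of exchanging
`(I, i)` and `(J, j)`. -/
def TwoFormCoeff.IsSkew (deg : ι → ℤ) (C : TwoFormCoeff ι k) : Prop :=
  ∀ I i J j, C I i J j =
    -((-1 : k) ^ (((I.map deg).sum + deg i) * ((J.map deg).sum + deg j)) * C J j I i)

/-- Splits a word as `x^I dx_i r`, where `dx_i` is its first differential. -/
def splitAtD : List (Letter ι) → Option (List ι × ι × List (Letter ι))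
  | [] => none
  | .dx i :: r => some ([], i, r)
  | .x j :: l => (splitAtD l).map fun q => (j :: q.1, q.2.1, q.2.2)

/-- The series `∑ ω_{ij,IJ} x^I dx_i x^J dx_j`. -/
def TwoFormCoeff.series (C : TwoFormCoeff ι k) : Series ι k := fun l =>
  match splitAtD l with
  | none => 0
  | some (I, i, r) =>
    match splitAtD r with
    | some (J, j, []) => C I i J j
    | _ => 0

/-- The cyclic two-form `∑ ω_{ij,IJ} (x^I dx_i x^J dx_j)_c`. -/
def TwoFormCoeff.form (deg : ι → ℤ) (C : TwoFormCoeff ι k) : CyclicForm k deg :=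
  cyc k deg C.series

end Forms

/-! ## The formal manifold of an `A_∞`-algebra and the two-form of a bimodule map -/

section Manifold

variable {k : Type v} [Field k] {A : Type u} [AddCommGroup A] [Module k A]
  {𝒜 : ℤ → Submodule k A} {ι : Type w}

theorem repr_eq_zero_of_mem (h𝒜 : DirectSum.IsInternal 𝒜) (e : Module.Basis ι k A)
    (deg : ι → ℤ) (hdeg : ∀ i, e i ∈ 𝒜 (deg i)) (n : ℤ) (a : A) (ha : a ∈ 𝒜 n) (j : ι)
    (hj : e.repr a j ≠ 0) : n = deg j := by
  classical
  by_contra hne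
  let _ : DirectSum.Decomposition 𝒜 := h𝒜.chooseDecomposition
  let π : A →ₗ[k] A := (𝒜 (deg j)).subtype ∘ₗ
    DirectSum.component k ℤ (fun i => 𝒜 i) (deg j) ∘ₗ (DirectSum.decomposeLinearEquiv 𝒜).toLinearMap
  have hπ : ∀ (d : ℤ) (b : A), b ∈ 𝒜 d → π b = if d = deg j then b else 0 := fun d b hb => by
    change ((DirectSum.decompose 𝒜 b (deg j) : 𝒜 (deg j)) : A) = _
    rw [DirectSum.decompose_of_mem 𝒜 hb]
    split_ifs with h
    · subst h
      simp
    · rw [DirectSum.of_eq_of_ne _ _ _ (Ne.symm h)]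
      rfl
  have hrep : ∀ b : A, e.repr (π b) j = e.repr b j := by
    intro b
    have : (e.coord j) ∘ₗ π = e.coord j := by
      refine e.ext fun i => ?_
      simp only [LinearMap.comp_apply, hπ _ _ (hdeg i)]
      split_ifs with h
      · rfl
      · have hij : i ≠ j := fun hij => h (by rw [hij])
        simp [hij]
    exact LinearMap.congr_fun this b
  have h0 := hrep a
  rw [hπ n a ha, if_neg hne] at h0
  exact hj (by rw [← h0]; simp)

/-- The vector field `δ` of an `A_∞`-algebra, with `δ x_j = ∑_I m^j_I x^I` where
`m (e_{i₁}, …, e_{i_n}) = ∑_j m^j_{i₁ ⋯ i_n} e_j`. -/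
noncomputable def homologicalField (h𝒜 : DirectSum.IsInternal 𝒜) (M : AInfAlgebra 𝒜)
    (e : Module.Basis ι k A) (deg : ι → ℤ) (hdeg : ∀ i, e i ∈ 𝒜 (deg i)) :
    OddVectorField k deg where
  comp j I := e.repr (M.m.ap (I.map e)) j
  degree_one j I h := by
    have hm := M.degree_one (I.map fun i => (⟨deg i, e i, hdeg i⟩ : HElt 𝒜))
    have hv : vals (I.map fun i => (⟨deg i, e i, hdeg i⟩ : HElt 𝒜)) = I.map e := by
      simp [vals]
    have hw : wdeg (I.map fun i => (⟨deg i, e i, hdeg i⟩ : HElt 𝒜)) = (I.map deg).sum := by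
      simp [wdeg, Function.comp_def]
    rw [hv, hw] at hm
    have := repr_eq_zero_of_mem h𝒜 e deg hdeg _ _ hm j h
    omega

/-- The coefficients `ω_{ij,IJ} = φ(e_I, e_i, e_J)(e_j)`. -/
noncomputable def PreBimoduleMap.coeff {D : ℤ} (Φ : PreBimoduleMap 𝒜 D) (e : Module.Basis ι k A) :
    TwoFormCoeff ι k :=
  fun I i J j => Φ.φ.ap (I.map e) (e i) (J.map e) (e j)

/-- The cyclic two-form `ω_φ = ∑ φ(e_I, e_i, e_J)(e_j) (x^I dx_i x^J dx_j)_c`. -/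
noncomputable def PreBimoduleMap.form {D : ℤ} (Φ : PreBimoduleMap 𝒜 D) (e : Module.Basis ι k A)
    (deg : ι → ℤ) : CyclicForm k deg :=
  (Φ.coeff e).form deg

end Manifold
end AInfinity

/-! A family pulled back from a constant pairing `ψ` along `f` has a cyclic description: on a word
`a x b y` it is the signed sum of `ψ (f (arc around x)) (f (arc around y))` over all ways of cutting
the cyclic word into two such arcs. Exchanging the two arcs gives skew symmetry (`pullback_isSkew`).
If three elements are marked, a cut into two arcs separates one of them from the other two; every
such cut occurs in two of the three terms of the closedness sum, with opposite signs
(`pullback_isClosed`). Hence every strong homotopy inner product is skew symmetric and closed.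

The converse is a noncommutative Darboux theorem, `exists_darboux`: a skew symmetric, closed,
non-degenerate family is the pullback of its constant part `φ_{0,0}` along some `f` with `f₁ = id`.
The components of `f` are found by recursion on the arity. The difference between `φ` and the
pullback along the components already known is skew symmetric and closed. By a Poincaré lemma
(`TwoMarked.IsClosed.homotopy`), a positive integer multiple of it is the differential of its
contraction, and characteristic zero allows division. Non-degeneracy represents the resulting
functional by a vector, which is the value of the next component.

Since `f₁ = id`, substitution of `f` is unitriangular for word length. The `A_∞`-structure can
therefore be transported along `f` to a structure on the same space (`exists_transport`), with the
same `m₁`, so `f` is a quasi-isomorphism. If `φ` is a bimodule map, its equation is the pullback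
along `f` of the cyclic defect of `φ_{0,0}` for the transported structure; by unitriangularity the
defect vanishes (`pairing_cyclic_of_transport`), so that `φ` is a strong homotopy inner product.

It remains to translate into forms. In characteristic zero a series vanishes as a cyclic form
exactly when the sum of all its signed rotations vanishes and its coefficient at the empty word is
zero (`cyc_eq_zero_iff`). For skew coefficients `C` that sum takes the value `2 C` on the words `x^I
dx_i x^J dx_j`, and such words represent all two-forms; so skew families are the same as two-forms
(`bijOn_form`). The rotation sum commutes with `d`, and the coefficients of the result at words with
three differentials are twice the closedness sums. For `L_δ`, the terms are sorted by the position
of the block substituted by `δ` relative to the two differentials; brought to the normal words they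
form `lieInner + lieOuter`, which is the difference of the two sides of the bimodule equation. -/

namespace AInfinity

/-! ## Sums over cuttings -/

section Cuttings

variable {α N : Type*} [AddCommMonoid N]

theorem sum2_zero (l : List α) : sum2 l (fun _ _ => (0 : N)) = 0 := by
  induction l with
  | nil => rfl
  | cons a l ih => simp [sum2, ih]

theorem sum2_eq_zero (l : List α) (F : List α → List α → N)
    (h : ∀ p t, p ++ t = l → F p t = 0) : sum2 l F = 0 :=
  (sum2_congr l F (fun _ _ => 0) h).trans (sum2_zero l)

theorem sum3_zero (l : List α) : sum3 l (fun _ _ _ => (0 : N)) = 0 := by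
  simp [sum3, sum2_zero]

theorem sum3_eq_zero (l : List α) (F : List α → List α → List α → N)
    (h : ∀ p s t, p ++ (s ++ t) = l → F p s t = 0) : sum3 l F = 0 :=
  (sum3_congr l F (fun _ _ _ => 0) h).trans (sum3_zero l)

theorem map_sum2 {N' G : Type*} [AddCommMonoid N'] [FunLike G N N'] [AddMonoidHomClass G N N']
    (g : G) (l : List α) (F : List α → List α → N) :
    g (sum2 l F) = sum2 l (fun p t => g (F p t)) := by
  induction l generalizing F with
  | nil => rfl
  | cons a l ih => simp only [sum2, map_add, ih]

theorem map_sum3 {N' G : Type*} [AddCommMonoid N'] [FunLike G N N'] [AddMonoidHomClass G N N']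
    (g : G) (l : List α) (F : List α → List α → List α → N) :
    g (sum3 l F) = sum3 l (fun p s t => g (F p s t)) := by
  simp only [sum3, map_sum2]

theorem sum2_smul {R : Type*} [Semiring R] [Module R N] (r : R) (l : List α)
    (F : List α → List α → N) : sum2 l (fun p t => r • F p t) = r • sum2 l F :=
  (map_sum2 (Module.toAddMonoidEnd R N r) l F).symm

theorem sum3_smul {R : Type*} [Semiring R] [Module R N] (r : R) (l : List α)
    (F : List α → List α → List α → N) :
    sum3 l (fun p s t => r • F p s t) = r • sum3 l F := by
  simp only [sum3, sum2_smul]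

theorem sum2_neg {N : Type*} [AddCommGroup N] (l : List α) (F : List α → List α → N) :
    sum2 l (fun p t => -F p t) = -sum2 l F :=
  (map_sum2 (negAddMonoidHom : N →+ N) l F).symm

theorem sum2_append_cons (u v : List α) (x : α) (F : List α → List α → N) :
    sum2 (u ++ x :: v) F =
      sum2 u (fun p t => F p (t ++ x :: v)) + sum2 v (fun p t => F (u ++ x :: p) t) := by
  induction u generalizing F with
  | nil => simp [sum2]
  | cons a u ih => simp only [List.cons_append, sum2, ih, add_assoc]

theorem sum2_comm {β : Type*} (l : List α) (l' : List β)
    (F : List α → List α → List β → List β → N) :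
    sum2 l (fun p t => sum2 l' (fun p' t' => F p t p' t')) =
      sum2 l' (fun p' t' => sum2 l (fun p t => F p t p' t')) := by
  induction l generalizing F with
  | nil => rfl
  | cons a l ih => simp only [sum2, ih, sum2_add]

theorem sum2_assoc (l : List α) (F : List α → List α → List α → N) :
    sum2 l (fun q t => sum2 q (fun p s => F p s t)) = sum3 l F := by
  induction l generalizing F with
  | nil => rfl
  | cons a l ih =>
    rw [sum3_cons, ← ih]
    simp only [sum2, sum2_add, add_assoc]

/-- The letter `x` lies in the last, the middle or the first block. These are the three kinds of
terms in the bimodule equation, with `x` the module element. -/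
theorem sum3_append_cons (u v : List α) (x : α) (F : List α → List α → List α → N) :
    sum3 (u ++ x :: v) F =
      sum3 u (fun p s t => F p s (t ++ x :: v)) +
      sum2 u (fun p s => sum2 v (fun s' t => F p (s ++ x :: s') t)) +
      sum3 v (fun p s t => F (u ++ x :: p) s t) := by
  simp only [sum3]
  rw [sum2_append_cons]
  simp only [sum2_append_cons, sum2_add]

theorem sum2_eq_sum_range (l : List α) (F : List α → List α → N) :
    sum2 l F = ∑ r ∈ Finset.range (l.length + 1), F (l.take r) (l.drop r) := by
  induction l generalizing F with
  | nil => simp [sum2]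
  | cons a l ih =>
    rw [List.length_cons, Finset.sum_range_succ', sum2, ih, add_comm]
    simp

/-- The sum of `G c` over all ways `c` of cutting a word into nonempty blocks. -/
def blockSum : List α → (List (List α) → N) → N
  | [], G => G []
  | a :: l, G => blockSum l (fun c => G ([a] :: c)) +
      -- Here the first letter joins the block that follows it; the empty cut has no such block and
      -- contributes zero.
      blockSum l (fun c => match c with
        | [] => 0
        | b :: c => G ((a :: b) :: c))

theorem blockSum_congr (l : List α) (G G' : List (List α) → N)
    (h : ∀ c, c.flatten = l → (∀ s ∈ c, s ≠ []) → G c = G' c) :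
    blockSum l G = blockSum l G' := by
  induction l generalizing G G' with
  | nil => exact h [] rfl (by simp)
  | cons a l ih =>
    simp only [blockSum]
    congr 1
    · refine ih _ _ fun c hc h0 => h _ (by simp [hc]) ?_
      simpa using h0
    · refine ih _ _ fun c hc h0 => ?_
      cases c with
      | nil => rfl
      | cons b c =>
        refine h _ (by simpa using hc) ?_
        simp only [List.mem_cons, forall_eq_or_imp] at h0 ⊢
        exact ⟨by simp, h0.2⟩

theorem blockSum_add (l : List α) (G G' : List (List α) → N) :
    blockSum l (fun c => G c + G' c) = blockSum l G + blockSum l G' := by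
  induction l generalizing G G' with
  | nil => rfl
  | cons a l ih =>
    simp only [blockSum, ih]
    rw [show (fun c : List (List α) => (match c with
        | [] => 0
        | b :: c => G ((a :: b) :: c) + G' ((a :: b) :: c) : N)) =
      fun c => (match c with
        | [] => 0
        | b :: c => G ((a :: b) :: c)) + (match c with
        | [] => 0
        | b :: c => G' ((a :: b) :: c)) by
      funext c; cases c <;> simp, ih]
    abel

theorem blockSum_zero (l : List α) : blockSum l (fun _ => (0 : N)) = 0 := by
  have h : ∀ l : List α, blockSum l (fun c => match c with
      | [] => (0 : N)
      | _ :: _ => 0) = blockSum l (fun _ => 0) := fun l => by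
    congr 1; funext c; cases c <;> rfl
  induction l with
  | nil => rfl
  | cons a l ih => simp only [blockSum, ih, h, add_zero]

theorem blockSum_eq_zero (l : List α) (G : List (List α) → N)
    (h : ∀ c, c.flatten = l → (∀ s ∈ c, s ≠ []) → G c = 0) : blockSum l G = 0 :=
  (blockSum_congr l G (fun _ => 0) h).trans (blockSum_zero l)

theorem map_blockSum {N' F : Type*} [AddCommMonoid N'] [FunLike F N N']
    [AddMonoidHomClass F N N'] (g : F) (l : List α) (G : List (List α) → N) :
    g (blockSum l G) = blockSum l (fun c => g (G c)) := by
  induction l generalizing G with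
  | nil => rfl
  | cons a l ih =>
    simp only [blockSum, map_add, ih]
    congr 2
    funext c
    cases c <;> simp

theorem blockSum_sum2_comm {β : Type*} (l : List α) (l' : List β)
    (F : List (List α) → List β → List β → N) :
    blockSum l (fun c => sum2 l' (F c)) = sum2 l' (fun p t => blockSum l (fun c => F c p t)) := by
  induction l' generalizing F with
  | nil => rfl
  | cons a l' ih => simp only [sum2, blockSum_add, ih]

theorem blockSum_cons (a : α) (l : List α) (G : List (List α) → N) :
    blockSum (a :: l) G = sum2 l (fun s t => blockSum t (fun c => G ((a :: s) :: c))) := by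
  induction l generalizing a G with
  | nil => simp [blockSum, sum2]
  | cons b l ih =>
    rw [blockSum, sum2, ih b (fun c => match c with
        | [] => 0
        | b :: c => G ((a :: b) :: c))]

/-- A cut of the list of blocks is a cut of the underlying word that respects the blocks, so the
word may be cut first and its two parts be divided into blocks independently. -/
theorem blockSum_sum2 (l : List α) (H : List (List α) → List (List α) → N) :
    blockSum l (fun c => sum2 c H) =
      sum2 l (fun p t => blockSum p (fun P => blockSum t (fun T => H P T))) := by
  induction l generalizing H with
  | nil => rfl
  | cons a l ih =>
    have e : (fun c : List (List α) => (match c with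
        | [] => 0
        | b :: c => sum2 ((a :: b) :: c) H : N)) = fun c =>
        (match c with
        | [] => 0
        | b :: c => H [] ((a :: b) :: c)) + sum2 c (fun P T => match P with
          | [] => 0
          | b :: P => H ((a :: b) :: P) T) := by
      funext c
      cases c <;> simp [sum2]
    simp only [blockSum, sum2]
    rw [blockSum_add]
    change _ + blockSum l (fun c : List (List α) => (match c with
        | [] => 0
        | b :: c => sum2 ((a :: b) :: c) H : N)) = _
    rw [e, blockSum_add, ih, ih, sum2_add]
    have e2 : ∀ p t : List α, blockSum p (fun P => blockSum t (fun T => (match P with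
          | [] => 0
          | b :: P => H ((a :: b) :: P) T : N))) =
        blockSum p (fun P => match P with
          | [] => 0
          | b :: P => blockSum t (fun T => H ((a :: b) :: P) T)) := fun p t => by
      congr 1
      funext P
      cases P
      · exact blockSum_zero t
      · rfl
    simp only [e2]
    abel

theorem blockSum_sum3 (l : List α) (H : List (List α) → List (List α) → List (List α) → N) :
    blockSum l (fun c => sum3 c H) =
      sum3 l (fun p s t => blockSum p (fun P => blockSum s (fun S =>
        blockSum t (fun T => H P S T)))) := by
  simp only [sum3, blockSum_sum2, blockSum_sum2_comm]

/-- Only the empty word has a cut without blocks. This isolates the case in which the block under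
consideration starts at the beginning of the word. -/
theorem sum2_blockSum_nil (u : List α) (X : List α → N) :
    sum2 u (fun U s => blockSum U (fun c => match c with
      | [] => X s
      | _ :: _ => 0)) = X u := by
  cases u with
  | nil => rfl
  | cons a u =>
    rw [sum2, sum2_eq_zero, add_zero, blockSum]
    intro p t _
    rw [blockSum]
    have h : blockSum p (fun c => match c with
        | [] => (0 : N)
        | _ :: _ => 0) = 0 := blockSum_eq_zero _ _ fun c _ _ => by cases c <;> rfl
    rw [blockSum_zero, h, add_zero]

/-- The cuts are sorted by the block `s ++ x :: s'` that contains the distinguished letter; `A` and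
`B` are the blocks before and after it. -/
theorem blockSum_append_cons (u v : List α) (x : α) (G : List (List α) → N) :
    blockSum (u ++ x :: v) G =
      sum2 u (fun U s => blockSum U (fun A => sum2 v (fun s' V => blockSum V (fun B =>
        G (A ++ (s ++ x :: s') :: B))))) := by
  induction u generalizing G with
  | nil => exact blockSum_cons x v G
  | cons a u ih =>
    rw [List.cons_append, blockSum, ih, ih, sum2]
    have e : ∀ s : List α, (fun A => sum2 v (fun s' V => blockSum V (fun B =>
          (match A ++ (s ++ x :: s') :: B with
            | [] => 0
            | b :: c => G ((a :: b) :: c) : N)))) = fun A =>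
        (match A with
          | [] => sum2 v (fun s' V => blockSum V (fun B => G ((a :: s ++ x :: s') :: B)))
          | _ :: _ => 0) + (match A with
          | [] => 0
          | b :: A => sum2 v (fun s' V => blockSum V (fun B =>
            G (((a :: b) :: A) ++ (s ++ x :: s') :: B)))) := fun s => by
      funext A
      cases A <;> simp
    simp only [e, blockSum_add, sum2_add]
    rw [sum2_blockSum_nil (N := N) u (fun s => sum2 v (fun s' V => blockSum V (fun B =>
      G ((a :: s ++ x :: s') :: B))))]
    simp only [blockSum, sum2_add]
    simp only [List.nil_append, List.cons_append]
    abel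

theorem length_le_of_flatten_eq {l : List α} {c : List (List α)} (hc : c.flatten = l)
    (h0 : ∀ s ∈ c, s ≠ []) : c.length ≤ l.length := by
  subst hc
  induction c with
  | nil => simp
  | cons b c ih =>
    simp only [List.mem_cons, forall_eq_or_imp] at h0
    have := ih h0.2
    have hb := List.length_pos_iff.mpr h0.1
    simp only [List.length_cons, List.flatten_cons, List.length_append]
    omega

theorem blockSum_length_eq (l : List α) (G : List (List α) → N) :
    blockSum l (fun c => if c.length = l.length then G c else 0) = G (l.map fun a => [a]) := by
  induction l generalizing G with
  | nil => simp [blockSum]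
  | cons a l ih =>
    simp only [blockSum, List.length_cons, Nat.add_right_cancel_iff]
    rw [ih (fun c => G ([a] :: c)), blockSum_eq_zero, add_zero]
    · simp
    · intro c hc h0
      have := length_le_of_flatten_eq hc h0
      cases c with
      | nil => rfl
      | cons b c =>
        simp only [List.length_cons] at this
        exact if_neg (by omega)

/-- Blocks are nonempty, so the cut into single letters is the only one with as many blocks as
letters. All inductions that treat substitution of `f`, with `f₁ = id`, as unitriangular rest on
this splitting. -/
theorem blockSum_eq_add (l : List α) (G : List (List α) → N) :
    blockSum l G = G (l.map fun a => [a]) +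
      blockSum l (fun c => if c.length < l.length then G c else 0) := by
  rw [← blockSum_length_eq l G, ← blockSum_add]
  refine blockSum_congr _ _ _ fun c hc h0 => ?_
  have := length_le_of_flatten_eq hc h0
  split_ifs <;> first | omega | simp

/-- All ways of cutting a word into nonempty blocks. -/
def blockCuts : List α → List (List (List α))
  | [] => [[]]
  | a :: l => (blockCuts l).map ([a] :: ·) ++ (blockCuts l).filterMap (fun c => match c with
      | [] => none
      | b :: c => some ((a :: b) :: c))

theorem blockSum_eq_sum_blockCuts (l : List α) (G : List (List α) → N) :
    blockSum l G = ((blockCuts l).map G).sum := by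
  induction l generalizing G with
  | nil => simp [blockSum, blockCuts]
  | cons a l ih =>
    simp only [blockSum, blockCuts, ih, List.map_append, List.sum_append, List.map_map,
      Function.comp_def]
    congr 1
    induction blockCuts l with
    | nil => rfl
    | cons c L ihL => cases c <;> simp [ihL]

theorem mem_blockCuts (l : List α) (c : List (List α)) :
    c ∈ blockCuts l ↔ c.flatten = l ∧ ∀ s ∈ c, s ≠ [] := by
  induction l generalizing c with
  | nil =>
    simp only [blockCuts, List.mem_singleton]
    constructor
    · rintro rfl; simp
    · rintro ⟨h1, h2⟩
      cases c with
      | nil => rfl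
      | cons b c => simp_all
  | cons a l ih =>
    simp only [blockCuts, List.mem_append, List.mem_map, List.mem_filterMap, ih]
    constructor
    · rintro (⟨c, ⟨rfl, h⟩, rfl⟩ | ⟨c, ⟨rfl, h⟩, hc⟩)
      · exact ⟨by simp, by simpa using h⟩
      · cases c with
        | nil => cases hc
        | cons b c =>
          cases hc
          refine ⟨by simp, ?_⟩
          simp only [List.mem_cons, forall_eq_or_imp] at h ⊢
          exact ⟨by simp, h.2⟩
    · rintro ⟨h1, h2⟩
      cases c with
      | nil => simp at h1
      | cons b c =>
        simp only [List.mem_cons, forall_eq_or_imp] at h2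
        obtain ⟨hb, h2⟩ := h2
        cases b with
        | nil => exact absurd rfl hb
        | cons a' b =>
          simp only [List.flatten_cons, List.cons_append, List.cons.injEq] at h1
          obtain ⟨rfl, h1⟩ := h1
          by_cases hb' : b = []
          · subst hb'
            exact Or.inl ⟨c, ⟨by simpa using h1, h2⟩, rfl⟩
          · refine Or.inr ⟨b :: c, ⟨by simpa using h1, ?_⟩, rfl⟩
            simpa using ⟨hb', h2⟩

theorem nodup_blockCuts (l : List α) : (blockCuts l).Nodup := by
  induction l with
  | nil => simp [blockCuts]
  | cons a l ih =>
    rw [blockCuts, List.nodup_append]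
    refine ⟨ih.map (List.cons_injective), ih.filterMap ?_, ?_⟩
    · intro c c' d hd hd'
      cases c with
      | nil => cases hd
      | cons b c =>
        cases c' with
        | nil => cases hd'
        | cons b' c' =>
          simp only [Option.mem_def, Option.some.injEq] at hd hd'
          subst hd
          simpa [eq_comm] using hd'
    · intro c hc d hd
      simp only [List.mem_map, List.mem_filterMap] at hc hd
      obtain ⟨c, hc, rfl⟩ := hc
      obtain ⟨d, hd, hd'⟩ := hd
      cases d with
      | nil => cases hd'
      | cons b d =>
        cases hd'
        have := ((mem_blockCuts _ _).mp hd).2 b (by simp)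
        simp_all

/-- The relation in `AInfHom` sums over compositions, whereas the recursive `blockSum` is what can
be manipulated. A composition and the list of blocks it cuts out determine each other through the
block lengths. -/
theorem sum_splitWrtComposition (l : List α) (G : List (List α) → N) :
    ∑ c : Composition l.length, G (l.splitWrtComposition c) = blockSum l G := by
  classical
  rw [blockSum_eq_sum_blockCuts, ← List.sum_toFinset G (nodup_blockCuts l)]
  refine Finset.sum_bij (fun c _ => l.splitWrtComposition c) ?_ ?_ ?_ ?_
  · intro c _
    rw [List.mem_toFinset, mem_blockCuts]
    refine ⟨List.flatten_splitWrtComposition l c, fun s hs => ?_⟩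
    exact List.length_pos_iff.mp (List.length_pos_of_mem_splitWrtComposition hs)
  · intro c _ c' _ h
    have h1 := List.map_length_splitWrtComposition l c
    rw [h, List.map_length_splitWrtComposition] at h1
    exact (Composition.ext h1).symm
  · intro L hL
    rw [List.mem_toFinset, mem_blockCuts] at hL
    obtain ⟨rfl, h0⟩ := hL
    refine ⟨⟨L.map List.length, ?_, ?_⟩, Finset.mem_univ _, ?_⟩
    · intro i hi
      obtain ⟨s, hs, rfl⟩ := List.mem_map.mp hi
      exact List.length_pos_iff.mpr (h0 s hs)
    · rw [List.length_flatten]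
    · exact List.splitWrtComposition_flatten L _ rfl
  · intro c _
    rfl

end Cuttings

/-! ## Signs -/

theorem zmod_two_mul_self (x : ZMod 2) : x * x = x := by revert x; decide

/-- Koszul signs are compared through their exponents in `ZMod 2`, where they become identities in a
commutative ring of characteristic two. Idempotence, `zmod_two_mul_self`, is supplied separately
where a degree meets itself. -/
theorem sgn_eq {k : Type*} [Field k] {a b : ℤ} (h : (a : ZMod 2) = b) :
    (-1 : k) ^ a = (-1 : k) ^ b := by
  refine sgn_congr (even_iff_two_dvd.mpr ((ZMod.intCast_zmod_eq_zero_iff_dvd _ 2).mp ?_))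
  rw [Int.cast_sub, h, sub_self]

theorem neg_sgn_eq {k : Type*} [Field k] {a b : ℤ} (h : (a : ZMod 2) + 1 = b) :
    -(-1 : k) ^ a = (-1 : k) ^ b := by
  rw [← sgn_eq (k := k) (a := a + 1) (b := b) (by push_cast; exact h), ← sgn_mul]
  simp

theorem sgn_mul_self {k : Type*} [Field k] (a : ℤ) : (-1 : k) ^ a * (-1 : k) ^ a = 1 := by
  rw [sgn_mul]
  exact (Even.neg_one_zpow ⟨a, rfl⟩)

end AInfinity

namespace AInfinity

/-! ## Multilinear families evaluated on words -/

section Families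

variable {k : Type*} [Field k] {A : Type*} [AddCommGroup A] [Module k A]
  {B : Type*} [AddCommGroup B] [Module k B]

theorem MultiFamily.ap_eq (F : MultiFamily k A B) (l : List A) {n : ℕ} (h : l.length = n) :
    F.ap l = F n (fun i => l.get (i.cast h.symm)) := by
  subst h
  rfl

theorem MultiFamily.ap_ofFn (F : MultiFamily k A B) {n : ℕ} (a : Fin n → A) :
    F.ap (List.ofFn a) = F n a := by
  rw [F.ap_eq _ (List.length_ofFn (f := a))]
  congr 1
  funext i
  simp

theorem MultiFamily.ap_nil (F : MultiFamily k A B) (h : F 0 = 0) : F.ap [] = 0 := by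
  change F 0 _ = 0
  rw [h]
  rfl

/-- Written as an update at one index, the value on a word exposes its linearity in one letter; the
entry `0` is a placeholder that the update overwrites. -/
theorem MultiFamily.ap_append_cons (F : MultiFamily k A B) (u v : List A) (a : A) :
    F.ap (u ++ a :: v) = F (u.length + v.length + 1) (Function.update
      (fun i => (u ++ 0 :: v).get (i.cast (by simp [add_assoc])))
      ⟨u.length, by omega⟩ a) := by
  rw [F.ap_eq (n := u.length + v.length + 1) _ (by simp [add_assoc])]
  congr 1
  funext i
  by_cases hi : i = ⟨u.length, by omega⟩
  · subst hi
    simp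
  · rw [Function.update_of_ne hi]
    have hne : (i : ℕ) ≠ u.length := fun h => hi (Fin.ext h)
    simp only [List.get_eq_getElem, Fin.val_cast]
    rcases lt_or_gt_of_ne hne with h | h
    · rw [List.getElem_append_left h, List.getElem_append_left h]
    · rw [List.getElem_append_right h.le, List.getElem_append_right h.le]
      obtain ⟨j, hj⟩ : ∃ j, (i : ℕ) - u.length = j + 1 := ⟨i - u.length - 1, by omega⟩
      simp only [hj, List.getElem_cons_succ]

/-- A multilinear family as a linear map of one of its arguments. -/
def MultiFamily.slot (F : MultiFamily k A B) (u v : List A) : A →ₗ[k] B where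
  toFun a := F.ap (u ++ a :: v)
  map_add' a b := by simp only [ap_append_cons, MultilinearMap.map_update_add]
  map_smul' r a := by
    simp only [ap_append_cons, MultilinearMap.map_update_smul, RingHom.id_apply]

theorem MultiFamily.slot_apply (F : MultiFamily k A B) (u v : List A) (a : A) :
    F.slot u v a = F.ap (u ++ a :: v) := rfl

/-- A family of bimodule type as a function of its first group of arguments. -/
def BiFamily.left (φ : BiFamily k A) (x : A) (b : List A) (y : A) : MultiFamily k A k := fun n =>
  LinearMap.compMultilinearMap
    { toFun := fun T => T x b.get y
      map_add' := fun _ _ => rfl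
      map_smul' := fun _ _ => rfl } (φ n b.length)

/-- A family of bimodule type as a function of its second group of arguments. -/
def BiFamily.right (φ : BiFamily k A) (a : List A) (x : A) (y : A) : MultiFamily k A k := fun n =>
  LinearMap.compMultilinearMap
    { toFun := fun T => T y
      map_add' := fun _ _ => rfl
      map_smul' := fun _ _ => rfl } (φ a.length n a.get x)

/-- A family of bimodule type as a function of its module argument. -/
def BiFamily.mid (φ : BiFamily k A) (a : List A) (b : List A) (y : A) : A →ₗ[k] k where
  toFun x := φ.ap a x b y
  map_add' x x' := by simp [BiFamily.ap]
  map_smul' r x := by simp [BiFamily.ap]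

/-- A family of bimodule type as a function of its last argument. -/
def BiFamily.last (φ : BiFamily k A) (a : List A) (x : A) (b : List A) : A →ₗ[k] k where
  toFun y := φ.ap a x b y
  map_add' x x' := by simp [BiFamily.ap]
  map_smul' r x := by simp [BiFamily.ap]

theorem BiFamily.ap_ofFn (φ : BiFamily k A) {n m : ℕ} (a : Fin n → A) (x : A) (b : Fin m → A)
    (y : A) : φ.ap (List.ofFn a) x (List.ofFn b) y = φ n m a x b y := by
  change (φ.left x _ y).ap _ = _
  rw [MultiFamily.ap_ofFn]
  let F : MultiFamily k A k := fun m => LinearMap.compMultilinearMap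
    { toFun := fun T => T y
      map_add' := fun _ _ => rfl
      map_smul' := fun _ _ => rfl } (φ n m a x)
  exact F.ap_ofFn b

/-- Recursion on the arity for families whose component `n` is prescribed in terms of the components
below `n`. Both the Darboux coordinate change and the transported operations are constructed in this
way. -/
theorem MultiFamily.exists_eq_step (step : MultiFamily k A B → MultiFamily k A B)
    (hstep : ∀ F F' n, (∀ i < n, F i = F' i) → step F n = step F' n) :
    ∃ F : MultiFamily k A B, ∀ n, F n = step F n := by
  -- The components not yet constructed are filled with zero; by `hstep` the filling has no
  -- influence on component `n`.
  let G : ∀ n, (∀ i, i < n → MultilinearMap k (fun _ : Fin i => A) B) →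
      MultilinearMap k (fun _ : Fin n => A) B :=
    fun n ih => step (fun i => if h : i < n then ih i h else 0) n
  refine ⟨fun n => WellFounded.fix (C := fun n => MultilinearMap k (fun _ : Fin n => A) B)
    Nat.lt_wfRel.wf G n, fun n => ?_⟩
  change WellFounded.fix _ G n = _
  rw [WellFounded.fix_eq]
  refine hstep _ _ n fun i hi => ?_
  rw [dif_pos hi]

end Families

/-! ## Functions of homogeneous elements -/

section Homogeneous

variable {k : Type*} [Field k] {A : Type*} [AddCommGroup A] [Module k A]
  {𝒜 : ℤ → Submodule k A} {N : Type*} [AddCommGroup N] [Module k N]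

theorem HElt.ext' {h h' : HElt 𝒜} (h1 : h.1 = h'.1) (h2 : (h.2 : A) = h'.2) : h = h' := by
  obtain ⟨n, a⟩ := h
  obtain ⟨n', a'⟩ := h'
  dsimp at h1 h2
  subst h1
  rw [Subtype.ext h2]

theorem vals_nil : vals ([] : List (HElt 𝒜)) = [] := rfl

theorem vals_cons (x : HElt 𝒜) (l : List (HElt 𝒜)) : vals (x :: l) = (x.2 : A) :: vals l := rfl

theorem vals_append (l l' : List (HElt 𝒜)) : vals (l ++ l') = vals l ++ vals l' := by
  simp [vals]

theorem length_vals (l : List (HElt 𝒜)) : (vals l).length = l.length := by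
  simp [vals]

theorem wdeg_nil : wdeg ([] : List (HElt 𝒜)) = 0 := rfl

theorem wdeg_cons (x : HElt 𝒜) (l : List (HElt 𝒜)) : wdeg (x :: l) = x.1 + wdeg l := by
  simp [wdeg]

theorem wdeg_append (l l' : List (HElt 𝒜)) : wdeg (l ++ l') = wdeg l + wdeg l' := by
  simp [wdeg]

/-- A function of a homogeneous element that is linear in each degree. -/
def HLin (g : HElt 𝒜 → N) : Prop := ∀ n, IsLinearMap k (fun a : 𝒜 n => g ⟨n, a⟩)

theorem HLin.of_linear (f : A →ₗ[k] N) : HLin (fun h : HElt 𝒜 => f h.2) := fun n =>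
  (f ∘ₗ (𝒜 n).subtype).isLinear

namespace HLin

variable {g g' : HElt 𝒜 → N}

theorem zero : HLin (fun _ : HElt 𝒜 => (0 : N)) := fun _ => ⟨fun _ _ => by simp, fun _ _ => by simp⟩

theorem add (hg : HLin g) (hg' : HLin g') : HLin (fun h => g h + g' h) := fun n =>
  (IsLinearMap.mk' _ (hg n) + IsLinearMap.mk' _ (hg' n)).isLinear

/-- This closure property is the reason for asking linearity in each degree only: Koszul signs
depend on the degree and would destroy linearity across degrees. -/
theorem smul_deg (c : ℤ → k) (hg : HLin g) : HLin (fun h => c h.1 • g h) := fun n =>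
  (c n • IsLinearMap.mk' _ (hg n)).isLinear

theorem mul_deg {g : HElt 𝒜 → k} (c : ℤ → k) (hg : HLin g) : HLin (fun h => c h.1 * g h) :=
  hg.smul_deg c

theorem neg (hg : HLin g) : HLin (fun h => -g h) := by
  simpa using hg.smul_deg (fun _ => -1)

theorem sub (hg : HLin g) (hg' : HLin g') : HLin (fun h => g h - g' h) := by
  simpa [sub_eq_add_neg] using hg.add hg'.neg

theorem map {N' : Type*} [AddCommGroup N'] [Module k N'] (hg : HLin g) (f : N →ₗ[k] N') :
    HLin (fun h => f (g h)) := fun n =>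
  (f ∘ₗ IsLinearMap.mk' _ (hg n)).isLinear

theorem sum2 {α : Type*} {F : List α → List α → HElt 𝒜 → N} (l : List α)
    (hF : ∀ p t, HLin (F p t)) : HLin (fun h => AInfinity.sum2 l (fun p t => F p t h)) := by
  induction l generalizing F with
  | nil => exact hF _ _
  | cons a l ih => exact (hF _ _).add (ih fun p t => hF _ _)

theorem blockSum {α : Type*} {F : List (List α) → HElt 𝒜 → N} (l : List α)
    (hF : ∀ c, HLin (F c)) : HLin (fun h => AInfinity.blockSum l (fun c => F c h)) := by
  induction l generalizing F with
  | nil => exact hF _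
  | cons a l ih =>
    refine (ih fun c => hF _).add ?_
    exact ih (F := fun c h => match c with
      | [] => 0
      | b :: c => F ((a :: b) :: c) h) fun c => by
        cases c
        · exact zero
        · exact hF _

theorem map_zero' (hg : HLin g) (n : ℤ) : g ⟨n, 0⟩ = 0 := (hg n).map_zero

end HLin

/-- A function of a word of homogeneous elements that is linear in each letter. -/
def WLin (T : List (HElt 𝒜) → N) : Prop := ∀ u v, HLin (fun h => T (u ++ h :: v))

namespace WLin

variable {T T' : List (HElt 𝒜) → N}

theorem zero : WLin (fun _ : List (HElt 𝒜) => (0 : N)) := fun _ _ => HLin.zero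

theorem add (hT : WLin T) (hT' : WLin T') : WLin (fun l => T l + T' l) := fun u v =>
  (hT u v).add (hT' u v)

theorem sub (hT : WLin T) (hT' : WLin T') : WLin (fun l => T l - T' l) := fun u v =>
  (hT u v).sub (hT' u v)

theorem map {N' : Type*} [AddCommGroup N'] [Module k N'] (hT : WLin T) (f : N →ₗ[k] N') :
    WLin (fun l => f (T l)) := fun u v => (hT u v).map f

theorem smul_deg (c : ℤ → k) (hT : WLin T) : WLin (fun l => c (wdeg l) • T l) := fun u v => by
  simpa only [wdeg_append, wdeg_cons] using
    (hT u v).smul_deg (fun d => c (wdeg u + (d + wdeg v)))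

theorem mul_deg {T : List (HElt 𝒜) → k} (c : ℤ → k) (hT : WLin T) :
    WLin (fun l => c (wdeg l) * T l) := hT.smul_deg c

theorem ap {A' : Type*} [AddCommGroup A'] [Module k A'] (F : MultiFamily k A A') (U V : List A) :
    WLin (fun l : List (HElt 𝒜) => F.ap (U ++ (vals l ++ V))) := fun u v => by
  simpa only [F.slot_apply, vals_append, vals_cons, List.append_assoc, List.cons_append] using
    HLin.of_linear (𝒜 := 𝒜) (F.slot (U ++ vals u) (vals v ++ V))

theorem ap_vals {A' : Type*} [AddCommGroup A'] [Module k A'] (F : MultiFamily k A A') :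
    WLin (fun l : List (HElt 𝒜) => F.ap (vals l)) := by
  simpa using ap (𝒜 := 𝒜) F [] []

theorem sum2_right {α : Type*} {F : List α → List α → List (HElt 𝒜) → N} (l : List α)
    (hF : ∀ p t, WLin (F p t)) : WLin (fun x => AInfinity.sum2 l (fun p t => F p t x)) :=
  fun u v => HLin.sum2 l fun p t => hF p t u v

theorem sum3_right {α : Type*} {F : List α → List α → List α → List (HElt 𝒜) → N} (l : List α)
    (hF : ∀ p s t, WLin (F p s t)) :
    WLin (fun x => AInfinity.sum3 l (fun p s t => F p s t x)) :=
  sum2_right l fun p r => sum2_right r fun s t => hF p s t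

theorem sum2 {F : List (HElt 𝒜) → List (HElt 𝒜) → N} (h1 : ∀ t, WLin (fun p => F p t))
    (h2 : ∀ p, WLin (fun t => F p t)) : WLin (fun l => AInfinity.sum2 l F) := fun u v => by
  simp only [sum2_append_cons]
  refine HLin.add (HLin.sum2 u fun p t => ?_) (HLin.sum2 v fun p t => ?_)
  · exact h2 p t v
  · exact h1 t u p

theorem sum3 {F : List (HElt 𝒜) → List (HElt 𝒜) → List (HElt 𝒜) → N}
    (h1 : ∀ s t, WLin (fun p => F p s t)) (h2 : ∀ p t, WLin (fun s => F p s t))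
    (h3 : ∀ p s, WLin (fun t => F p s t)) : WLin (fun l => AInfinity.sum3 l F) :=
  sum2 (fun t => sum2_right t fun s r => h1 s r)
    (fun p => sum2 (fun t => h2 p t) (fun s => h3 p s))

theorem blockSum {G : List (List (HElt 𝒜)) → N}
    (h : ∀ P Q, WLin (fun s => G (P ++ s :: Q))) : WLin (fun l => AInfinity.blockSum l G) :=
  fun u v => by
  simp only [blockSum_append_cons]
  exact HLin.sum2 u fun U s => HLin.blockSum U fun P => HLin.sum2 v fun s' V =>
    HLin.blockSum V fun Q => h P Q s s'

end WLin

section Basis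

variable {ι : Type*} (e : Module.Basis ι k A) {deg : ι → ℤ} (hdeg : ∀ i, e i ∈ 𝒜 (deg i))

/-- A member of a homogeneous basis as a homogeneous element. -/
noncomputable def basisElt (i : ι) : HElt 𝒜 := ⟨deg i, e i, hdeg i⟩

theorem vals_map_basisElt (I : List ι) : vals (I.map (basisElt e hdeg)) = I.map e := by
  simp [vals, basisElt]

theorem wdeg_map_basisElt (I : List ι) : wdeg (I.map (basisElt e hdeg)) = (I.map deg).sum := by
  simp [wdeg, basisElt, Function.comp_def]

/-- By `repr_eq_zero_of_mem`, a homogeneous element of degree `n` is a combination of basis vectors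
of degree `n`, and within that degree both functions are linear. -/
theorem HLin.ext_basis (h𝒜 : DirectSum.IsInternal 𝒜) {g g' : HElt 𝒜 → N} (hg : HLin g)
    (hg' : HLin g') (h : ∀ i, g (basisElt e hdeg i) = g' (basisElt e hdeg i)) (x : HElt 𝒜) :
    g x = g' x := by
  classical
  obtain ⟨n, a, ha⟩ := x
  -- Basis vectors of other degrees are replaced by zero, which is harmless because their
  -- coordinates in `a` vanish.
  let E : ι → 𝒜 n := fun i => if hi : deg i = n then ⟨e i, hi ▸ hdeg i⟩ else 0
  have hE : (⟨a, ha⟩ : 𝒜 n) = (e.repr a).sum fun i r => r • E i := by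
    refine Subtype.ext ?_
    change a = _
    conv_lhs => rw [← e.linearCombination_repr a]
    rw [Finsupp.linearCombination_apply, Finsupp.sum, Finsupp.sum, AddSubmonoidClass.coe_finsetSum]
    refine Finset.sum_congr rfl fun i hi => ?_
    have := repr_eq_zero_of_mem h𝒜 e deg hdeg n a ha i (Finsupp.mem_support_iff.mp hi)
    simp [E, this]
  have hgE : ∀ i, g ⟨n, E i⟩ = g' ⟨n, E i⟩ := fun i => by
    by_cases hi : deg i = n
    · subst hi
      simp only [E, dif_pos]
      exact h i
    · simp only [E, dif_neg hi]
      rw [hg.map_zero', hg'.map_zero']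
  have key := (LinearMap.congr_arg (f := IsLinearMap.mk' _ (hg n)) hE)
  have key' := (LinearMap.congr_arg (f := IsLinearMap.mk' _ (hg' n)) hE)
  simp only [Finsupp.sum, map_sum, map_smul, IsLinearMap.mk'_apply] at key key'
  rw [key, key']
  exact Finset.sum_congr rfl fun i _ => by rw [hgE]

theorem WLin.ext_basis (h𝒜 : DirectSum.IsInternal 𝒜) {T T' : List (HElt 𝒜) → N} (hT : WLin T)
    (hT' : WLin T')
    (h : ∀ I : List ι, T (I.map (basisElt e hdeg)) = T' (I.map (basisElt e hdeg)))
    (x : List (HElt 𝒜)) : T x = T' x := by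
  -- The letters are replaced by basis elements from left to right; `I` is the part already
  -- replaced.
  suffices H : ∀ I : List ι, T (I.map (basisElt e hdeg) ++ x) =
      T' (I.map (basisElt e hdeg) ++ x) from H []
  induction x with
  | nil => simpa using h
  | cons a x ih =>
    intro I
    refine HLin.ext_basis e hdeg h𝒜 (hT (I.map (basisElt e hdeg)) x)
      (hT' (I.map (basisElt e hdeg)) x) (fun i => ?_) a
    simpa using ih (I ++ [i])

/-- The product of the `I i`-th coordinates of the `i`-th arguments. -/
noncomputable def coordProd {n : ℕ} (I : Fin n → ι) : MultilinearMap k (fun _ : Fin n => A) k :=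
  (MultilinearMap.mkPiAlgebra k (Fin n) k).compLinearMap fun i => e.coord (I i)

theorem coordProd_apply {n : ℕ} (I : Fin n → ι) (a : Fin n → A) :
    coordProd e I a = ∏ i, e.repr (a i) (I i) := rfl

theorem coordProd_basis [DecidableEq ι] {n : ℕ} (I J : Fin n → ι) :
    coordProd e I (fun i => e (J i)) = if I = J then 1 else 0 := by
  rw [coordProd_apply]
  split_ifs with h
  · subst h
    simp
  · obtain ⟨i, hi⟩ := Function.ne_iff.mp h
    exact Finset.prod_eq_zero (Finset.mem_univ i) (by simp [Ne.symm hi])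

variable [Fintype ι]

/-- The multilinear family with given values on the words in a basis. -/
noncomputable def familyOfWords (T : List ι → N) : MultiFamily k A N := fun _ =>
  ∑ I, (coordProd e I).smulRight (T (List.ofFn I))

theorem familyOfWords_ap (T : List ι → N) (I : List ι) :
    (familyOfWords e T).ap (I.map e) = T I := by
  classical
  obtain ⟨n, J, rfl⟩ : ∃ (n : ℕ) (J : Fin n → ι), I = List.ofFn J :=
    ⟨I.length, I.get, (List.ofFn_get I).symm⟩
  rw [List.map_ofFn, MultiFamily.ap_ofFn, familyOfWords, sum_apply,
    Finset.sum_eq_single J]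
  · rw [MultilinearMap.smulRight_apply]
    have := coordProd_basis e J J
    rw [if_pos rfl] at this
    change coordProd e J (fun i => e (J i)) • _ = _
    rw [this, one_smul]
  · intro I _ hI
    rw [MultilinearMap.smulRight_apply]
    have := coordProd_basis e I J
    rw [if_neg hI] at this
    change coordProd e I (fun i => e (J i)) • _ = _
    rw [this, zero_smul]
  · simp

theorem familyOfWords_congr (T T' : List ι → N) (n : ℕ)
    (h : ∀ I : List ι, I.length = n → T I = T' I) :
    (familyOfWords e T : MultiFamily k A N) n = familyOfWords e T' n := by
  simp only [familyOfWords]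
  exact Finset.sum_congr rfl fun I _ => by rw [h _ (List.length_ofFn)]

/-- A function defined only on words of homogeneous elements, typically with degree-dependent signs,
is realised by an honest multilinear family. -/
theorem familyOfWords_ap_vals (h𝒜 : DirectSum.IsInternal 𝒜) {T : List (HElt 𝒜) → N}
    (hT : WLin T) (x : List (HElt 𝒜)) :
    (familyOfWords e fun I => T (I.map (basisElt e hdeg))).ap (vals x) = T x := by
  refine WLin.ext_basis e hdeg h𝒜 (WLin.ap_vals _) hT (fun I => ?_) x
  rw [vals_map_basisElt, familyOfWords_ap]

/-- The family of bimodule type with given values on a basis. -/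
noncomputable def biFamilyOfCoeff (C : TwoFormCoeff ι k) : BiFamily k A := fun p q =>
  ∑ I : Fin p → ι, ∑ i, ∑ J : Fin q → ι, ∑ j, (coordProd e I).smulRight
    ((e.coord i).smulRight ((coordProd e J).smulRight
      (C (List.ofFn I) i (List.ofFn J) j • e.coord j)))

theorem biFamilyOfCoeff_ap (C : TwoFormCoeff ι k) (I : List ι) (i : ι) (J : List ι) (j : ι) :
    (biFamilyOfCoeff e C).ap (I.map e) (e i) (J.map e) (e j) = C I i J j := by
  classical
  obtain ⟨n, I, rfl⟩ : ∃ (n : ℕ) (J : Fin n → ι), I = List.ofFn J :=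
    ⟨I.length, I.get, (List.ofFn_get I).symm⟩
  obtain ⟨m, J, rfl⟩ : ∃ (n : ℕ) (I : Fin n → ι), J = List.ofFn I :=
    ⟨J.length, J.get, (List.ofFn_get J).symm⟩
  rw [List.map_ofFn, List.map_ofFn, BiFamily.ap_ofFn, biFamilyOfCoeff]
  have h : ∀ {n : ℕ} (I J : Fin n → ι), coordProd e I (e ∘ J) = if I = J then 1 else 0 :=
    fun I J => coordProd_basis e I J
  simp only [sum_apply, LinearMap.sum_apply, MultilinearMap.smulRight_apply,
    LinearMap.smul_apply, smul_apply, LinearMap.smulRight_apply, h]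
  simp [Finsupp.single_apply]

end Basis

end Homogeneous

end AInfinity

namespace AInfinity

/-! ## Skew symmetric and closed functions -/

section SkewClosed

variable {k : Type*} [Field k] {A : Type u} [AddCommGroup A] [Module k A]
  {𝒜 : ℤ → Submodule k A}

/-- Functions of two marked elements on a cyclic word: the word is `a x b y`, with `x` and `y`
marked. -/
abbrev TwoMarked (𝒜 : ℤ → Submodule k A) :=
  List (HElt 𝒜) → HElt 𝒜 → List (HElt 𝒜) → HElt 𝒜 → k

namespace TwoMarked

/-- Skew symmetry under the exchange of the marked elements. -/
def IsSkew (T : TwoMarked 𝒜) : Prop := ∀ a x b y,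
  T a x b y = -((-1 : k) ^ ((wdeg a + x.1) * (wdeg b + y.1)) * T b y a x)

/-- Closedness, for cyclic words that start with the first of the three marked elements. -/
def IsClosed (T : TwoMarked 𝒜) : Prop := ∀ x Q y R z W,
  (-1 : k) ^ ((x.1 + wdeg Q + y.1) * (wdeg R + z.1 + wdeg W)) * T (R ++ z :: W) x Q y +
  (-1 : k) ^ ((x.1 + wdeg Q + y.1 + wdeg R + z.1) * wdeg W) * T (W ++ x :: Q) y R z +
  (-1 : k) ^ (x.1 * (wdeg Q + y.1 + wdeg R + z.1 + wdeg W)) * T (Q ++ y :: R) z W x = 0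

theorem IsSkew.sub {T T' : TwoMarked 𝒜} (hT : T.IsSkew) (hT' : T'.IsSkew) :
    IsSkew (fun a x b y => T a x b y - T' a x b y : TwoMarked 𝒜) := fun a x b y => by
  simp only []
  linear_combination hT a x b y - hT' a x b y

theorem IsClosed.sub {T T' : TwoMarked 𝒜} (hT : T.IsClosed) (hT' : T'.IsClosed) :
    IsClosed (fun a x b y => T a x b y - T' a x b y : TwoMarked 𝒜) := fun x Q y R z W => by
  simp only []
  linear_combination hT x Q y R z W - hT' x Q y R z W

end TwoMarked

/-- The family `P x Q y R z S` is a cyclic rotation of `x Q y R z S P`, and moving `P` to the end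
multiplies all three terms by the same Koszul sign. -/
theorem PreBimoduleMap.isClosed_iff {D : ℤ} (Φ : PreBimoduleMap 𝒜 D) :
    Φ.IsClosed ↔ TwoMarked.IsClosed Φ.ev := by
  constructor
  · intro h x Q y R z W
    have := h [] x Q y R z W
    simpa [wdeg_nil] using this
  · intro h P x Q y R z S
    have h0 := h x Q y R z (S ++ P)
    have h1 : (-1 : k) ^ ((wdeg P + x.1 + wdeg Q + y.1) * (wdeg R + z.1 + wdeg S)) =
        (-1 : k) ^ (wdeg P * (x.1 + wdeg Q + y.1 + wdeg R + z.1 + wdeg S)) *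
          (-1 : k) ^ ((x.1 + wdeg Q + y.1) * (wdeg R + z.1 + wdeg (S ++ P))) := by
      rw [sgn_mul]; refine sgn_eq ?_; simp only [wdeg_append]; push_cast; grind
    have h2 : (-1 : k) ^ ((wdeg P + x.1 + wdeg Q + y.1 + wdeg R + z.1) * wdeg S) =
        (-1 : k) ^ (wdeg P * (x.1 + wdeg Q + y.1 + wdeg R + z.1 + wdeg S)) *
          (-1 : k) ^ ((x.1 + wdeg Q + y.1 + wdeg R + z.1) * wdeg (S ++ P)) := by
      rw [sgn_mul]; refine sgn_eq ?_; simp only [wdeg_append]; push_cast; grind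
    have h3 : (-1 : k) ^ ((wdeg P + x.1) * (wdeg Q + y.1 + wdeg R + z.1 + wdeg S)) =
        (-1 : k) ^ (wdeg P * (x.1 + wdeg Q + y.1 + wdeg R + z.1 + wdeg S)) *
          (-1 : k) ^ (x.1 * (wdeg Q + y.1 + wdeg R + z.1 + wdeg (S ++ P))) := by
      rw [sgn_mul]; refine sgn_eq ?_; simp only [wdeg_append]; push_cast; grind
    rw [h1, h2, h3]
    simp only [List.append_assoc, List.cons_append] at h0 ⊢
    linear_combination
      (-1 : k) ^ (wdeg P * (x.1 + wdeg Q + y.1 + wdeg R + z.1 + wdeg S)) * h0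

/-- The shape in which terms of two arc sums are matched: `a` and `d` are outer signs, `b` and `e`
the signs inside a pullback, and `c` the sign of exchanging the two arcs. -/
theorem sgn_transport {a b c d e : ℤ} (h : (a : ZMod 2) + b + c = d + e) (X : k) :
    (-1 : k) ^ a * ((-1 : k) ^ b * -((-1 : k) ^ c * X)) =
      -((-1 : k) ^ d * ((-1 : k) ^ e * X)) := by
  have : (-1 : k) ^ a * (-1 : k) ^ b * (-1 : k) ^ c = (-1 : k) ^ d * (-1 : k) ^ e := by
    rw [sgn_mul, sgn_mul, sgn_mul]
    exact sgn_eq (by push_cast; exact h)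
  linear_combination -X * this

/-! ### Skew symmetry and closedness of pullbacks of a constant pairing -/

section Pullback

variable {B : Type u} [AddCommGroup B] [Module k B] {ℬ : ℤ → Submodule k B}
  {f : MultiFamily k A B} {ψ : B →ₗ[k] B →ₗ[k] k}

theorem pairing_ap_swap (hf : ∀ x : List (HElt 𝒜), f.ap (vals x) ∈ ℬ (wdeg x))
    (hψ : ∀ x y : HElt ℬ, ψ x.2 y.2 = -((-1 : k) ^ (x.1 * y.1) * ψ y.2 x.2))
    (u v : List (HElt 𝒜)) : ψ (f.ap (vals u)) (f.ap (vals v)) =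
      -((-1 : k) ^ (wdeg u * wdeg v) * ψ (f.ap (vals v)) (f.ap (vals u))) :=
  hψ ⟨wdeg u, _, hf u⟩ ⟨wdeg v, _, hf v⟩

theorem pullback_eq (a : List (HElt 𝒜)) (x : HElt 𝒜) (b : List (HElt 𝒜)) (y : HElt 𝒜) :
    pullback 𝒜 f ψ a x b y = sum2 a (fun p s => sum2 b (fun s' t =>
      (-1 : k) ^ (wdeg p * (wdeg s + x.1 + wdeg s' + wdeg t + y.1)) *
        ψ (f.ap (vals (s ++ x :: s'))) (f.ap (vals (t ++ y :: p))))) := by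
  simp only [pullback, vals_append, vals_cons]

/-- Both sides run over the same cuts into an arc around `x` and an arc around `y`; corresponding
terms differ by the skew symmetry of `ψ`. -/
theorem pullback_isSkew (hf : ∀ x : List (HElt 𝒜), f.ap (vals x) ∈ ℬ (wdeg x))
    (hψ : ∀ x y : HElt ℬ, ψ x.2 y.2 = -((-1 : k) ^ (x.1 * y.1) * ψ y.2 x.2)) :
    TwoMarked.IsSkew (pullback 𝒜 f ψ) := by
  intro a x b y
  simp only [pullback_eq]
  rw [sum2_comm b a]
  simp only [← sum2_mul, ← sum2_neg]
  refine sum2_congr _ _ _ fun p s ha => sum2_congr _ _ _ fun s' t hb => ?_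
  subst ha hb
  have := sgn_transport (a := 0) (b := wdeg p * (wdeg s + x.1 + wdeg s' + wdeg t + y.1))
    (c := wdeg (s ++ x :: s') * wdeg (t ++ y :: p))
    (d := (wdeg (p ++ s) + x.1) * (wdeg (s' ++ t) + y.1))
    (e := wdeg s' * (wdeg t + y.1 + wdeg p + wdeg s + x.1))
    (by simp only [wdeg_append, wdeg_cons]; push_cast; grind)
    (ψ (f.ap (vals (t ++ y :: p))) (f.ap (vals (s ++ x :: s'))))
  rw [pairing_ap_swap hf hψ, ← this]
  simp

/-- In each of the three terms two marked elements lie in different arcs, and the third lies in one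
of these arcs. The six resulting sums cancel in pairs, according to which marked element is alone in
its arc. -/
theorem pullback_isClosed (hf : ∀ x : List (HElt 𝒜), f.ap (vals x) ∈ ℬ (wdeg x))
    (hψ : ∀ x y : HElt ℬ, ψ x.2 y.2 = -((-1 : k) ^ (x.1 * y.1) * ψ y.2 x.2)) :
    TwoMarked.IsClosed (pullback 𝒜 f ψ) := by
  intro x Q y R z W
  simp only [pullback_eq, sum2_append_cons]
  -- The cuts for which `y` is alone in its arc.
  have e1 : (-1 : k) ^ ((x.1 + wdeg Q + y.1) * (wdeg R + z.1 + wdeg W)) *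
      sum2 R (fun p s => sum2 Q (fun s' t =>
        (-1 : k) ^ (wdeg p * (wdeg (s ++ z :: W) + x.1 + wdeg s' + wdeg t + y.1)) *
        ψ (f.ap (vals ((s ++ z :: W) ++ x :: s'))) (f.ap (vals (t ++ y :: p))))) =
      -((-1 : k) ^ ((x.1 + wdeg Q + y.1 + wdeg R + z.1) * wdeg W) *
      sum2 Q (fun p s => sum2 R (fun s' t =>
        (-1 : k) ^ (wdeg (W ++ x :: p) * (wdeg s + y.1 + wdeg s' + wdeg t + z.1)) *
        ψ (f.ap (vals (s ++ y :: s'))) (f.ap (vals (t ++ z :: (W ++ x :: p))))))) := by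
    rw [sum2_comm Q R]
    simp only [← sum2_mul, ← sum2_neg]
    refine sum2_congr _ _ _ fun p s ha => sum2_congr _ _ _ fun s' t hb => ?_
    subst ha hb
    rw [pairing_ap_swap hf hψ]
    simp only [List.append_assoc, List.cons_append]
    refine sgn_transport ?_ _
    simp only [wdeg_append, wdeg_cons]; push_cast; grind
  -- The cuts for which `x` is alone in its arc.
  have e2 : (-1 : k) ^ ((x.1 + wdeg Q + y.1) * (wdeg R + z.1 + wdeg W)) *
      sum2 W (fun p s => sum2 Q (fun s' t =>
        (-1 : k) ^ (wdeg (R ++ z :: p) * (wdeg s + x.1 + wdeg s' + wdeg t + y.1)) *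
        ψ (f.ap (vals (s ++ x :: s'))) (f.ap (vals (t ++ y :: (R ++ z :: p)))))) =
      -((-1 : k) ^ (x.1 * (wdeg Q + y.1 + wdeg R + z.1 + wdeg W)) *
      sum2 Q (fun p s => sum2 W (fun s' t =>
        (-1 : k) ^ (wdeg p * (wdeg (s ++ y :: R) + z.1 + wdeg s' + wdeg t + x.1)) *
        ψ (f.ap (vals ((s ++ y :: R) ++ z :: s'))) (f.ap (vals (t ++ x :: p)))))) := by
    rw [sum2_comm Q W]
    simp only [← sum2_mul, ← sum2_neg]
    refine sum2_congr _ _ _ fun p s ha => sum2_congr _ _ _ fun s' t hb => ?_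
    subst ha hb
    rw [pairing_ap_swap hf hψ]
    simp only [List.append_assoc, List.cons_append]
    refine sgn_transport ?_ _
    simp only [wdeg_append, wdeg_cons]; push_cast
    have := zmod_two_mul_self (x.1 : ZMod 2)
    grind
  -- The cuts for which `z` is alone in its arc.
  have e3 : (-1 : k) ^ ((x.1 + wdeg Q + y.1 + wdeg R + z.1) * wdeg W) *
      sum2 W (fun p s => sum2 R (fun s' t =>
        (-1 : k) ^ (wdeg p * (wdeg (s ++ x :: Q) + y.1 + wdeg s' + wdeg t + z.1)) *
        ψ (f.ap (vals ((s ++ x :: Q) ++ y :: s'))) (f.ap (vals (t ++ z :: p))))) =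
      -((-1 : k) ^ (x.1 * (wdeg Q + y.1 + wdeg R + z.1 + wdeg W)) *
      sum2 R (fun p s => sum2 W (fun s' t =>
        (-1 : k) ^ (wdeg (Q ++ y :: p) * (wdeg s + z.1 + wdeg s' + wdeg t + x.1)) *
        ψ (f.ap (vals (s ++ z :: s'))) (f.ap (vals (t ++ x :: (Q ++ y :: p))))))) := by
    rw [sum2_comm R W]
    simp only [← sum2_mul, ← sum2_neg]
    refine sum2_congr _ _ _ fun p s ha => sum2_congr _ _ _ fun s' t hb => ?_
    subst ha hb
    rw [pairing_ap_swap hf hψ]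
    simp only [List.append_assoc, List.cons_append]
    refine sgn_transport ?_ _
    simp only [wdeg_append, wdeg_cons]; push_cast
    grind
  linear_combination e1 + e2 + e3

end Pullback

end SkewClosed

end AInfinity

namespace AInfinity

/-! ## Sums over marked letters -/

section Mark

variable {α N : Type*} [AddCommMonoid N]

/-- The sum of `F p x q` over all ways of writing a word as `p x q` with a letter `x`. -/
def sumMark : List α → (List α → α → List α → N) → N
  | [], _ => 0
  | a :: l, F => F [] a l + sumMark l (fun p x q => F (a :: p) x q)

theorem sumMark_append_cons (u v : List α) (x : α) (F : List α → α → List α → N) :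
    sumMark (u ++ x :: v) F = sumMark u (fun p y q => F p y (q ++ x :: v)) + F u x v +
      sumMark v (fun p y q => F (u ++ x :: p) y q) := by
  induction u generalizing F with
  | nil => simp [sumMark]
  | cons a u ih => simp only [List.cons_append, sumMark, ih, add_assoc]

theorem sumMark_congr (l : List α) (F G : List α → α → List α → N)
    (h : ∀ p x q, p ++ x :: q = l → F p x q = G p x q) : sumMark l F = sumMark l G := by
  induction l generalizing F G with
  | nil => rfl
  | cons a l ih =>
    simp only [sumMark]
    rw [h [] a l rfl, ih _ (fun p x q => G (a :: p) x q) fun p x q hl => h _ _ _ (by simp [hl])]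

theorem sumMark_const (l : List α) (c : N) : sumMark l (fun _ _ _ => c) = l.length • c := by
  induction l with
  | nil => simp [sumMark]
  | cons a l ih => rw [sumMark, ih, List.length_cons, succ_nsmul']

theorem sumMark_add (l : List α) (F G : List α → α → List α → N) :
    sumMark l (fun p x q => F p x q + G p x q) = sumMark l F + sumMark l G := by
  induction l generalizing F G with
  | nil => simp [sumMark]
  | cons a l ih => simp only [sumMark, ih]; abel

theorem sumMark_mul {k : Type*} [Field k] (l : List α) (r : k) (F : List α → α → List α → k) :
    sumMark l (fun p x q => r * F p x q) = r * sumMark l F := by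
  induction l generalizing F with
  | nil => simp [sumMark]
  | cons a l ih => simp only [sumMark, ih, mul_add]

theorem sum2_eq_first (l : List α) (F : List α → List α → N)
    (h : ∀ p t, p ++ t = l → p ≠ [] → F p t = 0) : sum2 l F = F [] l := by
  cases l with
  | nil => rfl
  | cons a l =>
    rw [sum2, sum2_eq_zero, add_zero]
    exact fun p t hl => h _ _ (by simp [hl]) (by simp)

theorem sum2_eq_last (l : List α) (F : List α → List α → N)
    (h : ∀ p t, p ++ t = l → t ≠ [] → F p t = 0) : sum2 l F = F l [] := by
  induction l generalizing F with
  | nil => rfl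
  | cons a l ih =>
    rw [sum2, h [] _ rfl (by simp), zero_add]
    exact ih _ fun p t hl => h _ _ (by simp [hl])

end Mark

/-! ### The Poincaré lemma for skew symmetric closed functions -/

section Darboux

variable {k : Type v} [Field k] {A : Type u} [AddCommGroup A] [Module k A]
  {𝒜 : ℤ → Submodule k A} {D : ℤ}

namespace TwoMarked

/-- The difference of the two contractions of a closed function. -/
theorem IsClosed.triangle {T : TwoMarked 𝒜} (hs : T.IsSkew) (hc : T.IsClosed)
    (p : List (HElt 𝒜)) (l : HElt 𝒜) (q : List (HElt 𝒜)) (x : HElt 𝒜) (b : List (HElt 𝒜))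
    (y : HElt 𝒜) :
    T p l (q ++ x :: b) y = T (p ++ l :: q) x b y +
      (-1 : k) ^ ((wdeg (p ++ l :: q) + x.1) * (wdeg b + y.1)) * T (b ++ y :: p) l q x := by
  -- The cyclic word is `l q x b y p` with marked elements `l`, `x`, `y`; skew symmetry turns the
  -- third term of the relation into the left-hand side.
  have h := hc l q x b y p
  rw [hs (q ++ x :: b)] at h
  set E := (-1 : k) ^ ((l.1 + wdeg q + x.1 + wdeg b + y.1) * wdeg p) with hE
  have hE2 : E * E = 1 := sgn_mul_self _
  have h1 : (-1 : k) ^ ((l.1 + wdeg q + x.1) * (wdeg b + y.1 + wdeg p)) =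
      E * (-1 : k) ^ ((wdeg (p ++ l :: q) + x.1) * (wdeg b + y.1)) := by
    rw [hE, sgn_mul]; refine sgn_eq ?_; simp only [wdeg_append, wdeg_cons]; push_cast; grind
  have h3 : (-1 : k) ^ (l.1 * (wdeg q + x.1 + wdeg b + y.1 + wdeg p)) *
      (-1 : k) ^ ((wdeg (q ++ x :: b) + y.1) * (wdeg p + l.1)) = E := by
    rw [hE, sgn_mul]; refine sgn_eq ?_; simp only [wdeg_append, wdeg_cons]; push_cast; grind
  rw [h1] at h
  linear_combination (-E) * h - T p l (q ++ x :: b) y * E * h3 +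
    (T (p ++ l :: q) x b y + (-1 : k) ^ ((wdeg (p ++ l :: q) + x.1) * (wdeg b + y.1)) *
      T (b ++ y :: p) l q x - T p l (q ++ x :: b) y) * hE2

/-- A closed function is the differential of its contraction. -/
theorem IsClosed.homotopy {T : TwoMarked 𝒜} (hs : T.IsSkew) (hc : T.IsClosed)
    (a : List (HElt 𝒜)) (x : HElt 𝒜) (b : List (HElt 𝒜)) (y : HElt 𝒜) :
    ((a.length + b.length + 2 : ℕ) : k) * T a x b y =
      sumMark (a ++ x :: b) (fun p l q => T p l q y) -
      (-1 : k) ^ ((wdeg a + x.1) * (wdeg b + y.1)) *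
        sumMark (b ++ y :: a) (fun p l q => T p l q x) := by
  -- Marking a letter of `a` or of `b` yields, by `triangle`, one copy of `T` and a remainder that
  -- cancels against the other contraction. Marking `x` and `y` themselves yields two further
  -- copies, whence the factor `a.length + b.length + 2`.
  have ha : sumMark a (fun p l q => T p l (q ++ x :: b) y) = (a.length : k) * T a x b y +
      (-1 : k) ^ ((wdeg a + x.1) * (wdeg b + y.1)) *
        sumMark a (fun p l q => T (b ++ y :: p) l q x) := by
    rw [← nsmul_eq_mul, ← sumMark_const, ← sumMark_mul, ← sumMark_add]
    refine sumMark_congr _ _ _ fun p l q hl => ?_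
    subst hl
    exact hc.triangle hs p l q x b y
  have hb : sumMark b (fun p l q => T p l (q ++ y :: a) x) = (b.length : k) * T b y a x +
      (-1 : k) ^ ((wdeg b + y.1) * (wdeg a + x.1)) *
        sumMark b (fun p l q => T (a ++ x :: p) l q y) := by
    rw [← nsmul_eq_mul, ← sumMark_const, ← sumMark_mul, ← sumMark_add]
    refine sumMark_congr _ _ _ fun p l q hl => ?_
    subst hl
    exact hc.triangle hs p l q y a x
  rw [sumMark_append_cons, sumMark_append_cons, ha, hb, hs b y a x]
  have hE : (-1 : k) ^ ((wdeg b + y.1) * (wdeg a + x.1)) =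
      (-1 : k) ^ ((wdeg a + x.1) * (wdeg b + y.1)) := by rw [mul_comm]
  rw [hE]
  have hE2 := sgn_mul_self (k := k) ((wdeg a + x.1) * (wdeg b + y.1))
  push_cast
  linear_combination (sumMark b (fun p l q => T (a ++ x :: p) l q y) -
    T a x b y - b.length * T a x b y) * hE2

end TwoMarked

theorem WLin.sumMark {N : Type*} [AddCommGroup N] [Module k N]
    {F : List (HElt 𝒜) → HElt 𝒜 → List (HElt 𝒜) → N}
    (h1 : ∀ x q, WLin (fun p => F p x q)) (h2 : ∀ p q, HLin (fun x => F p x q))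
    (h3 : ∀ p x, WLin (fun q => F p x q)) : WLin (fun l => AInfinity.sumMark l F) := by
  have key : ∀ (l : List (HElt 𝒜)) (G : List (HElt 𝒜) → HElt 𝒜 → List (HElt 𝒜) → HElt 𝒜 → N),
      (∀ p x q, HLin (G p x q)) → HLin (fun h => AInfinity.sumMark l fun p x q => G p x q h) := by
    intro l
    induction l with
    | nil => exact fun _ _ => HLin.zero
    | cons a l ih => exact fun G hG => (hG _ _ _).add (ih _ fun p x q => hG _ _ _)
  intro u v
  simp only [sumMark_append_cons]
  refine HLin.add (HLin.add (key _ _ fun p x q => ?_) ?_) (key _ _ fun p x q => ?_)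
  · exact h3 p x q v
  · exact h2 u v
  · exact h1 x q u p

theorem HLin.sumMark {N : Type*} [AddCommGroup N] [Module k N] {α : Type*} (l : List α)
    {G : List α → α → List α → HElt 𝒜 → N} (hG : ∀ p x q, HLin (G p x q)) :
    HLin (fun h => AInfinity.sumMark l fun p x q => G p x q h) := by
  induction l generalizing G with
  | nil => exact HLin.zero
  | cons a l ih => exact (hG _ _ _).add (ih fun p x q => hG _ _ _)

section PullbackLinear

variable {B : Type u} [AddCommGroup B] [Module k B] (f : MultiFamily k A B)
  (ψ : B →ₗ[k] B →ₗ[k] k)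

theorem pullback_wLin_left (x : HElt 𝒜) (b : List (HElt 𝒜)) (y : HElt 𝒜) :
    WLin (fun a => pullback 𝒜 f ψ a x b y) := by
  refine WLin.sum2 (fun s => WLin.sum2_right _ fun s' t => ?_)
    (fun p => WLin.sum2_right _ fun s' t => ?_)
  · refine WLin.mul_deg (fun d => (-1 : k) ^ (d * (wdeg s + x.1 + wdeg s' + wdeg t + y.1)))
      (WLin.map (N := B) ?_ (ψ _))
    simpa using WLin.ap (𝒜 := 𝒜) f (vals t ++ [(y.2 : A)]) []
  · refine WLin.mul_deg (fun d => (-1 : k) ^ (wdeg p * (d + x.1 + wdeg s' + wdeg t + y.1)))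
      (WLin.map (N := B) ?_ (ψ.flip (f.ap (vals t ++ (y.2 : A) :: vals p))))
    simpa using WLin.ap (𝒜 := 𝒜) f [] ((x.2 : A) :: vals s')

theorem pullback_wLin_right (a : List (HElt 𝒜)) (x : HElt 𝒜) (y : HElt 𝒜) :
    WLin (fun b => pullback 𝒜 f ψ a x b y) := by
  refine WLin.sum2_right _ fun p s => WLin.sum2 (fun t => ?_) (fun s' => ?_)
  · refine WLin.mul_deg (fun d => (-1 : k) ^ (wdeg p * (wdeg s + x.1 + d + wdeg t + y.1)))
      (WLin.map (N := B) ?_ (ψ.flip (f.ap (vals t ++ (y.2 : A) :: vals p))))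
    simpa using WLin.ap (𝒜 := 𝒜) f (vals s ++ [(x.2 : A)]) []
  · refine WLin.mul_deg (fun d => (-1 : k) ^ (wdeg p * (wdeg s + x.1 + wdeg s' + d + y.1)))
      (WLin.map (N := B) ?_ (ψ _))
    simpa using WLin.ap (𝒜 := 𝒜) f [] ((y.2 : A) :: vals p)

theorem pullback_hLin_mid (a : List (HElt 𝒜)) (b : List (HElt 𝒜)) (y : HElt 𝒜) :
    HLin (fun x => pullback 𝒜 f ψ a x b y) := by
  refine HLin.sum2 _ fun p s => HLin.sum2 _ fun s' t => ?_
  exact HLin.mul_deg (fun d => (-1 : k) ^ (wdeg p * (wdeg s + d + wdeg s' + wdeg t + y.1)))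
    ((HLin.of_linear (f.slot _ _)).map (ψ.flip (f.ap (vals t ++ (y.2 : A) :: vals p))))

theorem pullback_hLin_last (a : List (HElt 𝒜)) (x : HElt 𝒜) (b : List (HElt 𝒜)) :
    HLin (fun y => pullback 𝒜 f ψ a x b y) := by
  refine HLin.sum2 _ fun p s => HLin.sum2 _ fun s' t => ?_
  exact HLin.mul_deg (fun d => (-1 : k) ^ (wdeg p * (wdeg s + x.1 + wdeg s' + wdeg t + d)))
    ((HLin.of_linear (f.slot _ _)).map (ψ _))

end PullbackLinear

namespace PreBimoduleMap

variable (Φ : PreBimoduleMap 𝒜 D)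

theorem wLin_left (x : HElt 𝒜) (b : List (HElt 𝒜)) (y : HElt 𝒜) :
    WLin (fun a => Φ.ev a x b y) := WLin.ap_vals (Φ.φ.left x.2 (vals b) y.2)

theorem wLin_right (a : List (HElt 𝒜)) (x : HElt 𝒜) (y : HElt 𝒜) :
    WLin (fun b => Φ.ev a x b y) := WLin.ap_vals (Φ.φ.right (vals a) x.2 y.2)

theorem hLin_mid (a : List (HElt 𝒜)) (b : List (HElt 𝒜)) (y : HElt 𝒜) :
    HLin (fun x => Φ.ev a x b y) := HLin.of_linear (Φ.φ.mid (vals a) (vals b) y.2)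

theorem hLin_last (a : List (HElt 𝒜)) (x : HElt 𝒜) (b : List (HElt 𝒜)) :
    HLin (fun y => Φ.ev a x b y) := HLin.of_linear (Φ.φ.last (vals a) x.2 (vals b))

/-- The bilinear form `φ_{0,0}(v)(w)`. -/
def pairing : A →ₗ[k] A →ₗ[k] k :=
  LinearMap.mk₂ k (fun x y => Φ.φ.ap [] x [] y)
    (fun x x' y => (Φ.φ.mid [] [] y).map_add x x') (fun r x y => (Φ.φ.mid [] [] y).map_smul r x)
    (fun x y y' => (Φ.φ.last [] x []).map_add y y') (fun r x y => (Φ.φ.last [] x []).map_smul r y)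

theorem pairing_apply (x y : A) : Φ.pairing x y = Φ.φ.ap [] x [] y := rfl

theorem pairing_degree (x y : HElt 𝒜) (h : Φ.pairing x.2 y.2 ≠ 0) : x.1 + y.1 + D = 0 := by
  simpa [wdeg_nil] using Φ.degree [] x [] y h

variable {Φ}

theorem IsSkew.pairing_skew (h : Φ.IsSkew) (x y : HElt 𝒜) :
    Φ.pairing x.2 y.2 = -((-1 : k) ^ (x.1 * y.1) * Φ.pairing y.2 x.2) := by
  simpa [wdeg_nil, ev, vals_nil, pairing_apply] using h [] x [] y

theorem IsNondegenerate.pairing_nondegenerate (h : Φ.IsNondegenerate) : Φ.pairing.Nondegenerate :=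
  ⟨fun x hx => h.1 x hx, fun y hy => h.2 y hy⟩

/-- The pairing has degree `-D`, so a vector that pairs nontrivially only with elements of degree
`-d - D` has its homogeneous components outside degree `d` in the kernel of the pairing. This shows
that the maps built by the Darboux recursion have degree zero. -/
theorem IsNondegenerate.mem_of_pairing {ι : Type*} (e : Module.Basis ι k A) {deg : ι → ℤ}
    (hdeg : ∀ i, e i ∈ 𝒜 (deg i)) (h : Φ.IsNondegenerate) [Fintype ι] (d : ℤ) (a : A)
    (ha : ∀ y : HElt 𝒜, Φ.pairing a y.2 ≠ 0 → d + y.1 + D = 0) : a ∈ 𝒜 d := by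
  classical
  -- The degree `d` component of `a`. The difference `a - a'` is shown to pair to zero with each `e
  -- j`: by degree reasons on `a - a'` if `e j` has the complementary degree, and on `a` and `a'`
  -- separately otherwise.
  let a' : A := ∑ i, if deg i = d then e.repr a i • e i else 0
  have ha' : a' ∈ 𝒜 d := Submodule.sum_mem _ fun i _ => by
    split_ifs with hi
    · exact Submodule.smul_mem _ _ (hi ▸ hdeg i)
    · exact Submodule.zero_mem _
  suffices a = a' by rwa [this]
  rw [← sub_eq_zero]
  refine h.1 _ fun y => ?_
  change Φ.pairing (a - a') y = 0
  suffices H : Φ.pairing (a - a') = 0 by rw [H]; rfl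
  refine e.ext fun j => ?_
  rw [LinearMap.zero_apply]
  by_cases hj : d + deg j + D = 0
  · have hsub : a - a' = ∑ i, if deg i = d then 0 else e.repr a i • e i := by
      conv_lhs => rw [← e.sum_repr a]
      rw [← Finset.sum_sub_distrib]
      refine Finset.sum_congr rfl fun i _ => ?_
      split_ifs <;> simp
    rw [hsub, map_sum, LinearMap.sum_apply]
    refine Finset.sum_eq_zero fun i _ => ?_
    split_ifs with hi
    · simp
    · by_contra hne
      rw [map_smul, LinearMap.smul_apply] at hne
      have := Φ.pairing_degree ⟨deg i, e i, hdeg i⟩ ⟨deg j, e j, hdeg j⟩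
        (right_ne_zero_of_smul hne)
      simp only at this
      omega
  · rw [map_sub, LinearMap.sub_apply]
    have h1 : Φ.pairing a (e j) = 0 := by
      by_contra hne
      exact hj (ha ⟨deg j, e j, hdeg j⟩ hne)
    have h2 : Φ.pairing a' (e j) = 0 := by
      by_contra hne
      have := Φ.pairing_degree ⟨d, a', ha'⟩ ⟨deg j, e j, hdeg j⟩ hne
      exact hj this
    rw [h1, h2, sub_zero]

end PreBimoduleMap

end Darboux

end AInfinity

namespace AInfinity

/-! ### The noncommutative Darboux theorem -/

section Darboux

variable {k : Type v} [Field k] {A : Type u} [AddCommGroup A] [Module k A]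
  {𝒜 : ℤ → Submodule k A} {D : ℤ}

/-- The part of a multilinear family with fewer than `n` arguments. -/
def MultiFamily.trunc {B : Type*} [AddCommGroup B] [Module k B] (F : MultiFamily k A B) (n : ℕ) :
    MultiFamily k A B := fun i => if i < n then F i else 0

theorem MultiFamily.trunc_ap {B : Type*} [AddCommGroup B] [Module k B] (F : MultiFamily k A B)
    (n : ℕ) (l : List A) : (F.trunc n).ap l = if l.length < n then F.ap l else 0 := by
  unfold ap trunc
  split_ifs <;> rfl

theorem MultiFamily.ap_congr {B : Type*} [AddCommGroup B] [Module k B] {F F' : MultiFamily k A B}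
    {l : List A} (h : F l.length = F' l.length) : F.ap l = F'.ap l := by
  unfold ap
  rw [h]

section TopTerms

variable {B : Type u} [AddCommGroup B] [Module k B]

/-- The terms of a pullback that contain the component of highest arity. -/
theorem pullback_trunc (f : MultiFamily k A B) (ψ : B →ₗ[k] B →ₗ[k] k)
    (a : List (HElt 𝒜)) (x : HElt 𝒜) (b : List (HElt 𝒜)) (y : HElt 𝒜)
    (hn : 2 ≤ a.length + b.length + 1) :
    pullback 𝒜 f ψ a x b y = pullback 𝒜 (f.trunc (a.length + b.length + 1)) ψ a x b y +
      (ψ (f.ap (vals (a ++ x :: b))) (f.ap [(y.2 : A)]) +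
      (-1 : k) ^ (wdeg a * (x.1 + wdeg b + y.1)) *
        ψ (f.ap [(x.2 : A)]) (f.ap (vals (b ++ y :: a)))) := by
  classical
  set n := a.length + b.length + 1 with hn'
  -- The cyclic word has `n + 1` letters, so a component of arity `n` occurs only if the other arc
  -- is a single letter. Since `n ≥ 2` these two cuts are different, and each is singled out as an
  -- indicator inside the double sum.
  have h1 : ψ (f.ap (vals (a ++ x :: b))) (f.ap [(y.2 : A)]) =
      sum2 a (fun p s => sum2 b (fun s' t => if p = [] ∧ t = [] then
        ψ (f.ap (vals (s ++ x :: s'))) (f.ap (vals (t ++ y :: p))) else 0)) := by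
    rw [sum2_eq_first, sum2_eq_last]
    · simp [vals_cons, vals_nil]
    · intro p t _ ht
      simp [ht]
    · intro p t _ hp
      simp [hp, sum2_zero]
  have h2 : (-1 : k) ^ (wdeg a * (x.1 + wdeg b + y.1)) *
        ψ (f.ap [(x.2 : A)]) (f.ap (vals (b ++ y :: a))) =
      sum2 a (fun p s => sum2 b (fun s' t => if s = [] ∧ s' = [] then
        (-1 : k) ^ (wdeg p * (wdeg s + x.1 + wdeg s' + wdeg t + y.1)) *
        ψ (f.ap (vals (s ++ x :: s'))) (f.ap (vals (t ++ y :: p))) else 0)) := by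
    rw [sum2_eq_last, sum2_eq_first]
    · simp [vals_cons, vals_nil, wdeg_nil]
    · intro p t _ ht
      simp [ht]
    · intro p t _ hp
      simp [hp, sum2_zero]
  rw [h1, h2, pullback_eq, pullback_eq]
  simp only [← sum2_add]
  refine sum2_congr _ _ _ fun p s ha => sum2_congr _ _ _ fun s' t hb => ?_
  subst ha hb
  simp only [MultiFamily.trunc_ap, length_vals, List.length_append, List.length_cons] at hn' hn ⊢
  by_cases hpt : p = [] ∧ t = []
  · obtain ⟨rfl, rfl⟩ := hpt
    have : ¬ (s = [] ∧ s' = []) := by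
      rintro ⟨rfl, rfl⟩
      simp at hn' hn
      omega
    simp only [List.length_nil] at hn'
    rw [if_neg (show ¬ s.length + (s'.length + 1) < n by omega)]
    simp [this, wdeg_nil]
  · have hpt' : 0 < p.length + t.length := by
      by_contra h0
      exact hpt ⟨List.length_eq_zero_iff.mp (by omega), List.length_eq_zero_iff.mp (by omega)⟩
    rw [if_neg hpt, if_pos (show s.length + (s'.length + 1) < n by omega), zero_add]
    by_cases hs : s = [] ∧ s' = []
    · obtain ⟨rfl, rfl⟩ := hs
      simp only [List.length_nil] at hn'
      rw [if_neg (by omega), if_pos ⟨rfl, rfl⟩]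
      simp
    · have hs' : 0 < s.length + s'.length := by
        by_contra h0
        exact hs ⟨List.length_eq_zero_iff.mp (by omega), List.length_eq_zero_iff.mp (by omega)⟩
      rw [if_neg hs, if_pos (show t.length + (p.length + 1) < n by omega), add_zero]

end TopTerms

variable {ι : Type w} [Fintype ι] (e : Module.Basis ι k A) {deg : ι → ℤ}
  (hdeg : ∀ i, e i ∈ 𝒜 (deg i))

/-- The functional that determines the next component of a Darboux coordinate change, as a function
of a word and of a further element. -/
noncomputable def darbouxForm (Φ : PreBimoduleMap 𝒜 D) (f : MultiFamily k A A) (n : ℕ)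
    (x : List (HElt 𝒜)) (y : HElt 𝒜) : k :=
  ((n + 1 : ℕ) : k)⁻¹ * sumMark x (fun p l q =>
    Φ.ev p l q y - pullback 𝒜 (f.trunc n) Φ.pairing p l q y)

theorem darbouxForm_wLin (Φ : PreBimoduleMap 𝒜 D) (f : MultiFamily k A A) (n : ℕ) (y : HElt 𝒜) :
    WLin (fun x => darbouxForm Φ f n x y) := by
  refine WLin.mul_deg (fun _ => ((n + 1 : ℕ) : k)⁻¹) (WLin.sumMark ?_ ?_ ?_)
  · exact fun l q => (Φ.wLin_left l q y).sub (pullback_wLin_left _ _ l q y)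
  · exact fun p q => (Φ.hLin_mid p q y).sub (pullback_hLin_mid _ _ p q y)
  · exact fun p l => (Φ.wLin_right p l y).sub (pullback_wLin_right _ _ p l y)

theorem darbouxForm_hLin (Φ : PreBimoduleMap 𝒜 D) (f : MultiFamily k A A) (n : ℕ)
    (x : List (HElt 𝒜)) : HLin (fun y => darbouxForm Φ f n x y) := by
  refine HLin.mul_deg (fun _ => ((n + 1 : ℕ) : k)⁻¹) (HLin.sumMark _ fun p l q => ?_)
  exact (Φ.hLin_last p l q).sub (pullback_hLin_last _ _ p l q)

/-- In finite dimension the injective map from `A` to its dual is surjective; `S` represents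
functionals by vectors, which is how non-degeneracy enters the Darboux recursion. -/
theorem PreBimoduleMap.IsNondegenerate.exists_inverse {Φ : PreBimoduleMap 𝒜 D}
    (e : Module.Basis ι k A) (h : Φ.IsNondegenerate) :
    ∃ S : (A →ₗ[k] k) →ₗ[k] A, ∀ ξ y, Φ.pairing (S ξ) y = ξ y := by
  have := Module.Finite.of_basis e
  have hinj : Function.Injective Φ.pairing := by
    rw [injective_iff_map_eq_zero]
    exact fun x hx => h.1 x fun y => LinearMap.congr_fun hx y
  have hsurj : Function.Surjective Φ.pairing :=
    (LinearMap.injective_iff_surjective_of_finrank_eq_finrank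
      (Subspace.dual_finrank_eq (K := k) (V := A)).symm).mp hinj
  obtain ⟨S, hS⟩ := Φ.pairing.exists_rightInverse_of_surjective (LinearMap.range_eq_top.mpr hsurj)
  exact ⟨S, fun ξ y => LinearMap.congr_fun (LinearMap.congr_fun hS ξ) y⟩

/-- The values on basis words of the next component of a Darboux coordinate change. -/
noncomputable def darbouxWord (Φ : PreBimoduleMap 𝒜 D) (S : (A →ₗ[k] k) →ₗ[k] A)
    (f : MultiFamily k A A) (n : ℕ) (x : List (HElt 𝒜)) : A :=
  S (∑ j, darbouxForm Φ f n x (basisElt e hdeg j) • e.coord j)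

theorem darbouxWord_wLin (Φ : PreBimoduleMap 𝒜 D) (S : (A →ₗ[k] k) →ₗ[k] A)
    (f : MultiFamily k A A) (n : ℕ) : WLin (darbouxWord e hdeg Φ S f n) := by
  have h : ∀ s : Finset ι, WLin (fun x : List (HElt 𝒜) =>
      ∑ j ∈ s, darbouxForm Φ f n x (basisElt e hdeg j) • e.coord j) := by
    classical
    intro s
    induction s using Finset.induction_on with
    | empty => simpa using WLin.zero
    | insert j s hj ih =>
      simp only [Finset.sum_insert hj]
      exact ((darbouxForm_wLin Φ f n _).map (LinearMap.toSpanSingleton k _ (e.coord j))).add ih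
  exact (h Finset.univ).map S

theorem pairing_darbouxWord (h𝒜 : DirectSum.IsInternal 𝒜) {Φ : PreBimoduleMap 𝒜 D}
    {S : (A →ₗ[k] k) →ₗ[k] A} (hS : ∀ ξ y, Φ.pairing (S ξ) y = ξ y)
    (f : MultiFamily k A A) (n : ℕ) (x : List (HElt 𝒜)) (y : HElt 𝒜) :
    Φ.pairing (darbouxWord e hdeg Φ S f n x) y.2 = darbouxForm Φ f n x y := by
  classical
  refine HLin.ext_basis e hdeg h𝒜 (HLin.of_linear (Φ.pairing _)) (darbouxForm_hLin Φ f n x)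
    (fun i => ?_) y
  rw [darbouxWord, hS, LinearMap.sum_apply]
  simp only [LinearMap.smul_apply, basisElt, Module.Basis.coord_apply, Module.Basis.repr_self,
    smul_eq_mul]
  simp [Finsupp.single_apply]

/-- Noncommutative Darboux theorem: a skew symmetric closed family that is non-degenerate at chain
level is the pullback of its constant part under a formal coordinate change that is the identity
to first order. -/
theorem exists_darboux [CharZero k] (h𝒜 : DirectSum.IsInternal 𝒜)
    (hdeg : ∀ i, e i ∈ 𝒜 (deg i)) (Φ : PreBimoduleMap 𝒜 D) (hs : Φ.IsSkew) (hc : Φ.IsClosed)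
    (hnd : Φ.IsNondegenerate) :
    ∃ f : MultiFamily k A A, f 0 = 0 ∧ (∀ a, f.ap [a] = a) ∧
      (∀ x : List (HElt 𝒜), f.ap (vals x) ∈ 𝒜 (wdeg x)) ∧
      ∀ a x b y, Φ.ev a x b y = pullback 𝒜 f Φ.pairing a x b y := by
  obtain ⟨S, hS⟩ := hnd.exists_inverse e
  -- Component zero is zero and component one is the identity. From arity two on, the value is the
  -- vector that represents `darbouxForm`, taken at the length of the whole word; it involves only
  -- components of smaller arity, through `trunc`.
  let W : MultiFamily k A A → List ι → A := fun g I => match I with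
    | [] => 0
    | [i] => e i
    | i :: j :: I => darbouxWord e hdeg Φ S g (I.length + 2)
        ((i :: j :: I).map (basisElt e hdeg))
  obtain ⟨f, hf⟩ := MultiFamily.exists_eq_step (fun g => familyOfWords e (W g)) (by
    intro F F' n hF
    refine familyOfWords_congr e _ _ n fun I hI => ?_
    match I with
    | [] => rfl
    | [i] => rfl
    | i :: j :: I =>
      have : F.trunc (I.length + 2) = F'.trunc (I.length + 2) := by
        funext m
        simp only [MultiFamily.trunc]
        split_ifs with hm
        · refine hF m ?_
          simp only [List.length_cons] at hI
          omega
        · rfl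
      simp only [W, darbouxWord, darbouxForm, this])
  have h0 : f 0 = 0 := by
    rw [hf]
    refine Module.Basis.ext_multilinear (fun _ => e) fun I => ?_
    rw [← MultiFamily.ap_ofFn]
    exact (familyOfWords_ap e (W f) []).trans rfl
  have h1 : ∀ a, f.ap [a] = a := by
    intro a
    change f.slot [] [] a = LinearMap.id (R := k) a
    congr 1
    refine e.ext fun i => ?_
    change f.ap [e i] = e i
    rw [MultiFamily.ap_congr (hf _)]
    exact familyOfWords_ap e (W f) [i]
  have h2 : ∀ (x : List (HElt 𝒜)) (y : HElt 𝒜), 2 ≤ x.length →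
      Φ.pairing (f.ap (vals x)) y.2 = darbouxForm Φ f x.length x y := by
    intro x y hx
    rw [← pairing_darbouxWord e hdeg h𝒜 hS f]
    congr 2
    rw [← familyOfWords_ap_vals e hdeg h𝒜 (darbouxWord_wLin e hdeg Φ S f x.length)]
    rw [MultiFamily.ap_congr (hf _)]
    refine MultiFamily.ap_congr (familyOfWords_congr e _ _ _ fun I hI => ?_)
    rw [length_vals] at hI
    match I with
    | [] => simp at hI; omega
    | [i] => simp at hI; omega
    | i :: j :: I =>
      simp only [W]
      rw [← hI]
      rfl
  -- Degrees are settled by induction on the length: `Φ` and the pullback along components of degree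
  -- zero vanish off total degree `-D`, hence so does `darbouxForm`, and its representing vector has
  -- the expected degree.
  have h3 : ∀ (n : ℕ) (x : List (HElt 𝒜)), x.length < n → f.ap (vals x) ∈ 𝒜 (wdeg x) := by
    intro n
    induction n with
    | zero => exact fun x hx => absurd hx (by omega)
    | succ n ih =>
      intro x hx
      rcases Nat.lt_or_ge x.length n with hlt | hge
      · exact ih x hlt
      obtain rfl : x.length = n := by omega
      match x with
      | [] =>
        change f.ap [] ∈ _
        rw [f.ap_nil h0]
        exact Submodule.zero_mem _
      | [a] =>
        change f.ap [(a.2 : A)] ∈ _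
        rw [h1, wdeg_cons, wdeg_nil, add_zero]
        exact a.2.2
      | a :: b :: x =>
        have hdeg0 : ∀ z : List (HElt 𝒜),
            (f.trunc (a :: b :: x).length).ap (vals z) ∈ 𝒜 (wdeg z) := fun z => by
          rw [MultiFamily.trunc_ap, length_vals]
          split_ifs with hz
          · exact ih z hz
          · exact Submodule.zero_mem _
        refine hnd.mem_of_pairing e hdeg _ _ fun y hy => ?_
        rw [h2 _ _ (by simp), darbouxForm] at hy
        by_contra hne
        refine hy ?_
        rw [sumMark_congr (G := fun _ _ _ => 0) _ _ fun p l q hl => ?_, sumMark_const]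
        · simp
        have hw : wdeg p + l.1 + wdeg q = wdeg (a :: b :: x) := by
          rw [← hl, wdeg_append, wdeg_cons, add_assoc]
        have e1 : Φ.ev p l q y = 0 := by
          by_contra h
          exact hne (hw ▸ Φ.degree p l q y h)
        have e2 : pullback 𝒜 (f.trunc (a :: b :: x).length) Φ.pairing p l q y = 0 := by
          rw [pullback_eq]
          refine sum2_eq_zero _ _ fun p1 s1 hp => sum2_eq_zero _ _ fun s2 t2 hq => ?_
          by_contra h
          have := Φ.pairing_degree ⟨_, _, hdeg0 _⟩ ⟨_, _, hdeg0 _⟩ (right_ne_zero_of_mul h)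
          refine hne ?_
          rw [← hw, ← hp, ← hq]
          simp only [wdeg_append, wdeg_cons] at this ⊢
          linarith
        rw [e1, e2, sub_zero]
  have h3' : ∀ x : List (HElt 𝒜), f.ap (vals x) ∈ 𝒜 (wdeg x) := fun x => h3 _ x (Nat.lt_succ_self _)
  refine ⟨f, h0, h1, h3', fun a x b y => ?_⟩
  rcases Nat.lt_or_ge (a.length + b.length + 1) 2 with hn | hn
  · obtain rfl : a = [] := List.length_eq_zero_iff.mp (by omega)
    obtain rfl : b = [] := List.length_eq_zero_iff.mp (by omega)
    simp only [pullback, sum2, vals_nil, wdeg_nil, List.nil_append, h1]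
    simp [PreBimoduleMap.ev, vals_nil, PreBimoduleMap.pairing_apply]
  · rw [pullback_trunc _ _ _ _ _ _ hn, h1, h1]
    set n := a.length + b.length + 1 with hn'
    have hft : ∀ z : List (HElt 𝒜), (f.trunc n).ap (vals z) ∈ 𝒜 (wdeg z) := fun z => by
      rw [MultiFamily.trunc_ap, length_vals]
      split_ifs with hz
      · exact h3' z
      · exact Submodule.zero_mem _
    -- The error left by the components of arity below `n` is skew symmetric and closed. By the
    -- Poincaré lemma `n + 1` times this error is a difference of two contractions, and `h2`
    -- identifies these with `n + 1` times the two terms containing the component of arity `n`.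
    have hsT := TwoMarked.IsSkew.sub (T := Φ.ev) hs (pullback_isSkew hft hs.pairing_skew)
    have hcT := TwoMarked.IsClosed.sub (Φ.isClosed_iff.mp hc)
      (pullback_isClosed hft hs.pairing_skew)
    have key := hcT.homotopy hsT a x b y
    -- Characteristic zero enters here.
    have hN : ((n + 1 : ℕ) : k) ≠ 0 := Nat.cast_ne_zero.mpr (by omega)
    have k1 := h2 (a ++ x :: b) y (by simp; omega)
    have k2 := h2 (b ++ y :: a) x (by simp; omega)
    have l1 : (a ++ x :: b).length = n := by simp; omega
    have l2 : (b ++ y :: a).length = n := by simp; omega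
    rw [darbouxForm, l1] at k1
    rw [darbouxForm, l2] at k2
    have l3 : a.length + b.length + 2 = n + 1 := by omega
    rw [l3] at key
    rw [eq_comm, inv_mul_eq_iff_eq_mul₀ hN] at k1 k2
    rw [k1, k2] at key
    have k3 := hs.pairing_skew x ⟨_, _, h3' (b ++ y :: a)⟩
    simp only at k3
    rw [k3]
    have k4 : (-1 : k) ^ ((wdeg a + x.1) * (wdeg b + y.1)) =
        (-1 : k) ^ (wdeg a * (x.1 + wdeg b + y.1)) * (-1 : k) ^ (x.1 * wdeg (b ++ y :: a)) := by
      rw [sgn_mul]; refine sgn_eq ?_; simp only [wdeg_append, wdeg_cons]; push_cast; grind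
    rw [k4] at key
    refine mul_left_cancel₀ hN ?_
    linear_combination key

end Darboux

end AInfinity

namespace AInfinity

/-! ### Nested cuts and the order of their summation -/

section Nesting

variable {α N : Type*} [AddCommMonoid N]

theorem sum2_map {β : Type*} (g : α → β) (l : List α) (F : List β → List β → N) :
    sum2 (l.map g) F = sum2 l (fun p t => F (p.map g) (t.map g)) := by
  induction l generalizing F with
  | nil => rfl
  | cons a l ih => simp [sum2, ih]

theorem sum3_map {β : Type*} (g : α → β) (l : List α) (F : List β → List β → List β → N) :
    sum3 (l.map g) F = sum3 l (fun p s t => F (p.map g) (s.map g) (t.map g)) := by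
  simp only [sum3, sum2_map]

/-- Both sides run over the cuts into five blocks: a middle block is enlarged on both sides, or a
larger block is chosen and then subdivided. -/
theorem sum3_nest (l : List α) (G : List α → List α → List α → List α → List α → N) :
    sum3 l (fun p s t => sum2 p (fun p' u => sum2 t (fun w t' => G p' u s w t'))) =
      sum3 l (fun p r t => sum3 r (fun u s w => G p u s w t)) := by
  have h1 : sum3 l (fun p s t => sum2 p (fun p' u => sum2 t (fun w t' => G p' u s w t'))) =
      sum2 l (fun q r => sum2 q (fun p u => sum2 r (fun s t => sum2 t (fun w t' =>
        G p u s w t')))) := by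
    simp only [sum3]
    exact sum2_congr _ _ _ fun p r _ => sum2_comm _ _ _
  rw [h1, sum2_assoc, sum3]
  simp only [sum3]
  refine sum2_congr _ _ _ fun p r _ => ?_
  rw [sum2_assoc, sum3]
  refine sum2_congr _ _ _ fun u r' _ => ?_
  rw [sum2_assoc, sum3]

/-- Both sides run over pairs of disjoint blocks; the block chosen first is the right one on one
side and the left one on the other. -/
theorem sum3_sum3_left (l : List α) (G : List α → List α → List α → List α → List α → N) :
    sum3 l (fun p s t => sum3 p (fun p1 s1 p2 => G p1 s1 p2 s t)) =
      sum3 l (fun p s t => sum3 t (fun t1 s2 t2 => G p s t1 s2 t2)) := by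
  have h1 : sum3 l (fun p s t => sum3 p (fun p1 s1 p2 => G p1 s1 p2 s t)) =
      sum2 l (fun p r => sum2 p (fun p1 q => sum2 q (fun s1 p2 => sum2 r (fun s t =>
        G p1 s1 p2 s t)))) := by
    simp only [sum3]
    refine sum2_congr _ _ _ fun p r _ => ?_
    rw [sum2_comm]
    exact sum2_congr _ _ _ fun p1 q _ => sum2_comm _ _ _
  rw [h1, sum2_assoc]
  simp only [sum3]
  refine sum2_congr _ _ _ fun p r _ => ?_
  rw [sum2_assoc, sum3]

theorem blockSum_comm {β : Type*} (l : List α) (l' : List β)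
    (F : List (List α) → List (List β) → N) :
    blockSum l (fun c => blockSum l' (F c)) = blockSum l' (fun c' => blockSum l (fun c =>
        F c c')) := by
  induction l' generalizing F with
  | nil => rfl
  | cons a l' ih =>
    simp only [blockSum, blockSum_add, ih]
    congr 2
    funext c'
    cases c'
    · exact blockSum_zero l
    · rfl

theorem sum2_mem {k : Type*} [Field k] {V : Type*} [AddCommGroup V] [Module k V]
    (S : Submodule k V) (l : List α) (F : List α → List α → V)
    (h : ∀ p t, p ++ t = l → F p t ∈ S) : sum2 l F ∈ S := by
  induction l generalizing F with
  | nil => exact h _ _ rfl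
  | cons a l ih =>
    exact S.add_mem (h _ _ rfl) (ih _ fun p t hl => h _ _ (by simp [hl]))

theorem blockSum_mem {k : Type*} [Field k] {V : Type*} [AddCommGroup V] [Module k V]
    (S : Submodule k V) (l : List α) (G : List (List α) → V)
    (h : ∀ c, c.flatten = l → G c ∈ S) : blockSum l G ∈ S := by
  rw [blockSum_eq_sum_blockCuts]
  refine list_sum_mem fun x hx => ?_
  obtain ⟨c, hc, rfl⟩ := List.mem_map.mp hx
  exact h c ((mem_blockCuts _ _).mp hc).1

end Nesting

/-! ## Transport of an `A_∞`-structure along a formal coordinate change -/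

section Transport

variable {k : Type v} [Field k] {A : Type u} [AddCommGroup A] [Module k A]
  {𝒜 : ℤ → Submodule k A} {N : Type*} [AddCommGroup N] [Module k N]

/-- The value of a family of maps of degree `d` on a word, as a homogeneous element. -/
def MultiFamily.elt (F : MultiFamily k A A) (d : ℤ)
    (hF : ∀ x : List (HElt 𝒜), F.ap (vals x) ∈ 𝒜 (wdeg x + d)) (s : List (HElt 𝒜)) : HElt 𝒜 :=
  ⟨wdeg s + d, F.ap (vals s), hF s⟩

theorem MultiFamily.elt_val (F : MultiFamily k A A) (d : ℤ)
    (hF : ∀ x : List (HElt 𝒜), F.ap (vals x) ∈ 𝒜 (wdeg x + d)) (x : List (HElt 𝒜)) :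
    ((F.elt d hF x).2 : A) = F.ap (vals x) := rfl

/-- The composite of a multilinear family with the coderivation extending `m`. -/
def derComp (m : MultiFamily k A A) (F : MultiFamily k A N) (x : List (HElt 𝒜)) : N :=
  sum3 x (fun p s t => (-1 : k) ^ wdeg p • F.ap (vals p ++ m.ap (vals s) :: vals t))

theorem derComp_wLin (m : MultiFamily k A A) (F : MultiFamily k A N) :
    WLin (derComp (𝒜 := 𝒜) m F) := by
  refine WLin.sum3 (fun s t => ?_) (fun p t => ?_) (fun p s => ?_)
  · refine WLin.smul_deg (fun d => (-1 : k) ^ d) ?_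
    simpa using WLin.ap (𝒜 := 𝒜) F [] (m.ap (vals s) :: vals t)
  · exact ((WLin.ap_vals m).map (F.slot (vals p) (vals t))).map
      (((-1 : k) ^ wdeg p) • LinearMap.id (R := k) (M := N))
  · refine WLin.map (N := N) ?_ (((-1 : k) ^ wdeg p) • LinearMap.id (R := k) (M := N))
    change WLin (fun t : List (HElt 𝒜) => F.ap (vals p ++ m.ap (vals s) :: vals t))
    simpa using WLin.ap (𝒜 := 𝒜) F (vals p ++ [m.ap (vals s)]) []

/-- Of two successive applications of `m`, either the second contains the result of the first, and
these terms add up to the `A_∞` relation, or the two act on disjoint blocks, and these terms cancel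
in pairs because `m` is odd. -/
theorem derComp_derComp (M : AInfAlgebra 𝒜) (F : MultiFamily k A N) (x : List (HElt 𝒜)) :
    sum3 x (fun p s t => (-1 : k) ^ wdeg p •
      derComp M.m F (p ++ M.m.elt 1 M.degree_one s :: t)) = 0 := by
  simp only [derComp, sum3_append_cons, smul_add, sum3_add]
  -- The nested terms, grouped by the block `r` on which the outer operation acts.
  have h2 : sum3 x (fun p s t => (-1 : k) ^ wdeg p •
      sum2 p (fun p' u => sum2 t (fun w t' => (-1 : k) ^ wdeg p' •
        F.ap (vals p' ++ M.m.ap (vals (u ++ M.m.elt 1 M.degree_one s :: w)) :: vals t')))) = 0 := by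
    simp only [← sum2_smul]
    have h := sum3_nest x (fun p' u s w t' => (-1 : k) ^ wdeg (p' ++ u) • (-1 : k) ^ wdeg p' •
        F.ap (vals p' ++ M.m.ap (vals (u ++ M.m.elt 1 M.degree_one s :: w)) :: vals t'))
    have h' : sum3 x (fun p s t => sum2 p (fun p' u => sum2 t (fun w t' =>
        (-1 : k) ^ wdeg p • (-1 : k) ^ wdeg p' •
        F.ap (vals p' ++ M.m.ap (vals (u ++ M.m.elt 1 M.degree_one s :: w)) :: vals t')))) =
      sum3 x (fun p s t => sum2 p (fun p' u => sum2 t (fun w t' =>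
        (-1 : k) ^ wdeg (p' ++ u) • (-1 : k) ^ wdeg p' •
        F.ap (vals p' ++ M.m.ap (vals (u ++ M.m.elt 1 M.degree_one s :: w)) :: vals t')))) :=
      sum3_congr _ _ _ fun p s t _ => sum2_congr _ _ _ fun p' u hp => by rw [hp]
    rw [h', h]
    refine sum3_eq_zero _ _ fun p r t _ => ?_
    have hrel := congrArg (F.slot (vals p) (vals t)) (M.relation r)
    rw [map_sum3, map_zero] at hrel
    rw [← hrel]
    refine sum3_congr _ _ _ fun u s w _ => ?_
    rw [map_smul, F.slot_apply, smul_smul, sgn_mul, vals_append, vals_cons]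
    congr 1
    exact sgn_eq (by rw [wdeg_append]; push_cast; grind)
  -- The disjoint terms; the two orders of application differ by the sign of moving one odd
  -- operation past the other.
  have h13 : sum3 x (fun p s t => (-1 : k) ^ wdeg p • sum3 p (fun p1 s1 p2 => (-1 : k) ^ wdeg p1 •
        F.ap (vals p1 ++ M.m.ap (vals s1) :: vals (p2 ++ M.m.elt 1 M.degree_one s :: t)))) +
      sum3 x (fun p s t => (-1 : k) ^ wdeg p • sum3 t (fun t1 s2 t2 =>
        (-1 : k) ^ wdeg (p ++ M.m.elt 1 M.degree_one s :: t1) •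
        F.ap (vals (p ++ M.m.elt 1 M.degree_one s :: t1) ++ M.m.ap (vals s2) :: vals t2))) = 0 := by
    have h' : sum3 x (fun p s t => (-1 : k) ^ wdeg p • sum3 p (fun p1 s1 p2 =>
        (-1 : k) ^ wdeg p1 • F.ap (vals p1 ++ M.m.ap (vals s1) ::
          vals (p2 ++ M.m.elt 1 M.degree_one s :: t)))) =
      sum3 x (fun p s t => sum3 p (fun p1 s1 p2 => (-1 : k) ^ wdeg (p1 ++ (s1 ++ p2)) •
        (-1 : k) ^ wdeg p1 • F.ap (vals p1 ++ M.m.ap (vals s1) ::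
          vals (p2 ++ M.m.elt 1 M.degree_one s :: t)))) := by
      refine sum3_congr _ _ _ fun p s t _ => ?_
      rw [← sum3_smul]
      exact sum3_congr _ _ _ fun p1 s1 p2 hp => by rw [hp]
    rw [h', sum3_sum3_left x (fun p1 s1 p2 s t => (-1 : k) ^ wdeg (p1 ++ (s1 ++ p2)) •
        (-1 : k) ^ wdeg p1 • F.ap (vals p1 ++ M.m.ap (vals s1) ::
          vals (p2 ++ M.m.elt 1 M.degree_one s :: t))), ← sum3_add]
    refine sum3_eq_zero _ _ fun p s t _ => ?_
    rw [← sum3_smul, ← sum3_add]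
    refine sum3_eq_zero _ _ fun t1 s2 t2 _ => ?_
    simp only [vals_append, vals_cons, List.append_assoc, List.cons_append, smul_smul, sgn_mul]
    simp only [MultiFamily.elt_val]
    rw [← add_smul, ← neg_sgn_eq (k := k) (a := wdeg (p ++ (s ++ t1)) + wdeg p)
      (b := wdeg p + wdeg (p ++ M.m.elt 1 M.degree_one s :: t1)), add_neg_cancel, zero_smul]
    simp only [wdeg_append, wdeg_cons, MultiFamily.elt]
    push_cast
    grind
  rw [h2, add_zero]
  exact h13

variable {f : MultiFamily k A A}

/-- The value of a map of degree zero on a word, as a homogeneous element. -/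
def MultiFamily.arc (f : MultiFamily k A A)
    (hf : ∀ x : List (HElt 𝒜), f.ap (vals x) ∈ 𝒜 (wdeg x)) (s : List (HElt 𝒜)) : HElt 𝒜 :=
  ⟨wdeg s, f.ap (vals s), hf s⟩

theorem wdeg_map_arc (hf : ∀ x : List (HElt 𝒜), f.ap (vals x) ∈ 𝒜 (wdeg x))
    (c : List (List (HElt 𝒜))) : wdeg (c.map (f.arc hf)) = wdeg c.flatten := by
  induction c with
  | nil => rfl
  | cons s c ih =>
    rw [List.map_cons, wdeg_cons, ih, List.flatten_cons, wdeg_append]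
    rfl

theorem vals_map_arc (hf : ∀ x : List (HElt 𝒜), f.ap (vals x) ∈ 𝒜 (wdeg x))
    (c : List (List (HElt 𝒜))) : vals (c.map (f.arc hf)) = c.map fun s => f.ap (vals s) := by
  simp [vals, MultiFamily.arc]

theorem arc_singleton (hf : ∀ x : List (HElt 𝒜), f.ap (vals x) ∈ 𝒜 (wdeg x))
    (h1 : ∀ a, f.ap [a] = a) (a : HElt 𝒜) : f.arc hf [a] = a :=
  HElt.ext' (by simp [MultiFamily.arc, wdeg_cons, wdeg_nil]) (h1 _)

/-- Substitution of `f` is unitriangular: as `f₁ = id`, the cut into single letters contributes `G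
x`, and all other cuts contribute values of `G` on shorter words. -/
theorem eq_zero_of_blockSum_arc {N : Type*} [AddCommGroup N]
    (hf : ∀ x : List (HElt 𝒜), f.ap (vals x) ∈ 𝒜 (wdeg x))
    (h1 : ∀ a, f.ap [a] = a) (G : List (HElt 𝒜) → N)
    (hG : ∀ x, blockSum x (fun c => G (c.map (f.arc hf))) = 0) (x : List (HElt 𝒜)) : G x = 0 := by
  induction hn : x.length using Nat.strong_induction_on generalizing x with
  | _ n ih =>
    have h := hG x
    rw [blockSum_eq_add, blockSum_eq_zero, add_zero, List.map_map] at h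
    · rw [← h]
      congr 1
      conv_lhs => rw [← List.map_id x]
      exact List.map_congr_left fun a _ => (arc_singleton hf h1 a).symm
    · intro c _ _
      split_ifs with hc
      · exact ih _ (hn ▸ hc) _ (List.length_map _)
      · rfl

/-- A morphism of `A_∞`-structures intertwines the coderivations. -/
theorem blockSum_derComp {m mB : MultiFamily k A A}
    (hm : ∀ x : List (HElt 𝒜), m.ap (vals x) ∈ 𝒜 (wdeg x + 1))
    (hf : ∀ x : List (HElt 𝒜), f.ap (vals x) ∈ 𝒜 (wdeg x))
    (hrel : ∀ x : List (HElt 𝒜),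
      blockSum x (fun c => mB.ap (c.map fun s => f.ap (vals s))) = derComp m f x)
    (F : MultiFamily k A N) (x : List (HElt 𝒜)) :
    blockSum x (fun c => derComp mB F (c.map (f.arc hf))) =
      sum3 x (fun p s t => (-1 : k) ^ wdeg p •
        blockSum (p ++ m.elt 1 hm s :: t) (fun c => F.ap (c.map fun s => f.ap (vals s)))) := by
  -- The blocks fed into `mB` are merged to one subword `s`, on which the morphism relation replaces
  -- `mB` after `f` by `f` after `m`.
  have hL : blockSum x (fun c => derComp mB F (c.map (f.arc hf))) =
      sum3 x (fun p s t => sum3 s (fun u s w => blockSum p (fun P => blockSum t (fun T =>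
        (-1 : k) ^ wdeg (p ++ u) • F.ap ((P.map fun s => f.ap (vals s)) ++
          f.ap (vals u ++ m.ap (vals s) :: vals w) :: T.map fun s => f.ap (vals s)))))) := by
    simp only [derComp, sum3_map, blockSum_sum3]
    refine sum3_congr _ _ _ fun p s t _ => ?_
    have h1 : ∀ P T : List (List (HElt 𝒜)), P.flatten = p →
        blockSum s (fun S => (-1 : k) ^ wdeg (P.map (f.arc hf)) •
          F.ap (vals (P.map (f.arc hf)) ++ mB.ap (vals (S.map (f.arc hf))) ::
            vals (T.map (f.arc hf)))) =
        sum3 s (fun u s w => (-1 : k) ^ wdeg (p ++ u) • F.ap ((P.map fun s => f.ap (vals s)) ++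
          f.ap (vals u ++ m.ap (vals s) :: vals w) :: T.map fun s => f.ap (vals s))) := by
      intro P T hP
      simp only [vals_map_arc, wdeg_map_arc, hP, ← F.slot_apply]
      have := congrArg ((-1 : k) ^ wdeg p • F.slot (P.map fun s => f.ap (vals s))
        (T.map fun s => f.ap (vals s))) (hrel s)
      rw [map_blockSum, derComp, map_sum3] at this
      refine Eq.trans this (sum3_congr _ _ _ fun u s w _ => ?_)
      rw [map_smul, LinearMap.smul_apply, smul_smul, sgn_mul, wdeg_append, add_comm]
    calc _ = blockSum p (fun P => blockSum t (fun T => blockSum s (fun S =>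
          (-1 : k) ^ wdeg (P.map (f.arc hf)) •
          F.ap (vals (P.map (f.arc hf)) ++ mB.ap (vals (S.map (f.arc hf))) ::
            vals (T.map (f.arc hf)))))) := by
            congr 1
            funext P
            exact blockSum_comm _ _ _
      _ = blockSum p (fun P => blockSum t (fun T => sum3 s (fun u s w =>
          (-1 : k) ^ wdeg (p ++ u) • F.ap ((P.map fun s => f.ap (vals s)) ++
          f.ap (vals u ++ m.ap (vals s) :: vals w) :: T.map fun s => f.ap (vals s))))) :=
            blockSum_congr _ _ _ fun P hP _ => blockSum_congr _ _ _ fun T _ _ => h1 P T hP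
      _ = _ := by
            simp only [sum3, blockSum_sum2_comm]
  -- Regrouped by the block on which `m` acts, the sum is over divisions into blocks of the word in
  -- which that block has been replaced by its image.
  rw [hL, ← sum3_nest x (fun p u s w t => blockSum p (fun P => blockSum t (fun T =>
        (-1 : k) ^ wdeg (p ++ u) • F.ap ((P.map fun s => f.ap (vals s)) ++
          f.ap (vals u ++ m.ap (vals s) :: vals w) :: T.map fun s => f.ap (vals s)))))]
  refine sum3_congr _ _ _ fun p s t _ => ?_
  rw [blockSum_append_cons, ← sum2_smul]
  refine sum2_congr _ _ _ fun U u hp => ?_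
  simp only [blockSum_sum2_comm]
  rw [← sum2_smul]
  refine sum2_congr _ _ _ fun w T _ => ?_
  have h := map_blockSum (((-1 : k) ^ wdeg p) • (LinearMap.id : N →ₗ[k] N)) U
    (fun P => blockSum T (fun Q => F.ap ((P ++ (u ++ m.elt 1 hm s :: w) :: Q).map
      fun s => f.ap (vals s))))
  simp only [LinearMap.smul_apply, LinearMap.id_apply] at h
  rw [h]
  congr 1
  funext P
  have h' := map_blockSum (((-1 : k) ^ wdeg p) • (LinearMap.id : N →ₗ[k] N)) T
    (fun Q => F.ap ((P ++ (u ++ m.elt 1 hm s :: w) :: Q).map fun s => f.ap (vals s)))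
  simp only [LinearMap.smul_apply, LinearMap.id_apply] at h'
  rw [h', hp]
  simp only [List.map_append, List.map_cons, vals_append, vals_cons]
  rfl

end Transport

end AInfinity

namespace AInfinity

/-! ### Cuts of a cyclic word into two arcs with a distinguished block -/

section Nesting

variable {α N : Type*} [AddCommMonoid N]

theorem sum3_sum2_left (l : List α) (G : List α → List α → List α → List α → N) :
    sum3 l (fun q s t => sum2 q (fun p r => G p r s t)) =
      sum2 l (fun p q => sum3 q (fun r s t => G p r s t)) := by
  have h1 : sum3 l (fun q s t => sum2 q (fun p r => G p r s t)) =
      sum2 l (fun q r' => sum2 q (fun p r => sum2 r' (fun s t => G p r s t))) := by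
    simp only [sum3]
    exact sum2_congr _ _ _ fun q r' _ => sum2_comm _ _ _
  rw [h1, sum2_assoc]
  rfl

theorem sum3_sum2_right (l : List α) (G : List α → List α → List α → List α → N) :
    sum3 l (fun p s r => sum2 r (fun t q => G p s t q)) =
      sum2 l (fun r q => sum3 r (fun p s t => G p s t q)) := by
  have h : ∀ r q : List α, sum3 r (fun p s t => G p s t q) =
      sum2 r (fun p r' => sum2 r' (fun s t => G p s t q)) := fun _ _ => rfl
  simp only [h]
  rw [sum2_assoc]
  simp only [sum3]
  refine sum2_congr _ _ _ fun p r _ => ?_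
  rw [sum2_assoc, sum3]

theorem sum2_sum3_comm {β : Type*} (l : List α) (l' : List β)
    (F : List α → List α → List β → List β → List β → N) :
    sum2 l (fun p t => sum3 l' (F p t)) = sum3 l' (fun a b c => sum2 l (fun p t => F p t a b c)) :=
        by
  simp only [sum3]
  rw [sum2_comm]
  exact sum2_congr _ _ _ fun _ _ _ => sum2_comm _ _ _

theorem sum3_eq_mid (l : List α) (F : List α → List α → List α → N)
    (h : ∀ p s t, p ++ (s ++ t) = l → p ≠ [] ∨ t ≠ [] → F p s t = 0) : sum3 l F = F [] l [] := by
  rw [sum3, sum2_eq_first, sum2_eq_last]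
  · exact fun s t hl ht => h _ _ _ (by simpa using hl) (Or.inr ht)
  · exact fun p r hl hp => sum2_eq_zero _ _ fun s t hr => h _ _ _ (by rw [hr, hl]) (Or.inl hp)

/-- This and the next five lemmas treat the cuts of `a x b y` into the arcs `a2 x b1` and `b2 y a1`
together with a block inside one arc. The block lies left of, around, or right of `x` in the `first`
lemmas, and of `y` in the `second` ones. On the right-hand side the arcs are chosen before the
block. -/
theorem cut_first_left (a : List α) (b : List α)
    (G : List α → List α → List α → List α → List α → List α → N) :
    sum3 a (fun q s t => sum2 q (fun a1 p => sum2 b (fun b1 b2 => G a1 p s t b1 b2))) =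
      sum2 a (fun a1 a2 => sum2 b (fun b1 b2 => sum3 a2 (fun p s t => G a1 p s t b1 b2))) := by
  rw [sum3_sum2_left]
  exact sum2_congr _ _ _ fun a1 a2 _ => (sum2_sum3_comm _ _ _).symm

theorem cut_first_mid (a : List α) (b : List α)
    (G : List α → List α → List α → List α → List α → List α → N) :
    sum2 a (fun q s => sum2 b (fun s' r => sum2 q (fun a1 p => sum2 r (fun t b2 =>
      G a1 p s s' t b2)))) =
    sum2 a (fun a1 a2 => sum2 b (fun b1 b2 => sum2 a2 (fun p s => sum2 b1 (fun s' t =>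
      G a1 p s s' t b2)))) := by
  have h : ∀ q s, sum2 b (fun s' r => sum2 q (fun a1 p => sum2 r (fun t b2 =>
      G a1 p s s' t b2))) = sum2 q (fun a1 p => sum3 b (fun s' t b2 => G a1 p s s' t b2)) :=
    fun q s => sum2_comm _ _ _
  simp only [h]
  rw [sum2_assoc, sum3]
  refine sum2_congr _ _ _ fun a1 a2 _ => ?_
  rw [sum2_comm]
  exact sum2_congr _ _ _ fun p s _ => (sum2_assoc _ _).symm

theorem cut_first_right (a : List α) (b : List α)
    (G : List α → List α → List α → List α → List α → List α → N) :
    sum3 b (fun p s r => sum2 a (fun a1 a2 => sum2 r (fun t b2 => G a1 a2 p s t b2))) =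
      sum2 a (fun a1 a2 => sum2 b (fun b1 b2 => sum3 b1 (fun p s t => G a1 a2 p s t b2))) := by
  rw [← sum2_sum3_comm]
  exact sum2_congr _ _ _ fun a1 a2 _ => sum3_sum2_right _ _

theorem cut_second_left (a : List α) (b : List α)
    (G : List α → List α → List α → List α → List α → List α → N) :
    sum3 b (fun q s t => sum2 a (fun a1 a2 => sum2 q (fun b1 p => G a1 a2 b1 p s t))) =
      sum2 a (fun a1 a2 => sum2 b (fun b1 b2 => sum3 b2 (fun p s t => G a1 a2 b1 p s t))) := by
  rw [← sum2_sum3_comm]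
  exact sum2_congr _ _ _ fun a1 a2 _ => sum3_sum2_left _ _

theorem cut_second_mid (a : List α) (b : List α)
    (G : List α → List α → List α → List α → List α → List α → N) :
    sum2 a (fun s' r => sum2 b (fun q s => sum2 r (fun t a2 => sum2 q (fun b1 p =>
      G s' t a2 b1 p s)))) =
    sum2 a (fun a1 a2 => sum2 b (fun b1 b2 => sum2 b2 (fun p s => sum2 a1 (fun s' t =>
      G s' t a2 b1 p s)))) := by
  have h : ∀ s' r, sum2 b (fun q s => sum2 r (fun t a2 => sum2 q (fun b1 p =>
      G s' t a2 b1 p s))) = sum2 r (fun t a2 => sum3 b (fun b1 p s => G s' t a2 b1 p s)) := by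
    intro s' r
    rw [sum2_comm]
    exact sum2_congr _ _ _ fun _ _ _ => sum2_assoc _ _
  simp only [h]
  have h' : ∀ a1 a2, sum2 b (fun b1 b2 => sum2 b2 (fun p s => sum2 a1 (fun s' t =>
      G s' t a2 b1 p s))) = sum2 a1 (fun s' t => sum3 b (fun b1 p s => G s' t a2 b1 p s)) := by
    intro a1 a2
    exact (sum2_sum3_comm _ _ _).symm
  simp only [h']
  rw [sum2_assoc, sum3]

theorem cut_second_right (a : List α) (b : List α)
    (G : List α → List α → List α → List α → List α → List α → N) :
    sum3 a (fun p s r => sum2 r (fun t a2 => sum2 b (fun b1 b2 => G p s t a2 b1 b2))) =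
      sum2 a (fun a1 a2 => sum2 b (fun b1 b2 => sum3 a1 (fun p s t => G p s t a2 b1 b2))) := by
  rw [sum3_sum2_right]
  exact sum2_congr _ _ _ fun a1 a2 _ => (sum2_sum3_comm _ _ _).symm

end Nesting

/-! ### The Lie derivative of an arc sum -/

section Lie

variable {k : Type v} [Field k] {A : Type u} [AddCommGroup A] [Module k A]
  {𝒜 : ℤ → Submodule k A}

/-- The sum of `B u v` over all ways of cutting the cyclic word `a x b y` into two arcs `u ∋ x`
and `v ∋ y`. -/
def arcSum (B : List (HElt 𝒜) → List (HElt 𝒜) → k) (a : List (HElt 𝒜)) (x : HElt 𝒜)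
    (b : List (HElt 𝒜)) (y : HElt 𝒜) : k :=
  sum2 a (fun p s => sum2 b (fun s' t =>
    (-1 : k) ^ (wdeg p * (wdeg s + x.1 + wdeg s' + wdeg t + y.1)) *
      B (s ++ x :: s') (t ++ y :: p)))

variable (B : List (HElt 𝒜) → List (HElt 𝒜) → k) (mE : List (HElt 𝒜) → HElt 𝒜)

theorem sgn_merge {a b c : ℤ} (h : (a : ZMod 2) + b = c) (X : k) :
    (-1 : k) ^ a * ((-1 : k) ^ b * X) = (-1 : k) ^ c * X := by
  rw [← mul_assoc, sgn_mul]
  congr 1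
  exact sgn_eq (by push_cast; exact h)

/-- The derivative of an arc sum along an odd coderivation: it acts on the two arcs. -/
theorem arcSum_lie (hmE : ∀ s, (mE s).1 = wdeg s + 1) (a : List (HElt 𝒜)) (x : HElt 𝒜)
    (b : List (HElt 𝒜)) (y : HElt 𝒜) :
    sum3 a (fun p s t => (-1 : k) ^ wdeg p * arcSum B (p ++ mE s :: t) x b y) +
    sum2 a (fun p s => sum2 b (fun s' t => (-1 : k) ^ wdeg p *
      arcSum B p (mE (s ++ x :: s')) t y)) +
    sum3 b (fun p s t => (-1 : k) ^ (wdeg a + x.1 + wdeg p) *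
      arcSum B a x (p ++ mE s :: t) y) -
    sum2 a (fun p s => sum2 b (fun s' t => (-1 : k) ^ (1 + (wdeg s + x.1 + wdeg s') +
      wdeg p * ((wdeg s + x.1 + wdeg s') + wdeg t + y.1)) *
        arcSum B s x s' (mE (t ++ y :: p)))) =
    sum2 a (fun a1 a2 => sum2 b (fun b1 b2 =>
      (-1 : k) ^ (wdeg a1 * (wdeg a2 + x.1 + wdeg b1 + wdeg b2 + y.1)) *
        sum3 (a2 ++ x :: b1) (fun p s t => (-1 : k) ^ wdeg p *
          B (p ++ mE s :: t) (b2 ++ y :: a1)))) +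
    sum2 a (fun a1 a2 => sum2 b (fun b1 b2 =>
      (-1 : k) ^ (wdeg a1 * (wdeg a2 + x.1 + wdeg b1 + wdeg b2 + y.1) +
        (wdeg a2 + x.1 + wdeg b1)) *
        sum3 (b2 ++ y :: a1) (fun p s t => (-1 : k) ^ wdeg p *
          B (a2 ++ x :: b1) (p ++ mE s :: t)))) := by
  have hadd : ∀ r z z' : k, r * (z + z') = r * z + r * z' := mul_add
  have hneg : sum2 a (fun p s => sum2 b (fun s' t => (-1 : k) ^ (1 + (wdeg s + x.1 + wdeg s') +
      wdeg p * ((wdeg s + x.1 + wdeg s') + wdeg t + y.1)) *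
        arcSum B s x s' (mE (t ++ y :: p)))) =
      -sum2 a (fun p s => sum2 b (fun s' t => (-1 : k) ^ ((wdeg s + x.1 + wdeg s') +
      wdeg p * ((wdeg s + x.1 + wdeg s') + wdeg t + y.1)) *
        arcSum B s x s' (mE (t ++ y :: p)))) := by
    simp only [← sum2_neg]
    refine sum2_congr _ _ _ fun p s _ => sum2_congr _ _ _ fun s' t _ => ?_
    rw [← neg_mul]
    congr 1
    rw [← neg_sgn_eq]
    push_cast; grind
  rw [hneg, sub_neg_eq_add]
  simp only [arcSum, sum2_append_cons, sum2_add, sum3_append_cons, sum3_add, hadd,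
    ← sum2_mul, ← sum3_mul]
  -- The terms are sorted by the position of the block replaced by `mE`. In `q1`, `q2` and `q3` it
  -- lies in the arc of `x`: to the left of `x`, around it, to the right of it.
  have q1 : sum3 a (fun q s t => sum2 q (fun a1 p => sum2 b (fun b1 b2 => (-1 : k) ^ wdeg q *
      ((-1 : k) ^ (wdeg a1 * (wdeg (p ++ mE s :: t) + x.1 + wdeg b1 + wdeg b2 + y.1)) *
      B (p ++ mE s :: t ++ x :: b1) (b2 ++ y :: a1))))) =
      sum2 a (fun a1 a2 => sum2 b (fun b1 b2 => sum3 a2 (fun p s t => (-1 : k) ^ (wdeg a1 *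
          (wdeg a2 + x.1 + wdeg b1 + wdeg b2 + y.1)) * ((-1 : k) ^ wdeg p *
          B (p ++ mE s :: (t ++ x :: b1)) (b2 ++ y :: a1))))) := by
    refine Eq.trans ?_ ((cut_first_left a b (fun a1 p s t b1 b2 => (-1 : k) ^ (wdeg a1 * (wdeg p +
        wdeg s + wdeg t + x.1 + wdeg b1 + wdeg b2 + y.1) + wdeg p) *
      B (p ++ mE s :: (t ++ x :: b1)) (b2 ++ y :: a1))).trans ?_)
    · refine sum3_congr _ _ _ fun q s t _ => sum2_congr _ _ _ fun a1 p hq =>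
          sum2_congr _ _ _ fun b1 b2 _ => ?_
      subst hq
      simp only [List.append_assoc, List.cons_append]
      refine sgn_merge ?_ _
      simp only [wdeg_append, wdeg_cons, hmE]; push_cast; grind
    · refine sum2_congr _ _ _ fun a1 a2 _ => sum2_congr _ _ _ fun b1 b2 _ =>
          sum3_congr _ _ _ fun p s t ha => ?_
      subst ha
      refine (sgn_merge ?_ _).symm
      simp only [wdeg_append]; push_cast; grind
  have q2 : sum2 a (fun q s => sum2 b (fun s' r => sum2 q (fun a1 p => sum2 r (fun t b2 =>
      (-1 : k) ^ wdeg q * ((-1 : k) ^ (wdeg a1 * (wdeg p + (mE (s ++ x :: s')).1 + wdeg t +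
      wdeg b2 + y.1)) * B (p ++ mE (s ++ x :: s') :: t) (b2 ++ y :: a1)))))) =
      sum2 a (fun a1 a2 => sum2 b (fun b1 b2 => sum2 a2 (fun p s => sum2 b1 (fun s' t =>
          (-1 : k) ^ (wdeg a1 * (wdeg a2 + x.1 + wdeg b1 + wdeg b2 + y.1)) * ((-1 : k) ^ wdeg p *
          B (p ++ mE (s ++ x :: s') :: t) (b2 ++ y :: a1)))))) := by
    refine Eq.trans ?_ ((cut_first_mid a b (fun a1 p s s' t b2 => (-1 : k) ^ (wdeg a1 * (wdeg p +
        wdeg s + x.1 + wdeg s' + wdeg t + wdeg b2 + y.1) + wdeg p) *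
      B (p ++ mE (s ++ x :: s') :: t) (b2 ++ y :: a1))).trans ?_)
    · refine sum2_congr _ _ _ fun q s _ => sum2_congr _ _ _ fun s' r _ =>
          sum2_congr _ _ _ fun a1 p hq => sum2_congr _ _ _ fun t b2 _ => ?_
      subst hq
      refine sgn_merge ?_ _
      simp only [wdeg_append, wdeg_cons, hmE]; push_cast; grind
    · refine sum2_congr _ _ _ fun a1 a2 _ => sum2_congr _ _ _ fun b1 b2 _ =>
          sum2_congr _ _ _ fun p s ha => sum2_congr _ _ _ fun s' t hb => ?_
      subst ha hb
      refine (sgn_merge ?_ _).symm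
      simp only [wdeg_append]; push_cast; grind
  have q3 : sum3 b (fun p s r => sum2 a (fun a1 a2 => sum2 r (fun t b2 => (-1 : k) ^ (wdeg a +
      x.1 + wdeg p) * ((-1 : k) ^ (wdeg a1 * (wdeg a2 + x.1 + wdeg (p ++ mE s :: t) + wdeg b2 +
      y.1)) * B (a2 ++ x :: (p ++ mE s :: t)) (b2 ++ y :: a1))))) =
      sum2 a (fun a1 a2 => sum2 b (fun b1 b2 => sum3 b1 (fun p s t => (-1 : k) ^ (wdeg a1 *
          (wdeg a2 + x.1 + wdeg b1 + wdeg b2 + y.1)) * ((-1 : k) ^ wdeg (a2 ++ x :: p) *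
          B ((a2 ++ x :: p) ++ mE s :: t) (b2 ++ y :: a1))))) := by
    refine Eq.trans ?_ ((cut_first_right a b (fun a1 a2 p s t b2 => (-1 : k) ^ (wdeg a1 *
        (wdeg a2 + x.1 + wdeg p + wdeg s + wdeg t + wdeg b2 + y.1) + wdeg a2 + x.1 + wdeg p) *
      B (a2 ++ x :: (p ++ mE s :: t)) (b2 ++ y :: a1))).trans ?_)
    · refine sum3_congr _ _ _ fun p s r _ => sum2_congr _ _ _ fun a1 a2 ha =>
          sum2_congr _ _ _ fun t b2 _ => ?_
      have := zmod_two_mul_self (wdeg a1 : ZMod 2)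
      subst ha
      refine sgn_merge ?_ _
      simp only [wdeg_append, wdeg_cons, hmE]; push_cast; grind
    · refine sum2_congr _ _ _ fun a1 a2 _ => sum2_congr _ _ _ fun b1 b2 _ =>
          sum3_congr _ _ _ fun p s t hb => ?_
      subst hb
      simp only [List.append_assoc, List.cons_append]
      refine (sgn_merge ?_ _).symm
      simp only [wdeg_append, wdeg_cons]; push_cast; grind
  -- In `q4`, `q5` and `q6` the block lies in the arc of `y`. The blocks around `y` are the
  -- contribution of the dual bimodule structure.
  have q4 : sum3 b (fun q s t => sum2 a (fun a1 a2 => sum2 q (fun b1 p => (-1 : k) ^ (wdeg a +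
      x.1 + wdeg q) * ((-1 : k) ^ (wdeg a1 * (wdeg a2 + x.1 + wdeg b1 + wdeg (p ++ mE s :: t) +
      y.1)) * B (a2 ++ x :: b1) (p ++ mE s :: t ++ y :: a1))))) =
      sum2 a (fun a1 a2 => sum2 b (fun b1 b2 => sum3 b2 (fun p s t => (-1 : k) ^ (wdeg a1 *
          (wdeg a2 + x.1 + wdeg b1 + wdeg b2 + y.1) + (wdeg a2 + x.1 + wdeg b1)) *
          ((-1 : k) ^ wdeg p * B (a2 ++ x :: b1) (p ++ mE s :: (t ++ y :: a1)))))) := by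
    refine Eq.trans ?_ ((cut_second_left a b (fun a1 a2 b1 p s t => (-1 : k) ^ (wdeg a1 *
        (wdeg a2 + x.1 + wdeg b1 + wdeg p + wdeg s + wdeg t + y.1) + wdeg a2 + x.1 + wdeg b1 +
        wdeg p) *
      B (a2 ++ x :: b1) (p ++ mE s :: (t ++ y :: a1)))).trans ?_)
    · refine sum3_congr _ _ _ fun q s t _ => sum2_congr _ _ _ fun a1 a2 ha =>
          sum2_congr _ _ _ fun b1 p hq => ?_
      subst ha hq
      simp only [List.append_assoc, List.cons_append]
      refine sgn_merge ?_ _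
      simp only [wdeg_append, wdeg_cons, hmE]; push_cast; grind
    · refine sum2_congr _ _ _ fun a1 a2 _ => sum2_congr _ _ _ fun b1 b2 _ =>
          sum3_congr _ _ _ fun p s t hb => ?_
      subst hb
      refine (sgn_merge ?_ _).symm
      simp only [wdeg_append]; push_cast; grind
  have q5 : sum2 a (fun s' r => sum2 b (fun q s => sum2 r (fun t a2 => sum2 q (fun b1 p =>
      (-1 : k) ^ ((wdeg r + x.1 + wdeg q) + wdeg s' * ((wdeg r + x.1 + wdeg q) + wdeg s + y.1)) *
      ((-1 : k) ^ (wdeg t * (wdeg a2 + x.1 + wdeg b1 + wdeg p + (mE (s ++ y :: s')).1)) *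
      B (a2 ++ x :: b1) (p ++ mE (s ++ y :: s') :: t)))))) =
      sum2 a (fun a1 a2 => sum2 b (fun b1 b2 => sum2 b2 (fun p s => sum2 a1 (fun s' t =>
          (-1 : k) ^ (wdeg a1 * (wdeg a2 + x.1 + wdeg b1 + wdeg b2 + y.1) + (wdeg a2 + x.1 +
          wdeg b1)) * ((-1 : k) ^ wdeg p * B (a2 ++ x :: b1) (p ++ mE (s ++ y :: s') :: t)))))) :=
          by
    refine Eq.trans ?_ ((cut_second_mid a b (fun s' t a2 b1 p s => (-1 : k) ^ ((wdeg s' + wdeg t) *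
        (wdeg a2 + x.1 + wdeg b1 + wdeg p + wdeg s + y.1) + wdeg a2 + x.1 + wdeg b1 + wdeg p) *
      B (a2 ++ x :: b1) (p ++ mE (s ++ y :: s') :: t))).trans ?_)
    · refine sum2_congr _ _ _ fun s' r _ => sum2_congr _ _ _ fun q s _ =>
          sum2_congr _ _ _ fun t a2 hr => sum2_congr _ _ _ fun b1 p hq => ?_
      subst hr hq
      refine sgn_merge ?_ _
      simp only [wdeg_append, wdeg_cons, hmE]; push_cast; grind
    · refine sum2_congr _ _ _ fun a1 a2 _ => sum2_congr _ _ _ fun b1 b2 _ =>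
          sum2_congr _ _ _ fun p s hb => sum2_congr _ _ _ fun s' t ha => ?_
      subst ha hb
      refine (sgn_merge ?_ _).symm
      simp only [wdeg_append]; push_cast; grind
  have q6 : sum3 a (fun p s r => sum2 r (fun t a2 => sum2 b (fun b1 b2 => (-1 : k) ^ wdeg p *
      ((-1 : k) ^ (wdeg (p ++ mE s :: t) * (wdeg a2 + x.1 + wdeg b1 + wdeg b2 + y.1)) *
      B (a2 ++ x :: b1) (b2 ++ y :: (p ++ mE s :: t)))))) =
      sum2 a (fun a1 a2 => sum2 b (fun b1 b2 => sum3 a1 (fun p s t => (-1 : k) ^ (wdeg a1 *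
          (wdeg a2 + x.1 + wdeg b1 + wdeg b2 + y.1) + (wdeg a2 + x.1 + wdeg b1)) *
          ((-1 : k) ^ wdeg (b2 ++ y :: p) * B (a2 ++ x :: b1) ((b2 ++ y :: p) ++ mE s :: t))))) :=
          by
    refine Eq.trans ?_ ((cut_second_right a b (fun p s t a2 b1 b2 => (-1 : k) ^ ((wdeg p + wdeg s +
        wdeg t) * (wdeg a2 + x.1 + wdeg b1 + wdeg b2 + y.1) + wdeg a2 + x.1 + wdeg b1 + wdeg b2 +
        y.1 + wdeg p) *
      B (a2 ++ x :: b1) (b2 ++ y :: (p ++ mE s :: t)))).trans ?_)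
    · refine sum3_congr _ _ _ fun p s r _ => sum2_congr _ _ _ fun t a2 hr =>
          sum2_congr _ _ _ fun b1 b2 _ => ?_
      subst hr
      refine sgn_merge ?_ _
      simp only [wdeg_append, wdeg_cons, hmE]; push_cast; grind
    · refine sum2_congr _ _ _ fun a1 a2 _ => sum2_congr _ _ _ fun b1 b2 _ =>
          sum3_congr _ _ _ fun p s t ha => ?_
      subst ha
      simp only [List.append_assoc, List.cons_append]
      refine (sgn_merge ?_ _).symm
      simp only [wdeg_append, wdeg_cons]; push_cast; grind
  linear_combination q1 + q2 + q3 + q4 + q5 + q6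

end Lie

end AInfinity

namespace AInfinity

/-! ### Cuts into two arcs, one of which is divided into blocks -/

section Nesting

variable {α N : Type*} [AddCommMonoid N]

/-- With `a = a1 U s` and `b = s' V b2`, the word consists of a block `s x s'`, a block `b2 y a1`,
and the words `U` and `V` between them, divided into blocks `P` and `Q`. Here the arc of `x` is
divided and that of `y` is one block; in `cut_blocks_second` the roles are exchanged, and the result
is the same sum. -/
theorem cut_blocks_first (a b : List α)
    (H : List α → List α → List α → List α → List α → List α → List (List α) →
      List (List α) → N) :
    sum2 a (fun a1 a2 => sum2 b (fun b1 b2 => sum2 a2 (fun U s => blockSum U (fun P =>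
      sum2 b1 (fun s' V => blockSum V (fun Q => H a1 U s s' V b2 P Q)))))) =
    sum3 a (fun a1 U s => sum3 b (fun s' V b2 => blockSum U (fun P => blockSum V (fun Q =>
      H a1 U s s' V b2 P Q)))) := by
  simp only [blockSum_sum2_comm]
  rw [sum3]
  refine sum2_congr _ _ _ fun a1 a2 _ => ?_
  rw [sum2_comm]
  exact sum2_congr _ _ _ fun U s _ => sum2_assoc _ _

theorem cut_blocks_second (a b : List α)
    (H : List α → List α → List α → List α → List α → List α → List (List α) →
      List (List α) → N) :
    sum2 a (fun p s => sum2 b (fun s' t => sum2 t (fun V b2 => blockSum V (fun Q =>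
      sum2 p (fun a1 U => blockSum U (fun P => H a1 U s s' V b2 P Q)))))) =
    sum3 a (fun a1 U s => sum3 b (fun s' V b2 => blockSum U (fun P => blockSum V (fun Q =>
      H a1 U s s' V b2 P Q)))) := by
  simp only [blockSum_sum2_comm]
  rw [← sum2_assoc]
  refine sum2_congr _ _ _ fun p s _ => ?_
  rw [sum2_sum3_comm, sum3]
  refine sum2_congr _ _ _ fun s' t _ => sum2_congr _ _ _ fun V b2 _ =>
    sum2_congr _ _ _ fun a1 U _ => blockSum_comm _ _ _

theorem blockSum_mul {k : Type*} [Field k] (r : k) (l : List α) (G : List (List α) → k) :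
    blockSum l (fun c => r * G c) = r * blockSum l G :=
  (map_blockSum (AddMonoidHom.mulLeft r) l G).symm

end Nesting

/-! ### Transport of the operations and of the cyclic pairing -/

section Transport

variable {k : Type v} [Field k] {A : Type u} [AddCommGroup A] [Module k A]
  {𝒜 : ℤ → Submodule k A} {ι : Type w} [Fintype ι] (e : Module.Basis ι k A) {deg : ι → ℤ}
  {f : MultiFamily k A A}

theorem derComp_mem {m : MultiFamily k A A}
    (hm : ∀ x : List (HElt 𝒜), m.ap (vals x) ∈ 𝒜 (wdeg x + 1))
    (hf : ∀ x : List (HElt 𝒜), f.ap (vals x) ∈ 𝒜 (wdeg x)) (x : List (HElt 𝒜)) :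
    derComp m f x ∈ 𝒜 (wdeg x + 1) := by
  refine sum2_mem _ _ _ fun p r hx => sum2_mem _ _ _ fun s t hr => Submodule.smul_mem _ _ ?_
  have h := hf (p ++ m.elt 1 hm s :: t)
  rw [vals_append, vals_cons] at h
  have hd : wdeg (p ++ m.elt 1 hm s :: t) = wdeg x + 1 := by
    rw [← hx, ← hr]
    simp only [wdeg_append, wdeg_cons, MultiFamily.elt]
    ring
  rwa [hd] at h

/-- Transport of an `A_∞`-structure along a formal coordinate change. -/
theorem exists_transport (h𝒜 : DirectSum.IsInternal 𝒜) (hdeg : ∀ i, e i ∈ 𝒜 (deg i))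
    (M : AInfAlgebra 𝒜) (h1 : ∀ a, f.ap [a] = a)
    (hf : ∀ x : List (HElt 𝒜), f.ap (vals x) ∈ 𝒜 (wdeg x)) :
    ∃ MB : AInfAlgebra 𝒜, ∀ x : List (HElt 𝒜),
      blockSum x (fun c => MB.m.ap (c.map fun s => f.ap (vals s))) = derComp M.m f x := by
  -- The morphism relation is solved for the operation of highest arity: the cut into single letters
  -- contributes exactly that operation, since `f₁ = id`, and the truncation retains all the other
  -- cuts.
  let W : ℕ → MultiFamily k A A → List (HElt 𝒜) → A := fun n g x =>
    derComp M.m f x - blockSum x (fun c => (g.trunc n).ap (c.map fun s => f.ap (vals s)))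
  have hW : ∀ n g, WLin (W n g) := fun n g => by
    refine (derComp_wLin M.m f).sub (WLin.blockSum fun P Q => ?_)
    simp only [List.map_append, List.map_cons]
    exact (WLin.ap_vals f).map ((g.trunc n).slot _ _)
  obtain ⟨m, hm⟩ := MultiFamily.exists_eq_step
    (fun g => familyOfWords e (fun I => W I.length g (I.map (basisElt e hdeg)))) (by
    intro F F' n hF
    refine familyOfWords_congr e _ _ n fun I hI => ?_
    have : F.trunc I.length = F'.trunc I.length := by
      funext i
      simp only [MultiFamily.trunc]
      split_ifs with hi
      · exact hF i (hI ▸ hi)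
      · rfl
    simp only [W, this])
  have hm' : ∀ x : List (HElt 𝒜), m.ap (vals x) = W x.length m x := by
    intro x
    rw [← familyOfWords_ap_vals e hdeg h𝒜 (hW x.length m)]
    rw [MultiFamily.ap_congr (hm _)]
    refine MultiFamily.ap_congr (familyOfWords_congr e _ _ _ fun I hI => ?_)
    rw [length_vals] at hI
    rw [hI]
  have hrel : ∀ x : List (HElt 𝒜),
      blockSum x (fun c => m.ap (c.map fun s => f.ap (vals s))) = derComp M.m f x := by
    intro x
    rw [blockSum_eq_add]
    have e1 : ((x.map fun a => [a]).map fun s => f.ap (vals s)) = vals x := by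
      rw [List.map_map]
      exact List.map_congr_left fun a _ => h1 _
    have e2 : blockSum x (fun c => (m.trunc x.length).ap (c.map fun s => f.ap (vals s))) =
        blockSum x (fun c => if c.length < x.length then
          m.ap (c.map fun s => f.ap (vals s)) else 0) := by
      simp only [MultiFamily.trunc_ap, List.length_map]
    rw [e1, hm', ← e2]
    simp only [W]
    abel
  have hm0 : m 0 = 0 := by
    have h := hm' []
    simp only [W, blockSum, MultiFamily.trunc_ap, derComp, sum3, sum2, vals_nil, wdeg_nil] at h
    have h2 : f.ap [M.m.ap []] = 0 := by rw [h1, M.m.ap_nil M.strict]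
    have h3 : m.ap [] = 0 := by simpa [h2] using h
    refine MultilinearMap.ext fun a => ?_
    rw [← MultiFamily.ap_ofFn]
    exact h3
  have hm1 : ∀ x : List (HElt 𝒜), m.ap (vals x) ∈ 𝒜 (wdeg x + 1) := by
    intro x
    induction hn : x.length using Nat.strong_induction_on generalizing x with
    | _ n ih =>
      rw [hm']
      refine Submodule.sub_mem _ (derComp_mem M.degree_one hf x) (blockSum_mem _ _ _ fun c hc => ?_)
      rw [MultiFamily.trunc_ap, List.length_map]
      split_ifs with hlt
      · have := ih _ (hn ▸ hlt) (c.map (f.arc hf)) (List.length_map _)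
        rwa [vals_map_arc, wdeg_map_arc, hc] at this
      · exact Submodule.zero_mem _
  refine ⟨⟨m, hm0, hm1, fun x => ?_⟩, hrel⟩
  -- By unitriangularity the relation for `m` may be checked after substitution of `f`, where it
  -- becomes the square of the coderivation of `M`.
  refine eq_zero_of_blockSum_arc hf h1 (derComp m m) (fun x => ?_) x
  rw [blockSum_derComp M.degree_one hf hrel m]
  simp only [hrel]
  exact derComp_derComp M f x

/-- Transport of a constant bimodule map. -/
theorem pairing_cyclic_of_transport {D : ℤ} {M MB : AInfAlgebra 𝒜} (h1 : ∀ a, f.ap [a] = a)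
    (hf : ∀ x : List (HElt 𝒜), f.ap (vals x) ∈ 𝒜 (wdeg x))
    (hrel : ∀ x : List (HElt 𝒜),
      blockSum x (fun c => MB.m.ap (c.map fun s => f.ap (vals s))) = derComp M.m f x)
    {ψ : A →ₗ[k] A →ₗ[k] k}
    (hψ : ∀ x y : HElt 𝒜, ψ x.2 y.2 = -((-1 : k) ^ (x.1 * y.1) * ψ y.2 x.2))
    (Φ : PreBimoduleMap 𝒜 D) (hΦ : Φ.IsBimoduleMap M)
    (hev : ∀ a x b y, Φ.ev a x b y = pullback 𝒜 f ψ a x b y)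
    (a : List (HElt 𝒜)) (x : HElt 𝒜) (b : List (HElt 𝒜)) (y : HElt 𝒜) :
    ψ (MB.m.ap (vals (a ++ x :: b))) y.2 = (-1 : k) ^ ((wdeg a + x.1) * (wdeg b + y.1)) *
      ψ (MB.m.ap (vals (b ++ y :: a))) x.2 := by
  -- the cyclic defect
  let C : TwoMarked 𝒜 := fun a x b y => ψ (MB.m.ap (vals (a ++ x :: b))) y.2 -
    (-1 : k) ^ ((wdeg a + x.1) * (wdeg b + y.1)) * ψ (MB.m.ap (vals (b ++ y :: a))) x.2
  let B : List (HElt 𝒜) → List (HElt 𝒜) → k := fun s t => ψ (f.ap (vals s)) (f.ap (vals t))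
  -- The pullback of the defect along `f` vanishes: by `arcSum_lie` the bimodule equation says that
  -- the derivatives of the two arcs add up to zero, and the morphism relation turns each derivative
  -- into the transported operation applied to blocks.
  have hsum : ∀ a x b y, sum3 a (fun a1 U s => sum3 b (fun s' V b2 =>
      blockSum U (fun P => blockSum V (fun Q =>
        (-1 : k) ^ (wdeg a1 * (wdeg U + wdeg s + x.1 + wdeg s' + wdeg V + wdeg b2 + y.1)) *
          C (P.map (f.arc hf)) (f.arc hf (s ++ x :: s')) (Q.map (f.arc hf))
            (f.arc hf (b2 ++ y :: a1)))))) = 0 := by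
    intro a x b y
    have hlie := arcSum_lie B (M.m.elt 1 M.degree_one) (fun _ => rfl) a x b y
    have hB : ∀ a x b y, arcSum B a x b y = Φ.ev a x b y := fun a x b y => by
      rw [hev, pullback_eq]; rfl
    have hb := hΦ a x b y
    simp only [dualOp] at hb
    simp only [hB, PreBimoduleMap.ev, vals_append, vals_cons, MultiFamily.elt_val] at hlie
    rw [sub_eq_zero.mpr hb] at hlie
    have hd1 : ∀ w v : List (HElt 𝒜), sum3 w (fun p s t => (-1 : k) ^ wdeg p *
          B (p ++ M.m.elt 1 M.degree_one s :: t) v) =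
        blockSum w (fun c => ψ (MB.m.ap (vals (c.map (f.arc hf)))) (f.arc hf v).2) := by
      intro w v
      have h := congrArg (ψ.flip (f.ap (vals v))) (hrel w)
      rw [map_blockSum, derComp, map_sum3] at h
      simp only [vals_map_arc]
      refine Eq.trans (sum3_congr _ _ _ fun p s t _ => ?_) h.symm
      simp only [B, map_smul, vals_append, vals_cons, smul_eq_mul]
      rfl
    have hd2 : ∀ u w : List (HElt 𝒜), sum3 w (fun p s t => (-1 : k) ^ wdeg p *
          B u (p ++ M.m.elt 1 M.degree_one s :: t)) =
        -((-1 : k) ^ (wdeg u * (wdeg w + 1)) *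
          blockSum w (fun c => ψ (MB.m.ap (vals (c.map (f.arc hf)))) (f.arc hf u).2)) := by
      intro u w
      rw [← hd1, ← sum3_mul]
      have hneg : ∀ F : List (HElt 𝒜) → List (HElt 𝒜) → List (HElt 𝒜) → k,
          -sum3 w F = sum3 w (fun p s t => -F p s t) := fun F =>
        map_sum3 (negAddMonoidHom : k →+ k) w F
      rw [hneg]
      refine sum3_congr _ _ _ fun p s t hw => ?_
      simp only [B]
      rw [pairing_ap_swap hf hψ]
      have : wdeg (p ++ M.m.elt 1 M.degree_one s :: t) = wdeg w + 1 := by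
        rw [← hw]
        simp only [wdeg_append, wdeg_cons, MultiFamily.elt]
        ring
      rw [this]
      ring
    simp only [hd1, hd2, blockSum_append_cons, ← blockSum_mul, ← sum2_mul, ← sum2_neg] at hlie
    have hnegb : ∀ (l : List (HElt 𝒜)) (G : List (List (HElt 𝒜)) → k),
        -blockSum l G = blockSum l (fun c => -G c) := fun l G =>
      map_blockSum (negAddMonoidHom : k →+ k) l G
    simp only [← blockSum_mul, ← sum2_mul, ← sum2_neg, hnegb] at hlie
    have s1 := cut_blocks_first a b (fun a1 U s s' V b2 P Q =>
      (-1 : k) ^ (wdeg a1 * (wdeg U + wdeg s + x.1 + wdeg s' + wdeg V + wdeg b2 + y.1)) *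
        ψ (MB.m.ap (vals (P.map (f.arc hf) ++ f.arc hf (s ++ x :: s') :: Q.map (f.arc hf))))
          (f.arc hf (b2 ++ y :: a1)).2)
    have s2 := cut_blocks_second a b (fun a1 U s s' V b2 P Q =>
      -((-1 : k) ^ (wdeg a1 * (wdeg U + wdeg s + x.1 + wdeg s' + wdeg V + wdeg b2 + y.1)) *
        ((-1 : k) ^ ((wdeg U + wdeg (s ++ x :: s')) * (wdeg V + wdeg (b2 ++ y :: a1))) *
        ψ (MB.m.ap (vals (Q.map (f.arc hf) ++ f.arc hf (b2 ++ y :: a1) :: P.map (f.arc hf))))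
          (f.arc hf (s ++ x :: s')).2)))
    have s3 : ∀ {X Y Z W : k}, 0 = X + Y → X = Z → Y = W → Z + W = 0 := by
      rintro _ _ _ _ h rfl rfl
      exact h.symm
    have s4 := s3 hlie (Eq.trans (sum2_congr _ _ _ fun a1 a2 _ => sum2_congr _ _ _ fun b1 b2 _ =>
        sum2_congr _ _ _ fun U s ha => blockSum_congr _ _ _ fun P _ _ =>
        sum2_congr _ _ _ fun s' V hb => blockSum_congr _ _ _ fun Q _ _ => by
          subst ha hb
          simp only [List.map_append, List.map_cons]
          congr 1
          refine sgn_eq ?_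
          simp only [wdeg_append]; push_cast; ring) s1)
      (Eq.trans (sum2_congr _ _ _ fun p s _ => sum2_congr _ _ _ fun s' t _ =>
        sum2_congr _ _ _ fun V b2 ht => blockSum_congr _ _ _ fun Q _ _ =>
        sum2_congr _ _ _ fun a1 U hp => blockSum_congr _ _ _ fun P _ _ => by
          subst ht hp
          simp only [List.map_append, List.map_cons, mul_neg]
          congr 1
          rw [← mul_assoc, ← mul_assoc, sgn_mul, sgn_mul]
          congr 1
          refine sgn_eq ?_
          simp only [wdeg_append, wdeg_cons]; push_cast; grind) s2)
    rw [← sum3_add] at s4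
    rw [← s4]
    refine sum3_congr _ _ _ fun a1 U s _ => ?_
    rw [← sum3_add]
    refine sum3_congr _ _ _ fun s' V b2 _ => ?_
    rw [← blockSum_add]
    refine blockSum_congr _ _ _ fun P hP _ => ?_
    rw [← blockSum_add]
    refine blockSum_congr _ _ _ fun Q hQ _ => ?_
    simp only [C, wdeg_map_arc, hP, hQ]
    change _ * (_ - (-1 : k) ^ ((wdeg U + wdeg (s ++ x :: s')) *
      (wdeg V + wdeg (b2 ++ y :: a1))) * _) = _
    ring
  -- In the vanishing sum the term with `x` and `y` alone in their blocks and all other blocks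
  -- single letters is the defect itself. Every other term is a defect with fewer letters.
  have hC : ∀ (n : ℕ) a x b y, a.length + b.length = n → C a x b y = 0 := by
    intro n
    induction n using Nat.strong_induction_on with
    | _ n ih =>
      intro a x b y hn
      have h := hsum a x b y
      rw [sum3_eq_mid, sum3_eq_mid] at h
      · have hz1 : ∀ c : List (List (HElt 𝒜)), c.length < a.length → ∀ d : k,
            blockSum b (fun Q => d * C (c.map (f.arc hf)) (f.arc hf ([] ++ [x]))
              (Q.map (f.arc hf)) (f.arc hf ([] ++ [y]))) = 0 := fun c hc d => by
          refine blockSum_eq_zero _ _ fun Q hQ h0 => ?_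
          have := length_le_of_flatten_eq hQ h0
          rw [ih _ _ _ _ _ _ rfl, mul_zero]
          simp only [List.length_map]
          omega
        have hz2 : ∀ c : List (List (HElt 𝒜)), c.length < b.length → ∀ d : k,
            d * C ((a.map fun a => [a]).map (f.arc hf)) (f.arc hf ([] ++ [x]))
              (c.map (f.arc hf)) (f.arc hf ([] ++ [y])) = 0 := fun c hc d => by
          rw [ih _ _ _ _ _ _ rfl, mul_zero]
          simp only [List.length_map]
          omega
        have hz : ∀ (l : List (HElt 𝒜)) (F : List (List (HElt 𝒜)) → k),
            (∀ c : List (List (HElt 𝒜)), c.length < l.length → F c = 0) →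
              blockSum l F = F (l.map fun a => [a]) := fun l F hF => by
          rw [blockSum_eq_add, blockSum_eq_zero l, add_zero]
          intro c _ _
          split_ifs with hc
          · exact hF c hc
          · rfl
        rw [hz a _ fun c hc => hz1 c hc _, hz b _ fun c hc => hz2 c hc _] at h
        have hid : ∀ l : List (HElt 𝒜), ((l.map fun a => [a]).map (f.arc hf)) = l := fun l => by
          rw [List.map_map]
          conv_rhs => rw [← List.map_id l]
          exact List.map_congr_left fun a _ => arc_singleton hf h1 a
        simpa only [hid, List.nil_append, arc_singleton hf h1, wdeg_nil, zero_mul, zpow_zero,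
          one_mul] using h
      · intro p s t hl hne
        refine blockSum_eq_zero _ _ fun P hP hP0 => blockSum_eq_zero _ _ fun Q hQ hQ0 => ?_
        have := length_le_of_flatten_eq hP hP0
        have := length_le_of_flatten_eq hQ hQ0
        have hl' := congrArg List.length hl
        simp only [List.length_append] at hl'
        have hpos : 0 < p.length + t.length := by
          rcases hne with h | h
          · have := List.length_pos_iff.mpr h; omega
          · have := List.length_pos_iff.mpr h; omega
        rw [ih _ _ _ _ _ _ rfl, mul_zero]
        simp only [List.length_map]
        omega
      · intro p s t hl hne
        refine sum3_eq_zero _ _ fun s' V b2 hb => ?_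
        refine blockSum_eq_zero _ _ fun P hP hP0 => blockSum_eq_zero _ _ fun Q hQ hQ0 => ?_
        have := length_le_of_flatten_eq hP hP0
        have := length_le_of_flatten_eq hQ hQ0
        have hl' := congrArg List.length hl
        have hb' := congrArg List.length hb
        simp only [List.length_append] at hl' hb'
        have hpos : 0 < p.length + t.length := by
          rcases hne with h | h
          · have := List.length_pos_iff.mpr h; omega
          · have := List.length_pos_iff.mpr h; omega
        rw [ih _ _ _ _ _ _ rfl, mul_zero]
        simp only [List.length_map]
        omega
  exact sub_eq_zero.mp (hC _ a x b y rfl)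

end Transport

end AInfinity

namespace AInfinity

/-! ### Strong homotopy inner products and closed non-degenerate bimodule maps -/

section StrongHomotopy

variable {k : Type v} [Field k] {A : Type u} [AddCommGroup A] [Module k A]
  {𝒜 : ℤ → Submodule k A} {ι : Type w} (e : Module.Basis ι k A) {deg : ι → ℤ} {D : ℤ}

theorem AInfAlgebra.ap_nil (M : AInfAlgebra 𝒜) : M.m.ap [] = 0 :=
  MultiFamily.ap_nil _ M.strict

/-- The transported structure has the same differential. -/
theorem ap_singleton_of_transport (hdeg : ∀ i, e i ∈ 𝒜 (deg i)) {f : MultiFamily k A A}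
    {M MB : AInfAlgebra 𝒜} (h1 : ∀ a, f.ap [a] = a)
    (hrel : ∀ x : List (HElt 𝒜),
      blockSum x (fun c => MB.m.ap (c.map fun s => f.ap (vals s))) = derComp M.m f x) (a : A) :
    MB.m.ap [a] = M.m.ap [a] := by
  have h : MB.m.slot [] [] = M.m.slot [] [] := by
    refine e.ext fun i => ?_
    have := hrel [basisElt e hdeg i]
    have z1 := (f.slot [] [e i]).map_zero
    have z2 := (f.slot [e i] []).map_zero
    simp only [MultiFamily.slot_apply, List.nil_append, List.cons_append] at z1 z2 ⊢
    simpa [blockSum_cons, sum2, blockSum, derComp, sum3, vals_nil, vals_cons, h1, M.ap_nil,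
      basisElt, wdeg_nil, z1, z2] using this
  exact LinearMap.congr_fun h a

theorem PreBimoduleMap.IsStrongHomotopyInnerProduct.isSkew {M : AInfAlgebra 𝒜}
    {Φ : PreBimoduleMap 𝒜 D} (h : Φ.IsStrongHomotopyInnerProduct M) : Φ.IsSkew := by
  obtain ⟨-, B, _, _, ℬ, _, MB, ψ, F, -, hev⟩ := h
  have hΦ : Φ.ev = pullback 𝒜 F.f ψ.pairing := by
    funext a x b y
    exact hev a x b y
  change TwoMarked.IsSkew Φ.ev
  rw [hΦ]
  exact pullback_isSkew F.degree_zero ψ.skew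

theorem PreBimoduleMap.IsStrongHomotopyInnerProduct.isClosed {M : AInfAlgebra 𝒜}
    {Φ : PreBimoduleMap 𝒜 D} (h : Φ.IsStrongHomotopyInnerProduct M) : Φ.IsClosed := by
  obtain ⟨-, B, _, _, ℬ, _, MB, ψ, F, -, hev⟩ := h
  have hΦ : Φ.ev = pullback 𝒜 F.f ψ.pairing := by
    funext a x b y
    exact hev a x b y
  rw [Φ.isClosed_iff, hΦ]
  exact pullback_isClosed F.degree_zero ψ.skew

/-- The cyclic algebra `B` is `A` itself with the transported operations and the pairing `φ_{0,0}`.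
The Darboux coordinate change is a quasi-isomorphism because `f₁ = id` and the two differentials
agree. -/
theorem PreBimoduleMap.IsBimoduleMap.isStrongHomotopyInnerProduct [Fintype ι] [CharZero k]
    (h𝒜 : DirectSum.IsInternal 𝒜) (hdeg : ∀ i, e i ∈ 𝒜 (deg i)) {M : AInfAlgebra 𝒜}
    {Φ : PreBimoduleMap 𝒜 D} (hΦ : Φ.IsBimoduleMap M) (hs : Φ.IsSkew) (hc : Φ.IsClosed)
    (hnd : Φ.IsNondegenerate) : Φ.IsStrongHomotopyInnerProduct M := by
  obtain ⟨f, h0, h1, hf, hev⟩ := exists_darboux e h𝒜 hdeg Φ hs hc hnd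
  obtain ⟨MB, hrel⟩ := exists_transport e h𝒜 hdeg M h1 hf
  have hm := ap_singleton_of_transport e hdeg h1 hrel
  have hm0 : MB.m.ap [(0 : A)] = 0 := by
    simpa only [MultiFamily.slot_apply, List.nil_append] using (MB.m.slot [] []).map_zero
  refine ⟨hΦ, A, inferInstance, inferInstance, 𝒜, h𝒜, MB, ⟨Φ.pairing, Φ.pairing_degree,
    hs.pairing_skew, hnd.pairing_nondegenerate, fun x t z => ?_⟩,
    ⟨f, h0, hf, fun x => ?_⟩, ⟨?_, ?_⟩, hev⟩
  · simpa [vals_append, vals_cons, vals_nil, wdeg_nil] using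
      pairing_cyclic_of_transport h1 hf hrel hs.pairing_skew Φ hΦ hev [] x t z
  · rw [sum_splitWrtComposition x
      (fun c => MB.m.ap (c.map fun s => f.ap (vals s))), hrel, derComp]
  · rintro a - ⟨b, hb⟩
    exact ⟨b, by rw [← hm, ← hb]; exact (h1 a).symm⟩
  · refine fun b hb => ⟨b, by rw [← hm, hb], 0, ?_⟩
    rw [hm0, add_zero]
    exact (h1 b).symm

end StrongHomotopy

end AInfinity

namespace AInfinity

/-! ### Reduction of families to their coefficients in a homogeneous basis -/

section Extension

variable {k : Type v} [Field k] {A : Type u} [AddCommGroup A] [Module k A]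
  {𝒜 : ℤ → Submodule k A} {ι : Type w} (e : Module.Basis ι k A) {deg : ι → ℤ}
  (hdeg : ∀ i, e i ∈ 𝒜 (deg i))

namespace TwoMarked

/-- Linearity in each argument. -/
structure IsMultilinear (T : TwoMarked 𝒜) : Prop where
  left : ∀ x b y, WLin (fun a => T a x b y)
  mid : ∀ a b y, HLin (fun x => T a x b y)
  right : ∀ a x y, WLin (fun b => T a x b y)
  last : ∀ a x b, HLin (fun y => T a x b y)

theorem IsMultilinear.ext_basis (h𝒜 : DirectSum.IsInternal 𝒜) {T T' : TwoMarked 𝒜}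
    (hT : T.IsMultilinear) (hT' : T'.IsMultilinear)
    (h : ∀ (I : List ι) (i : ι) (J : List ι) (j : ι), T (I.map (basisElt e hdeg))
        (basisElt e hdeg i) (J.map (basisElt e hdeg))
      (basisElt e hdeg j) = T' (I.map (basisElt e hdeg)) (basisElt e hdeg i)
      (J.map (basisElt e hdeg)) (basisElt e hdeg j)) : T = T' := by
  funext a x b y
  refine HLin.ext_basis e hdeg h𝒜 (hT.last a x b) (hT'.last a x b) (fun j => ?_) y
  refine WLin.ext_basis e hdeg h𝒜 (hT.right a x _) (hT'.right a x _) (fun J => ?_) b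
  refine HLin.ext_basis e hdeg h𝒜 (hT.mid a _ _) (hT'.mid a _ _) (fun i => ?_) x
  exact WLin.ext_basis e hdeg h𝒜 (hT.left _ _ _) (hT'.left _ _ _) (fun I => h I i J j) a

/-- Multiplication by a scalar that depends on the degrees of the arguments. -/
theorem IsMultilinear.mul_deg {T : TwoMarked 𝒜} (hT : T.IsMultilinear)
    (c : ℤ → ℤ → ℤ → ℤ → k) :
    IsMultilinear (fun a x b y => c (wdeg a) x.1 (wdeg b) y.1 * T a x b y) where
  left x b y := (hT.left x b y).mul_deg fun d => c d x.1 (wdeg b) y.1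
  mid a b y := (hT.mid a b y).mul_deg fun d => c (wdeg a) d (wdeg b) y.1
  right a x y := (hT.right a x y).mul_deg fun d => c (wdeg a) x.1 d y.1
  last a x b := (hT.last a x b).mul_deg fun d => c (wdeg a) x.1 (wdeg b) d

/-- The exchange of the marked elements. -/
theorem IsMultilinear.swap {T : TwoMarked 𝒜} (hT : T.IsMultilinear) :
    IsMultilinear (fun a x b y => T b y a x) where
  left x b y := hT.right b y x
  mid a b y := hT.last b y a
  right a x y := hT.left y a x
  last a x b := hT.mid b a x

end TwoMarked

theorem BiFamily.isMultilinear (φ : BiFamily k A) : TwoMarked.IsMultilinear (𝒜 := 𝒜)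
    (fun a x b y => φ.ap (vals a) x.2 (vals b) y.2) where
  left x b y := WLin.ap_vals (φ.left x.2 (vals b) y.2)
  mid a b y := HLin.of_linear (φ.mid (vals a) (vals b) y.2)
  right a x y := WLin.ap_vals (φ.right (vals a) x.2 y.2)
  last a x b := HLin.of_linear (φ.last (vals a) x.2 (vals b))

theorem PreBimoduleMap.ev_isMultilinear {D : ℤ} (Φ : PreBimoduleMap 𝒜 D) :
    TwoMarked.IsMultilinear Φ.ev := Φ.φ.isMultilinear

theorem PreBimoduleMap.ev_basisElt {D : ℤ} (Φ : PreBimoduleMap 𝒜 D) (I : List ι) (i : ι)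
    (J : List ι) (j : ι) :
    Φ.ev (I.map (basisElt e hdeg)) (basisElt e hdeg i) (J.map (basisElt e hdeg))
      (basisElt e hdeg j) = Φ.coeff e I i J j := by
  rw [PreBimoduleMap.ev, vals_map_basisElt, vals_map_basisElt]
  rfl

theorem PreBimoduleMap.isSkew_iff {D : ℤ} (hdeg : ∀ i, e i ∈ 𝒜 (deg i))
    (h𝒜 : DirectSum.IsInternal 𝒜) (Φ : PreBimoduleMap 𝒜 D) : Φ.IsSkew ↔ (Φ.coeff e).IsSkew deg := by
  constructor
  · intro h I i J j
    have := h (I.map (basisElt e hdeg)) (basisElt e hdeg i) (J.map (basisElt e hdeg))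
      (basisElt e hdeg j)
    rwa [Φ.ev_basisElt, Φ.ev_basisElt, wdeg_map_basisElt, wdeg_map_basisElt] at this
  · intro h
    have := TwoMarked.IsMultilinear.ext_basis e hdeg h𝒜 Φ.ev_isMultilinear
      (Φ.ev_isMultilinear.swap.mul_deg fun a x b y => -(-1 : k) ^ ((a + x) * (b + y)))
      (fun I i J j => by
        rw [Φ.ev_basisElt, Φ.ev_basisElt, wdeg_map_basisElt, wdeg_map_basisElt, h I i J j,
          neg_mul]
        rfl)
    intro a x b y
    rw [← neg_mul]
    exact congrFun (congrFun (congrFun (congrFun this a) x) b) y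

theorem PreBimoduleMap.ext_coeff {D : ℤ} {Φ Ψ : PreBimoduleMap 𝒜 D}
    (h : Φ.coeff e = Ψ.coeff e) : Φ = Ψ := by
  have : Φ.φ = Ψ.φ := by
    funext p q
    refine Module.Basis.ext_multilinear (fun _ => e) fun I => ?_
    refine e.ext fun i => Module.Basis.ext_multilinear (fun _ => e) fun J => e.ext fun j => ?_
    have := congrFun (congrFun (congrFun (congrFun h (List.ofFn I)) i) (List.ofFn J)) j
    simp only [PreBimoduleMap.coeff, List.map_ofFn, BiFamily.ap_ofFn] at this
    exact this
  cases Φ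
  cases Ψ
  cases this
  rfl

/-- The degree condition says that the family is unchanged by multiplication with the indicator of
total degree `-D`. This is an equality of functions linear in each argument, so the coefficients
decide it. -/
theorem biFamilyOfCoeff_degree (hdeg : ∀ i, e i ∈ 𝒜 (deg i))
    (h𝒜 : DirectSum.IsInternal 𝒜) [Fintype ι] {D : ℤ}
    (C : TwoFormCoeff ι k)
    (hC : ∀ I i J j, C I i J j ≠ 0 → (I.map deg).sum + deg i + (J.map deg).sum + deg j + D = 0)
    (a : List (HElt 𝒜)) (x : HElt 𝒜) (b : List (HElt 𝒜)) (y : HElt 𝒜)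
    (h : (biFamilyOfCoeff e C).ap (vals a) x.2 (vals b) y.2 ≠ 0) :
    wdeg a + x.1 + wdeg b + y.1 + D = 0 := by
  let φ := biFamilyOfCoeff e C
  have hT := φ.isMultilinear (𝒜 := 𝒜)
  have h0 := TwoMarked.IsMultilinear.ext_basis e hdeg h𝒜 hT
    (hT.mul_deg fun a x b y => if a + x + b + y + D = 0 then 1 else 0) (fun I i J j => by
      simp only [vals_map_basisElt, wdeg_map_basisElt]
      change φ.ap (I.map e) (e i) (J.map e) (e j) =
        (if (I.map deg).sum + deg i + (J.map deg).sum + deg j + D = 0 then 1 else 0) *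
          φ.ap (I.map e) (e i) (J.map e) (e j)
      rw [biFamilyOfCoeff_ap]
      split_ifs with hd
      · rw [one_mul]
      · rw [zero_mul]
        by_contra hne
        exact hd (hC _ _ _ _ hne))
  have h1 := congrFun (congrFun (congrFun (congrFun h0 a) x) b) y
  by_contra hne
  simp only [if_neg hne, zero_mul] at h1
  exact h h1

end Extension

end AInfinity

namespace AInfinity

/-! ## Cyclic forms and signed cyclic rotation -/

section Rotation

variable {ι : Type w} {k : Type v} [Field k] {deg : ι → ℤ}

theorem exSign_nil_left (p : List (Letter ι)) : exSign k deg [] p = 1 := by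
  simp [exSign, ideg, fdeg]

theorem exSign_nil_right (p : List (Letter ι)) : exSign k deg p [] = 1 := by
  simp [exSign, ideg, fdeg]

theorem exSign_cons_left (a : Letter ι) (u v : List (Letter ι)) :
    exSign k deg (a :: u) v = exSign k deg [a] (u ++ v) * exSign k deg u (v ++ [a]) := by
  rw [exSign, exSign, exSign, sgn_mul]
  refine sgn_congr ⟨-(a.ideg deg * ideg deg u + a.fdeg * fdeg u), ?_⟩
  simp only [ideg_append, ideg_cons, fdeg_append, fdeg_cons]
  simp only [ideg, fdeg, List.map_nil, List.sum_nil]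
  ring

/-- Rotating letter by letter accumulates precisely the sign of exchanging the two subwords. In
particular a full turn has sign one, so the cyclic group acts on the words of given length. -/
theorem rot_iterate_append (c : Series ι k) (u v : List (Letter ι)) :
    (rot k deg)^[u.length] c (u ++ v) = exSign k deg u v * c (v ++ u) := by
  induction u generalizing v with
  | nil => simp [exSign_nil_left]
  | cons a u ih =>
    rw [List.length_cons, Function.iterate_succ_apply', List.cons_append, rot_cons,
      List.append_assoc, ih, ← mul_assoc, exSign_cons_left a u v]
    simp

theorem rot_iterate_length (c : Series ι k) (l : List (Letter ι)) :
    (rot k deg)^[l.length] c l = c l := by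
  simpa [exSign_nil_right] using rot_iterate_append (deg := deg) c l []

theorem rot_iterate_snoc (c : Series ι k) (r : ℕ) (a : Letter ι) (p : List (Letter ι)) :
    (rot k deg)^[r + 1] c (a :: p) = exSign k deg [a] p * (rot k deg)^[r] c (p ++ [a]) := by
  rw [Function.iterate_succ_apply', rot_cons]

variable (k deg) in
/-- The sum of all cyclic rotations. -/
def rotNorm : Series ι k →ₗ[k] Series ι k where
  toFun c l := ∑ r ∈ Finset.range l.length, ((rot k deg) ^ r) c l
  map_add' c c' := by
    funext l
    simp [Finset.sum_add_distrib]
  map_smul' r c := by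
    funext l
    simp [Finset.mul_sum]

theorem rotNorm_apply (c : Series ι k) (l : List (Letter ι)) :
    rotNorm k deg c l = ∑ r ∈ Finset.range l.length, (rot k deg)^[r] c l := by
  change ∑ r ∈ Finset.range l.length, ((rot k deg) ^ r) c l = _
  simp only [Module.End.pow_apply]

theorem rotNorm_rot (c : Series ι k) : rotNorm k deg (rot k deg c) = rotNorm k deg c := by
  funext l
  simp only [rotNorm_apply, ← Function.iterate_succ_apply]
  have h := Finset.sum_range_succ (fun r => (rot k deg)^[r] c l) l.length
  rw [Finset.sum_range_succ', rot_iterate_length] at h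
  exact add_right_cancel h

theorem rot_rotNorm (c : Series ι k) : rot k deg (rotNorm k deg c) = rotNorm k deg c := by
  conv_rhs => rw [← rotNorm_rot]
  funext l
  cases l with
  | nil => rfl
  | cons a p =>
    rw [rot_cons, rotNorm_apply, rotNorm_apply, Finset.mul_sum, List.length_append,
      List.length_cons]
    refine Finset.sum_congr rfl fun r _ => ?_
    rw [← rot_iterate_snoc, Function.iterate_succ_apply]

theorem rotNorm_append (c : Series ι k) (u v : List (Letter ι)) :
    rotNorm k deg c (u ++ v) = exSign k deg u v * rotNorm k deg c (v ++ u) := by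
  rw [← rot_iterate_append, Function.iterate_fixed (rot_rotNorm c)]

/-- The cuts with an empty first part and with an empty second part both give the trivial rotation,
so the sum over all cuts counts it twice. -/
theorem rotNorm_add_self (c : Series ι k) (l : List (Letter ι)) :
    rotNorm k deg c l + c l = sum2 l (fun u v => exSign k deg u v * c (v ++ u)) := by
  rw [sum2_eq_sum_range, rotNorm_apply]
  conv_lhs => rw [← rot_iterate_length (deg := deg) c l]
  rw [← Finset.sum_range_succ (fun r => (rot k deg)^[r] c l)]
  refine Finset.sum_congr rfl fun r hr => ?_
  have h := rot_iterate_append (deg := deg) c (l.take r) (l.drop r)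
  rwa [List.take_append_drop, List.length_take,
    min_eq_left (Nat.lt_succ_iff.mp (Finset.mem_range.mp hr))] at h

/-- For a finite cyclic group acting in characteristic zero, the kernel of the norm is the image of
`1 - rot`. The empty word is kept apart: rotation fixes it, and its norm is an empty sum. -/
theorem mem_commutators_iff [CharZero k] (c : Series ι k) :
    c ∈ commutators k deg ↔ rotNorm k deg c = 0 ∧ c [] = 0 := by
  constructor
  · rintro ⟨b, rfl⟩
    refine ⟨?_, ?_⟩
    · simp [rotNorm_rot]
    · change b [] - b [] = 0
      rw [sub_self]
  · rintro ⟨h, h0⟩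
    -- The explicit preimage is `-(1/n) ∑ r • rot^r c` on words of length `n`: applying `1 - rot`
    -- telescopes to `c` minus `1/n` times the norm of `c`.
    refine ⟨fun l => -(l.length : k)⁻¹ *
      ∑ r ∈ Finset.range l.length, (r : k) * (rot k deg)^[r] c l, ?_⟩
    funext l
    cases l with
    | nil => simp [rot, h0]
    | cons a p =>
      have hn : ((p.length + 1 : ℕ) : k) ≠ 0 := Nat.cast_ne_zero.mpr (Nat.succ_ne_zero _)
      have hl := congrFun h (a :: p)
      rw [rotNorm_apply] at hl
      have e1 := Finset.sum_range_succ (fun r => (r : k) * (rot k deg)^[r] c (a :: p))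
        (p.length + 1)
      rw [Finset.sum_range_succ'] at e1
      have e2 : (rot k deg)^[p.length + 1] c (a :: p) = c (a :: p) :=
        rot_iterate_length (deg := deg) c (a :: p)
      have e3 := Finset.sum_range_succ (fun r => (rot k deg)^[r] c (a :: p)) (p.length + 1)
      rw [Finset.sum_range_succ', e2] at e3
      simp only [LinearMap.sub_apply, LinearMap.id_apply, Pi.sub_apply, rot_cons,
        List.length_append, List.length_cons, List.length_nil, zero_add]
      rw [mul_left_comm, ← mul_sub, neg_mul, neg_eq_iff_eq_neg, inv_mul_eq_iff_eq_mul₀ hn,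
        Finset.mul_sum]
      simp only [mul_left_comm (exSign k deg [a] p), ← rot_iterate_snoc]
      simp only [List.length_cons, Pi.zero_apply] at hl
      rw [hl] at e3
      simp only [Nat.cast_add, Nat.cast_one, add_mul, one_mul, Finset.sum_add_distrib,
        Nat.cast_zero, zero_mul, add_zero, e2, Function.iterate_zero, id_eq] at e1 e3 ⊢
      linear_combination -e1 + e3

theorem cyc_eq_zero_iff [CharZero k] (c : Series ι k) :
    cyc k deg c = 0 ↔ rotNorm k deg c = 0 ∧ c [] = 0 := by
  rw [← mem_commutators_iff]
  exact Submodule.Quotient.mk_eq_zero _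

end Rotation

end AInfinity

namespace AInfinity

/-! ### Two-forms and skew coefficients -/

section TwoForms

variable {ι : Type w} {k : Type v} [Field k] {deg : ι → ℤ}

/-- The word `x^I`. -/
def xWord (I : List ι) : List (Letter ι) := I.map Letter.x

theorem xWord_append (I J : List ι) : xWord (I ++ J) = xWord I ++ xWord J := List.map_append ..

theorem xWord_cons (i : ι) (I : List ι) : xWord (i :: I) = .x i :: xWord I := rfl

theorem ideg_xWord (I : List ι) : ideg deg (xWord I) = -(I.map deg).sum := by
  induction I with
  | nil => rfl
  | cons i I ih => rw [xWord_cons, ideg_cons, ih, List.map_cons, List.sum_cons, Letter.ideg]; ring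

theorem fdeg_xWord (I : List ι) : fdeg (xWord I) = 0 := by
  induction I with
  | nil => rfl
  | cons i I ih => rw [xWord_cons, fdeg_cons, ih, Letter.fdeg, add_zero]

theorem ideg_nil : ideg deg [] = 0 := rfl

theorem fdeg_nil : fdeg ([] : List (Letter ι)) = 0 := rfl

theorem fdeg_nonneg (l : List (Letter ι)) : 0 ≤ fdeg l := by
  induction l with
  | nil => rfl
  | cons y l ih =>
    rw [fdeg_cons]
    cases y <;> simp only [Letter.fdeg] <;> omega

theorem eq_xWord_or (l : List (Letter ι)) :
    (∃ I, l = xWord I) ∨ ∃ I i r, l = xWord I ++ .dx i :: r := by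
  induction l with
  | nil => exact Or.inl ⟨[], rfl⟩
  | cons y l ih =>
    cases y with
    | dx i => exact Or.inr ⟨[], i, l, rfl⟩
    | x i =>
      rcases ih with ⟨I, rfl⟩ | ⟨I, j, r, rfl⟩
      · exact Or.inl ⟨i :: I, rfl⟩
      · exact Or.inr ⟨i :: I, j, r, rfl⟩

theorem eq_xWord_of_fdeg_zero {l : List (Letter ι)} (h : fdeg l = 0) : ∃ I, l = xWord I := by
  rcases eq_xWord_or l with hl | ⟨I, i, r, rfl⟩
  · exact hl
  · have := fdeg_nonneg r
    simp only [fdeg_append, fdeg_cons, fdeg_xWord, Letter.fdeg] at h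
    omega

theorem eq_of_fdeg_pos {l : List (Letter ι)} {n : ℤ} (hn : 0 < n) (h : fdeg l = n) :
    ∃ I i r, l = xWord I ++ .dx i :: r ∧ fdeg r = n - 1 := by
  rcases eq_xWord_or l with ⟨I, rfl⟩ | ⟨I, i, r, rfl⟩
  · rw [fdeg_xWord] at h
    omega
  · refine ⟨I, i, r, rfl, ?_⟩
    simp only [fdeg_append, fdeg_cons, fdeg_xWord, Letter.fdeg] at h
    omega

/-- The word `x^I dx_i x^J dx_j`. -/
def twoFormWord (I : List ι) (i : ι) (J : List ι) (j : ι) : List (Letter ι) :=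
  xWord I ++ .dx i :: (xWord J ++ [.dx j])

theorem fdeg_twoFormWord (I : List ι) (i : ι) (J : List ι) (j : ι) :
    fdeg (twoFormWord I i J j) = 2 := by
  simp [twoFormWord, fdeg_append, fdeg_cons, fdeg_xWord, Letter.fdeg, fdeg_nil]

theorem ideg_twoFormWord (I : List ι) (i : ι) (J : List ι) (j : ι) :
    ideg deg (twoFormWord I i J j) =
      -((I.map deg).sum + deg i + (J.map deg).sum + deg j) := by
  simp only [twoFormWord, ideg_append, ideg_cons, ideg_xWord, Letter.ideg, ideg_nil]
  ring

/-- Moving the trailing `x^K` to the front turns any word with two differentials into a normal word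
`x^I dx_i x^J dx_j`. -/
theorem exists_rotation_twoFormWord {l : List (Letter ι)} (h : fdeg l = 2) :
    ∃ I i J j K, l = (xWord I ++ .dx i :: (xWord J ++ [.dx j])) ++ xWord K := by
  obtain ⟨I, i, r, rfl, hr⟩ := eq_of_fdeg_pos (by norm_num) h
  obtain ⟨J, j, s, rfl, hs⟩ := eq_of_fdeg_pos (by norm_num) hr
  obtain ⟨K, rfl⟩ := eq_xWord_of_fdeg_zero (by rw [hs]; norm_num)
  exact ⟨I, i, J, j, K, by simp⟩

theorem splitAtD_xWord (I : List ι) : splitAtD (xWord I) = none := by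
  induction I with
  | nil => rfl
  | cons i I ih => rw [xWord_cons, splitAtD, ih]; rfl

theorem splitAtD_append_cons (I : List ι) (i : ι) (r : List (Letter ι)) :
    splitAtD (xWord I ++ .dx i :: r) = some (I, i, r) := by
  induction I with
  | nil => rfl
  | cons j I ih => rw [xWord_cons, List.cons_append, splitAtD, ih]; rfl

namespace TwoFormCoeff

theorem series_twoFormWord (C : TwoFormCoeff ι k) (I : List ι) (i : ι) (J : List ι) (j : ι) :
    C.series (twoFormWord I i J j) = C I i J j := by
  rw [series, twoFormWord, splitAtD_append_cons]
  simp only [splitAtD_append_cons]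

theorem eq_twoFormWord_of_series_ne_zero (C : TwoFormCoeff ι k) {l : List (Letter ι)}
    (h : C.series l ≠ 0) : ∃ I i J j, l = twoFormWord I i J j := by
  rcases eq_xWord_or l with ⟨I, rfl⟩ | ⟨I, i, r, rfl⟩
  · exact absurd (by rw [series, splitAtD_xWord]) h
  rcases eq_xWord_or r with ⟨J, rfl⟩ | ⟨J, j, s, rfl⟩
  · refine absurd ?_ h
    rw [series, splitAtD_append_cons]
    simp only [splitAtD_xWord]
  cases s with
  | nil => exact ⟨I, i, J, j, rfl⟩
  | cons y s =>
    refine absurd ?_ h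
    rw [series, splitAtD_append_cons]
    simp only [splitAtD_append_cons]

theorem series_append_x (C : TwoFormCoeff ι k) (l : List (Letter ι)) (i : ι) :
    C.series (l ++ [.x i]) = 0 := by
  by_contra h
  obtain ⟨I, i, J, j, h⟩ := C.eq_twoFormWord_of_series_ne_zero h
  have := congrArg List.getLast? h
  simp [twoFormWord, List.getLast?_append, List.getLast?_cons] at this

theorem series_append_xWord (C : TwoFormCoeff ι k) (l : List (Letter ι)) {I : List ι}
    (hI : I ≠ []) : C.series (l ++ xWord I) = 0 := by
  obtain ⟨J, i, rfl⟩ := List.eq_nil_or_concat'  I |>.resolve_left hI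
  rw [xWord_append, ← List.append_assoc]
  exact C.series_append_x _ i

theorem fdeg_of_series_ne_zero (C : TwoFormCoeff ι k) {l : List (Letter ι)}
    (h : C.series l ≠ 0) : fdeg l = 2 := by
  obtain ⟨I, i, J, j, rfl⟩ := C.eq_twoFormWord_of_series_ne_zero h
  exact fdeg_twoFormWord I i J j

variable (deg) in
theorem rotNorm_series (C : TwoFormCoeff ι k) (I : List ι) (i : ι) (J : List ι) (j : ι) :
    rotNorm k deg C.series (twoFormWord I i J j) = C I i J j -
      (-1 : k) ^ (((I.map deg).sum + deg i) * ((J.map deg).sum + deg j)) * C J j I i := by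
  -- The series is supported on words that end with a differential. Only two rotations of a normal
  -- word do: the word itself and the one exchanging `(I, i)` with `(J, j)`, whose form degrees
  -- contribute the minus sign.
  have h := rotNorm_add_self (deg := deg) C.series (twoFormWord I i J j)
  have hx : ∀ (I : List ι) (F : List (Letter ι) → List (Letter ι) → k),
      (∀ p t, p ++ t = xWord I → p ≠ [] → F p t = 0) → sum2 (xWord I) F = F [] (xWord I) :=
    fun I F => sum2_eq_first _ F
  have hz : ∀ (I : List ι) (p t : List (Letter ι)) (l : List (Letter ι)), p ++ t = xWord I →
      p ≠ [] → C.series (l ++ p) = 0 := fun I p t l hp hne => by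
    have h0 : fdeg p + fdeg t = 0 := by rw [← fdeg_append, hp, fdeg_xWord]
    have h1 := fdeg_nonneg p
    have h2 := fdeg_nonneg t
    obtain ⟨K, rfl⟩ := eq_xWord_of_fdeg_zero (l := p) (by omega)
    refine C.series_append_xWord l fun hK => hne ?_
    rw [hK]
    rfl
  conv_rhs at h => rw [twoFormWord]
  rw [sum2_append_cons, sum2_snoc, hx, hx] at h
  · simp only [List.nil_append, List.append_nil, exSign_nil_left, exSign_nil_right, one_mul] at h
    have e1 := C.series_twoFormWord I i J j
    have e2 := C.series_twoFormWord J j I i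
    simp only [twoFormWord] at e1 e2 h ⊢
    have e3 : exSign k deg (xWord I ++ [.dx i]) (xWord J ++ [.dx j]) =
        -(-1 : k) ^ (((I.map deg).sum + deg i) * ((J.map deg).sum + deg j)) := by
      refine (neg_sgn_eq ?_).symm
      simp only [ideg_append, ideg_cons, ideg_xWord, fdeg_append, fdeg_cons, fdeg_xWord,
        Letter.ideg, Letter.fdeg, ideg_nil, fdeg_nil]
      push_cast
      ring
    rw [e3, show (xWord J ++ [Letter.dx j]) ++ (xWord I ++ [Letter.dx i]) =
      xWord J ++ Letter.dx j :: (xWord I ++ [Letter.dx i]) by simp, e2, e1] at h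
    linear_combination h
  · intro p t hp hne
    rw [show (t ++ [Letter.dx j]) ++ (xWord I ++ Letter.dx i :: p) =
      ((t ++ [Letter.dx j]) ++ (xWord I ++ [Letter.dx i])) ++ p by simp, hz J p t _ hp hne,
      mul_zero]
  · intro p t hp hne
    rw [hz I p t _ hp hne, mul_zero]

theorem IsSkew.rotNorm_series {C : TwoFormCoeff ι k} (hC : C.IsSkew deg) (I : List ι) (i : ι)
    (J : List ι) (j : ι) : rotNorm k deg C.series (twoFormWord I i J j) = 2 * C I i J j := by
  rw [TwoFormCoeff.rotNorm_series]
  linear_combination -hC I i J j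

end TwoFormCoeff

/-- On series of two-forms, the sum of all rotations is determined by its values on the words
`x^I dx_i x^J dx_j`. -/
theorem rotNorm_eq_zero_of_twoForm {c : Series ι k} (hc : ∀ l, c l ≠ 0 → fdeg l = 2)
    (h : ∀ I i J j, rotNorm k deg c (twoFormWord I i J j) = 0) : rotNorm k deg c = 0 := by
  funext l
  by_cases hl : fdeg l = 2
  · obtain ⟨I, i, J, j, K, rfl⟩ := exists_rotation_twoFormWord hl
    rw [rotNorm_append]
    have := h (K ++ I) i J j
    rw [twoFormWord, xWord_append, List.append_assoc] at this
    rw [this, mul_zero]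
    rfl
  · have := rotNorm_add_self (deg := deg) c l
    rw [sum2_eq_zero] at this
    · have hcl : c l = 0 := by
        by_contra hne
        exact hl (hc l hne)
      rw [hcl, add_zero] at this
      exact this
    · intro u v huv
      have : c (v ++ u) = 0 := by
        by_contra hne
        refine hl ?_
        have := hc _ hne
        rw [fdeg_append] at this
        rw [← huv, fdeg_append]
        omega
      rw [this, mul_zero]

theorem cyc_eq_zero_of_twoForm [CharZero k] {c : Series ι k} (hc : ∀ l, c l ≠ 0 → fdeg l = 2)
    (h : ∀ I i J j, rotNorm k deg c (twoFormWord I i J j) = 0) : cyc k deg c = 0 := by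
  rw [cyc_eq_zero_iff]
  refine ⟨rotNorm_eq_zero_of_twoForm hc h, ?_⟩
  by_contra hne
  exact absurd (hc _ hne) (by simp [fdeg])

/-- The rotation sum recovers `2 C`, so skew coefficients can be read off from the class. -/
theorem TwoFormCoeff.IsSkew.form_eq_zero_iff [CharZero k] {C : TwoFormCoeff ι k}
    (hC : C.IsSkew deg) : C.form deg = 0 ↔ C = 0 := by
  constructor
  · intro h
    have h1 := ((cyc_eq_zero_iff _).mp h).1
    funext I i J j
    have h2 := congrFun h1 (twoFormWord I i J j)
    rw [hC.rotNorm_series] at h2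
    exact (mul_eq_zero.mp h2).resolve_left two_ne_zero
  · rintro rfl
    exact cyc_eq_zero_of_twoForm (fun l h => TwoFormCoeff.fdeg_of_series_ne_zero _ h)
      fun I i J j => by rw [hC.rotNorm_series]; exact mul_zero _

theorem TwoFormCoeff.series_sub (C C' : TwoFormCoeff ι k) :
    (C - C').series = C.series - C'.series := by
  funext l
  by_cases h : ∃ I i J j, l = twoFormWord I i J j
  · obtain ⟨I, i, J, j, rfl⟩ := h
    simp only [Pi.sub_apply, series_twoFormWord]
  · have h0 : ∀ C : TwoFormCoeff ι k, C.series l = 0 := fun C => by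
      by_contra hne
      exact h (C.eq_twoFormWord_of_series_ne_zero hne)
    simp [h0]

theorem TwoFormCoeff.IsSkew.form_injective [CharZero k] {C C' : TwoFormCoeff ι k}
    (hC : C.IsSkew deg) (hC' : C'.IsSkew deg) (h : C.form deg = C'.form deg) : C = C' := by
  have hs : (C - C').IsSkew deg := fun I i J j => by
    simp only [Pi.sub_apply]
    linear_combination hC I i J j - hC' I i J j
  rw [← sub_eq_zero, ← hs.form_eq_zero_iff, TwoFormCoeff.form, TwoFormCoeff.series_sub, cyc,
    map_sub]
  exact sub_eq_zero.mpr h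

theorem TwoFormCoeff.form_mem_formsOfDegree {C : TwoFormCoeff ι k} {D : ℤ}
    (hC : ∀ I i J j, C I i J j ≠ 0 → (I.map deg).sum + deg i + (J.map deg).sum + deg j + D = 0) :
    C.form deg ∈ formsOfDegree k deg 2 D := by
  refine Submodule.mem_map_of_mem fun l hl => ⟨C.fdeg_of_series_ne_zero hl, ?_⟩
  obtain ⟨I, i, J, j, rfl⟩ := C.eq_twoFormWord_of_series_ne_zero hl
  rw [C.series_twoFormWord] at hl
  rw [ideg_twoFormWord]
  have := hC _ _ _ _ hl
  omega

/-- The coefficients are half the rotation sum of any representative on normal words. Rotation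
invariance makes them skew, and the new series has the same rotation sum as the old one, hence the
same class. -/
theorem exists_skew_of_mem_formsOfDegree [CharZero k] {D : ℤ} {ω : CyclicForm k deg}
    (hω : ω ∈ formsOfDegree k deg 2 D) : ∃ C : TwoFormCoeff ι k, C.IsSkew deg ∧
      (∀ I i J j, C I i J j ≠ 0 →
        (I.map deg).sum + deg i + (J.map deg).sum + deg j + D = 0) ∧ C.form deg = ω := by
  obtain ⟨c, hc, rfl⟩ := hω
  have hc : ∀ l, c l ≠ 0 → fdeg l = 2 ∧ ideg deg l = D := hc
  let C : TwoFormCoeff ι k := fun I i J j => 2⁻¹ * rotNorm k deg c (twoFormWord I i J j)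
  have hs : C.IsSkew deg := fun I i J j => by
    have h := rotNorm_append (deg := deg) c (xWord I ++ [.dx i]) (xWord J ++ [.dx j])
    have e3 : exSign k deg (xWord I ++ [.dx i]) (xWord J ++ [.dx j]) =
        -(-1 : k) ^ (((I.map deg).sum + deg i) * ((J.map deg).sum + deg j)) := by
      refine (neg_sgn_eq ?_).symm
      simp only [ideg_append, ideg_cons, ideg_xWord, fdeg_append, fdeg_cons, fdeg_xWord,
        Letter.ideg, Letter.fdeg, ideg_nil, fdeg_nil]
      push_cast
      ring
    rw [e3] at h
    simp only [List.append_assoc, List.singleton_append] at h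
    simp only [C, twoFormWord, h]
    ring
  refine ⟨C, hs, fun I i J j h => ?_, ?_⟩
  · have h1 : rotNorm k deg c (twoFormWord I i J j) ≠ 0 := right_ne_zero_of_mul h
    have h2 := rotNorm_add_self (deg := deg) c (twoFormWord I i J j)
    by_contra hne
    have hz : ∀ l, ideg deg l = ideg deg (twoFormWord I i J j) → c l = 0 := fun l hl => by
      by_contra h0
      refine hne ?_
      rw [(hc l h0).2, ideg_twoFormWord] at hl
      omega
    rw [hz _ rfl, add_zero, sum2_eq_zero] at h2
    · exact h1 h2
    · intro u v huv
      rw [hz _ (by rw [← huv, ideg_append, ideg_append, add_comm]), mul_zero]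
  · refine sub_eq_zero.mp ?_
    have : C.form deg - (commutators k deg).mkQ c = cyc k deg (C.series - c) := by
      rw [cyc, map_sub]
      rfl
    rw [this]
    refine cyc_eq_zero_of_twoForm (fun l h => ?_) fun I i J j => ?_
    · by_cases h0 : c l = 0
      · refine C.fdeg_of_series_ne_zero fun h1 => h ?_
        simp [h0, h1]
      · exact (hc l h0).1
    · rw [map_sub, Pi.sub_apply, hs.rotNorm_series, mul_inv_cancel_left₀ two_ne_zero, sub_self]

theorem TwoFormCoeff.IsSkew.originMatrix_form [Fintype ι] {C : TwoFormCoeff ι k}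
    (hC : C.IsSkew deg) (i j : ι) : originMatrix k deg (C.form deg) i j = 2 * C [] i [] j := by
  have e1 := C.series_twoFormWord [] i [] j
  have e2 := C.series_twoFormWord [] j [] i
  have h := hC [] i [] j
  change C.series [.dx i, .dx j] = _ at e1
  change C.series [.dx j, .dx i] = _ at e2
  change C.series [.dx i, .dx j] + exSign k deg [.dx i] [.dx j] * C.series [.dx j, .dx i] = _
  have e3 : exSign k deg [.dx i] [.dx j] = -(-1 : k) ^ (deg i * deg j) := by
    refine (neg_sgn_eq ?_).symm
    simp only [ideg_cons, fdeg_cons, Letter.ideg, Letter.fdeg, ideg_nil, fdeg_nil]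
    push_cast
    ring
  simp only [List.map_nil, List.sum_nil, zero_add] at h
  rw [e1, e2, e3]
  linear_combination -h

end TwoForms

end AInfinity

namespace AInfinity

/-! ### The de Rham differential of a two-form -/

section Closed

variable {ι : Type w} {k : Type v} [Field k] {deg : ι → ℤ}

theorem dCoeff_congr_length (l : List (Letter ι)) (c c' : Series ι k)
    (h : ∀ t, t.length = l.length → c t = c' t) : dCoeff l c = dCoeff l c' := by
  induction l generalizing c c' with
  | nil => rfl
  | cons y l ih =>
    have key : dCoeff l (fun t => c (y :: t)) = dCoeff l (fun t => c' (y :: t)) :=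
      ih _ _ fun t ht => h _ (by simp [ht])
    cases y with
    | x i => exact key
    | dx i => simp only [dCoeff, key, h (.x i :: l) rfl]

theorem dSeries_iterate_rot (r : ℕ) (c : Series ι k) :
    dSeries k ((rot k deg)^[r] c) = (rot k deg)^[r] (dSeries k c) := by
  induction r with
  | zero => rfl
  | succ r ih => rw [Function.iterate_succ_apply', dSeries_rot, ih, Function.iterate_succ_apply']

theorem rotNorm_dSeries (c : Series ι k) :
    rotNorm k deg (dSeries k c) = dSeries k (rotNorm k deg c) := by
  funext l
  rw [rotNorm_apply]
  simp only [← dSeries_iterate_rot]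
  -- The number of rotations depends on the length of the word; since `d` preserves length, one
  -- fixed range serves for all coefficients involved.
  have h : dSeries k (rotNorm k deg c) l =
      dSeries k (∑ r ∈ Finset.range l.length, (rot k deg)^[r] c) l :=
    dCoeff_congr_length _ _ _ fun t ht => by rw [rotNorm_apply, ht, Finset.sum_apply]
  rw [h, map_sum, Finset.sum_apply]

theorem dCoeff_xWord_append (I : List ι) (l : List (Letter ι)) (c : Series ι k) :
    dCoeff (xWord I ++ l) c = dCoeff l (fun t => c (xWord I ++ t)) := by
  induction I generalizing c with
  | nil => rfl
  | cons i I ih => rw [xWord_cons, List.cons_append, dCoeff, ih]; rfl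

theorem dCoeff_xWord (I : List ι) (c : Series ι k) : dCoeff (xWord I) c = 0 := by
  simpa [dCoeff] using dCoeff_xWord_append I [] c

namespace TwoFormCoeff

/-- The closedness expression on three marked basis elements. -/
def closedSum (deg : ι → ℤ) (C : TwoFormCoeff ι k) (x : ι) (Q : List ι) (y : ι) (R : List ι) (z : ι)
    (W : List ι) : k :=
  (-1 : k) ^ ((deg x + (Q.map deg).sum + deg y) * ((R.map deg).sum + deg z + (W.map deg).sum)) *
    C (R ++ z :: W) x Q y +
  (-1 : k) ^ ((deg x + (Q.map deg).sum + deg y + (R.map deg).sum + deg z) * (W.map deg).sum) *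
    C (W ++ x :: Q) y R z +
  (-1 : k) ^ (deg x * ((Q.map deg).sum + deg y + (R.map deg).sum + deg z + (W.map deg).sum)) *
    C (Q ++ y :: R) z W x

/-- One of the three differentials was created by `d`. Each of the three terms is rotated to a
normal word with two differentials, where the rotation sum is twice a coefficient. -/
theorem IsSkew.dSeries_rotNorm {C : TwoFormCoeff ι k} (hC : C.IsSkew deg) (x : ι) (Q : List ι)
    (y : ι) (R : List ι) (z : ι) (W : List ι) :
    dSeries k (rotNorm k deg C.series)
      (.dx x :: (xWord Q ++ .dx y :: (xWord R ++ .dx z :: xWord W))) =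
    2 * C.closedSum deg x Q y R z W := by
  change dCoeff _ _ = _
  simp only [dCoeff, dCoeff_xWord_append, dCoeff_xWord]
  have e1 := rotNorm_append (deg := deg) C.series
    (.x x :: (xWord Q ++ .dx y :: (xWord R ++ [.dx z]))) (xWord W)
  have e2 := rotNorm_append (deg := deg) C.series [.dx x]
    (xWord Q ++ .x y :: (xWord R ++ .dx z :: xWord W))
  have e3 := rotNorm_append (deg := deg) C.series (.dx x :: (xWord Q ++ [.dx y]))
    (xWord R ++ .x z :: xWord W)
  have t1 := hC.rotNorm_series (W ++ x :: Q) y R z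
  have t2 := hC.rotNorm_series (Q ++ y :: R) z W x
  have t3 := hC.rotNorm_series (R ++ z :: W) x Q y
  simp only [twoFormWord, xWord_append, xWord_cons, List.append_assoc, List.cons_append,
    List.nil_append] at e1 e2 e3 t1 t2 t3 ⊢
  rw [t1] at e1
  rw [t2] at e2
  rw [t3] at e3
  rw [e1, e2, e3]
  have s1 : exSign k deg (.x x :: (xWord Q ++ .dx y :: (xWord R ++ [.dx z]))) (xWord W) =
      (-1 : k) ^ ((deg x + (Q.map deg).sum + deg y + (R.map deg).sum + deg z) *
        (W.map deg).sum) := by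
    refine sgn_eq ?_
    simp only [ideg_append, ideg_cons, ideg_xWord, fdeg_append, fdeg_cons, fdeg_xWord,
      Letter.ideg, Letter.fdeg, ideg_nil, fdeg_nil]
    push_cast
    grind
  have s2 : exSign k deg [.dx x] (xWord Q ++ .x y :: (xWord R ++ .dx z :: xWord W)) =
      -(-1 : k) ^ (deg x * ((Q.map deg).sum + deg y + (R.map deg).sum + deg z +
        (W.map deg).sum)) := by
    refine (neg_sgn_eq ?_).symm
    simp only [ideg_append, ideg_cons, ideg_xWord, fdeg_append, fdeg_cons, fdeg_xWord,
      Letter.ideg, Letter.fdeg, ideg_nil, fdeg_nil]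
    push_cast
    grind
  have s3 : exSign k deg (.dx x :: (xWord Q ++ [.dx y])) (xWord R ++ .x z :: xWord W) =
      (-1 : k) ^ ((deg x + (Q.map deg).sum + deg y) *
        ((R.map deg).sum + deg z + (W.map deg).sum)) := by
    refine sgn_eq ?_
    simp only [ideg_append, ideg_cons, ideg_xWord, fdeg_append, fdeg_cons, fdeg_xWord,
      Letter.ideg, Letter.fdeg, ideg_nil, fdeg_nil]
    push_cast
    grind
  rw [s1, s2, s3, closedSum]
  ring

theorem IsSkew.extD_form_eq_zero_iff [CharZero k] {C : TwoFormCoeff ι k} (hC : C.IsSkew deg) :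
    extD k deg (C.form deg) = 0 ↔ ∀ x Q y R z W, C.closedSum deg x Q y R z W = 0 := by
  have h0 : extD k deg (C.form deg) = cyc k deg (dSeries k C.series) := rfl
  have h1 : dSeries k C.series [] = 0 := rfl
  rw [h0, cyc_eq_zero_iff, and_iff_left h1, rotNorm_dSeries]
  constructor
  · intro h x Q y R z W
    have := congrFun h (.dx x :: (xWord Q ++ .dx y :: (xWord R ++ .dx z :: xWord W)))
    rw [hC.dSeries_rotNorm] at this
    exact (mul_eq_zero.mp this).resolve_left two_ne_zero
  · intro h
    funext l
    by_cases hl : fdeg l = 3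
    · obtain ⟨I, x, r, rfl, hr⟩ := eq_of_fdeg_pos (by norm_num) hl
      obtain ⟨Q, y, s, rfl, hs⟩ := eq_of_fdeg_pos (by norm_num) hr
      obtain ⟨R, z, t, rfl, ht⟩ := eq_of_fdeg_pos (by norm_num) hs
      obtain ⟨W, rfl⟩ := eq_xWord_of_fdeg_zero (by rw [ht]; norm_num)
      -- The leading `x^I` is moved to the end, so that the word starts with a differential.
      rw [← rotNorm_dSeries, rotNorm_append, rotNorm_dSeries]
      have := hC.dSeries_rotNorm x Q y R z (W ++ I)
      rw [h, mul_zero] at this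
      simp only [xWord_append, List.append_assoc, List.cons_append] at this ⊢
      rw [this, mul_zero]
      rfl
    · have hz : dCoeff l (fun _ => (0 : k) * 0) = 0 := by
        rw [dCoeff_smul l 0 (fun _ => 0), zero_mul]
      change dCoeff l _ = 0
      rw [← hz]
      refine dCoeff_congr deg _ _ _ fun t _ ht => ?_
      have := rotNorm_add_self (deg := deg) C.series t
      have hs : ∀ s, fdeg s = fdeg t → C.series s = 0 := fun s hs => by
        by_contra hne
        have := C.fdeg_of_series_ne_zero hne
        omega
      rw [hs t rfl, add_zero, sum2_eq_zero] at this
      · rw [this, mul_zero]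
      · intro u v huv
        rw [hs _ (by rw [← huv, fdeg_append, fdeg_append, add_comm]), mul_zero]

end TwoFormCoeff

end Closed

/-! ### Closedness and non-degeneracy of a family in terms of its two-form -/

section ClosedMaps

variable {k : Type v} [Field k] {A : Type u} [AddCommGroup A] [Module k A]
  {𝒜 : ℤ → Submodule k A} {ι : Type w} (e : Module.Basis ι k A) {deg : ι → ℤ} {D : ℤ}

theorem WLin.append_left {N : Type*} [AddCommGroup N] [Module k N] {T : List (HElt 𝒜) → N}
    (hT : WLin T) (U : List (HElt 𝒜)) : WLin (fun l => T (U ++ l)) := fun u v => by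
  simpa only [List.append_assoc] using hT (U ++ u) v

theorem WLin.append_right {N : Type*} [AddCommGroup N] [Module k N] {T : List (HElt 𝒜) → N}
    (hT : WLin T) (V : List (HElt 𝒜)) : WLin (fun l => T (l ++ V)) := fun u v => by
  simpa only [List.append_assoc, List.cons_append] using hT u (v ++ V)

theorem WLin.append_cons {N : Type*} [AddCommGroup N] [Module k N] {T : List (HElt 𝒜) → N}
    (hT : WLin T) (U : List (HElt 𝒜)) (x : HElt 𝒜) : WLin (fun l => T (U ++ x :: l)) := by
  simpa only [List.append_assoc, List.singleton_append] using hT.append_left (U ++ [x])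

/-- The closedness expression, for cyclic words that start with the first of the three marked
elements. -/
def TwoMarked.closedSum (T : TwoMarked 𝒜) (x : HElt 𝒜) (Q : List (HElt 𝒜)) (y : HElt 𝒜)
    (R : List (HElt 𝒜)) (z : HElt 𝒜) (W : List (HElt 𝒜)) : k :=
  (-1 : k) ^ ((x.1 + wdeg Q + y.1) * (wdeg R + z.1 + wdeg W)) * T (R ++ z :: W) x Q y +
  (-1 : k) ^ ((x.1 + wdeg Q + y.1 + wdeg R + z.1) * wdeg W) * T (W ++ x :: Q) y R z +
  (-1 : k) ^ (x.1 * (wdeg Q + y.1 + wdeg R + z.1 + wdeg W)) * T (Q ++ y :: R) z W x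

theorem PreBimoduleMap.isClosed_iff_closedSum (hdeg : ∀ i, e i ∈ 𝒜 (deg i))
    (h𝒜 : DirectSum.IsInternal 𝒜) (Φ : PreBimoduleMap 𝒜 D) :
    Φ.IsClosed ↔ ∀ x Q y R z W, (Φ.coeff e).closedSum deg x Q y R z W = 0 := by
  rw [Φ.isClosed_iff]
  have hb : ∀ x Q y R z W, TwoMarked.closedSum Φ.ev (basisElt e hdeg x)
      (Q.map (basisElt e hdeg)) (basisElt e hdeg y) (R.map (basisElt e hdeg)) (basisElt e hdeg z)
      (W.map (basisElt e hdeg)) = (Φ.coeff e).closedSum deg x Q y R z W := fun x Q y R z W => by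
    rw [TwoFormCoeff.closedSum, ← Φ.ev_basisElt e hdeg, ← Φ.ev_basisElt e hdeg,
      ← Φ.ev_basisElt e hdeg]
    simp only [TwoMarked.closedSum, wdeg_map_basisElt e hdeg, List.map_append, List.map_cons]
    rfl
  constructor
  · intro h x Q y R z W
    rw [← hb]
    exact h _ _ _ _ _ _
  · intro h x Q y R z W
    change TwoMarked.closedSum Φ.ev x Q y R z W = 0
    have hT := Φ.ev_isMultilinear
    -- The six arguments are replaced by basis elements or words of such, one after the other from
    -- the last to the first.
    refine WLin.ext_basis e hdeg h𝒜 (T := fun W => TwoMarked.closedSum Φ.ev x Q y R z W)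
      (T' := fun _ => 0) ?_ WLin.zero (fun W => ?_) W
    · refine ((WLin.mul_deg (fun d => (-1 : k) ^ ((x.1 + wdeg Q + y.1) * (wdeg R + z.1 + d)))
        ((hT.left _ _ _).append_cons _ _)).add
        (WLin.mul_deg (fun d => (-1 : k) ^ ((x.1 + wdeg Q + y.1 + wdeg R + z.1) * d))
        ((hT.left _ _ _).append_right _))).add
        (WLin.mul_deg (fun d => (-1 : k) ^ (x.1 * (wdeg Q + y.1 + wdeg R + z.1 + d)))
        (hT.right _ _ _))
    refine HLin.ext_basis e hdeg h𝒜 (g := fun z => TwoMarked.closedSum Φ.ev x Q y R z _)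
      (g' := fun _ => 0) ?_ HLin.zero (fun z => ?_) z
    · refine ((HLin.mul_deg (fun d => (-1 : k) ^ ((x.1 + wdeg Q + y.1) * (wdeg R + d + wdeg _)))
        (hT.left _ _ _ _ _)).add
        (HLin.mul_deg (fun d => (-1 : k) ^ ((x.1 + wdeg Q + y.1 + wdeg R + d) * wdeg _))
        (hT.last _ _ _))).add
        (HLin.mul_deg (fun d => (-1 : k) ^ (x.1 * (wdeg Q + y.1 + wdeg R + d + wdeg _)))
        (hT.mid _ _ _))
    refine WLin.ext_basis e hdeg h𝒜 (T := fun R => TwoMarked.closedSum Φ.ev x Q y R _ _)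
      (T' := fun _ => 0) ?_ WLin.zero (fun R => ?_) R
    · refine ((WLin.mul_deg (fun d => (-1 : k) ^ ((x.1 + wdeg Q + y.1) * (d + Sigma.fst _ +
          wdeg _)))
        ((hT.left _ _ _).append_right _)).add
        (WLin.mul_deg (fun d => (-1 : k) ^ ((x.1 + wdeg Q + y.1 + d + Sigma.fst _) * wdeg _))
        (hT.right _ _ _))).add
        (WLin.mul_deg (fun d => (-1 : k) ^ (x.1 * (wdeg Q + y.1 + d + Sigma.fst _ + wdeg _)))
        ((hT.left _ _ _).append_cons _ _))
    refine HLin.ext_basis e hdeg h𝒜 (g := fun y => TwoMarked.closedSum Φ.ev x Q y _ _ _)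
      (g' := fun _ => 0) ?_ HLin.zero (fun y => ?_) y
    · refine ((HLin.mul_deg (fun d => (-1 : k) ^ ((x.1 + wdeg Q + d) *
          (wdeg _ + Sigma.fst _ + wdeg _))) (hT.last _ _ _)).add
        (HLin.mul_deg (fun d => (-1 : k) ^ ((x.1 + wdeg Q + d + wdeg _ + Sigma.fst _) * wdeg _))
        (hT.mid _ _ _))).add
        (HLin.mul_deg (fun d => (-1 : k) ^ (x.1 * (wdeg Q + d + wdeg _ + Sigma.fst _ + wdeg _)))
        (hT.left _ _ _ _ _))
    refine WLin.ext_basis e hdeg h𝒜 (T := fun Q => TwoMarked.closedSum Φ.ev x Q _ _ _ _)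
      (T' := fun _ => 0) ?_ WLin.zero (fun Q => ?_) Q
    · refine ((WLin.mul_deg (fun d => (-1 : k) ^ ((x.1 + d + Sigma.fst _) *
          (wdeg _ + Sigma.fst _ + wdeg _))) (hT.right _ _ _)).add
        (WLin.mul_deg (fun d => (-1 : k) ^ ((x.1 + d + Sigma.fst _ + wdeg _ + Sigma.fst _) *
          wdeg _)) ((hT.left _ _ _).append_cons _ _))).add
        (WLin.mul_deg (fun d => (-1 : k) ^ (x.1 * (d + Sigma.fst _ + wdeg _ + Sigma.fst _ +
          wdeg _))) ((hT.left _ _ _).append_right _))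
    refine HLin.ext_basis e hdeg h𝒜 (g := fun x => TwoMarked.closedSum Φ.ev x _ _ _ _ _)
      (g' := fun _ => 0) ?_ HLin.zero (fun x => ?_) x
    · refine ((HLin.mul_deg (fun d => (-1 : k) ^ ((d + wdeg _ + Sigma.fst _) *
          (wdeg _ + Sigma.fst _ + wdeg _))) (hT.mid _ _ _)).add
        (HLin.mul_deg (fun d => (-1 : k) ^ ((d + wdeg _ + Sigma.fst _ + wdeg _ + Sigma.fst _) *
          wdeg _)) (hT.left _ _ _ _ _))).add
        (HLin.mul_deg (fun d => (-1 : k) ^ (d * (wdeg _ + Sigma.fst _ + wdeg _ + Sigma.fst _ +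
          wdeg _))) (hT.last _ _ _))
    exact (hb x Q y R z W).trans (h x Q y R z W)

theorem PreBimoduleMap.isClosed_iff_extD [CharZero k] (hdeg : ∀ i, e i ∈ 𝒜 (deg i))
    (h𝒜 : DirectSum.IsInternal 𝒜) {Φ : PreBimoduleMap 𝒜 D} (hΦ : Φ.IsSkew) :
    Φ.IsClosed ↔ extD k deg (Φ.form e deg) = 0 := by
  rw [Φ.isClosed_iff_closedSum e hdeg h𝒜]
  exact (((Φ.isSkew_iff e hdeg h𝒜).mp hΦ).extD_form_eq_zero_iff).symm

/-- The matrix at the origin is the Gram matrix of `2 φ_{0,0}` in the basis `e`. -/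
theorem PreBimoduleMap.isNondegenerate_iff [Fintype ι] [CharZero k]
    (hdeg : ∀ i, e i ∈ 𝒜 (deg i)) (h𝒜 : DirectSum.IsInternal 𝒜) {Φ : PreBimoduleMap 𝒜 D}
    (hΦ : Φ.IsSkew) : Φ.IsNondegenerate ↔ (originMatrix k deg (Φ.form e deg)).Nondegenerate := by
  classical
  have h2 : (2 : k) ≠ 0 := two_ne_zero
  have hm : ∀ i j, originMatrix k deg (Φ.form e deg) i j = 2 * Φ.pairing (e i) (e j) :=
    ((Φ.isSkew_iff e hdeg h𝒜).mp hΦ).originMatrix_form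
  have hM : originMatrix k deg (Φ.form e deg) =
      LinearMap.toMatrix₂ e e ((2 : k) • Φ.pairing) := by
    ext i j
    rw [hm, LinearMap.toMatrix₂_apply]
    rfl
  rw [hM, LinearMap.nondegenerate_toMatrix₂_iff]
  constructor
  · intro h
    exact ⟨fun x hx => h.1 x fun y => (mul_eq_zero.mp (hx y)).resolve_left h2,
      fun y hy => h.2 y fun x => (mul_eq_zero.mp (hy x)).resolve_left h2⟩
  · intro h
    exact ⟨fun x hx => h.1 x fun y => by
        change (2 : k) * Φ.pairing x y = 0
        rw [Φ.pairing_apply, hx, mul_zero],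
      fun y hy => h.2 y fun x => by
        change (2 : k) * Φ.pairing x y = 0
        rw [Φ.pairing_apply, hy, mul_zero]⟩

end ClosedMaps

end AInfinity

namespace AInfinity

/-! ### Normal form of a general two-form -/

section NormalForm

variable {ι : Type w} {k : Type v} [Field k] {deg : ι → ℤ}

/-- The coefficients of a two-form, moved to the words `x^I dx_i x^J dx_j`. -/
def normalCoeff (deg : ι → ℤ) (c : Series ι k) : TwoFormCoeff ι k := fun I i J j =>
  sum2 I (fun P S =>
    (-1 : k) ^ ((P.map deg).sum * ((S.map deg).sum + deg i + (J.map deg).sum + deg j)) *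
      c (twoFormWord S i J j ++ xWord P))

/-- Cuts inside `x^I` and inside `x^J` account for the rotations that end with powers of the
coordinates. `normalCoeff` collects them, for the word and for its exchange, so that a series and
its normal form have equal rotation sums. -/
theorem rotNorm_twoFormWord (c : Series ι k) (I : List ι) (i : ι) (J : List ι) (j : ι) :
    rotNorm k deg c (twoFormWord I i J j) = normalCoeff deg c I i J j -
      (-1 : k) ^ (((I.map deg).sum + deg i) * ((J.map deg).sum + deg j)) *
        normalCoeff deg c J j I i := by
  have h := rotNorm_add_self (deg := deg) c (twoFormWord I i J j)
  have e1 : sum2 (xWord I) (fun p t => exSign k deg p (t ++ .dx i :: (xWord J ++ [.dx j])) *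
      c ((t ++ .dx i :: (xWord J ++ [.dx j])) ++ p)) = normalCoeff deg c I i J j := by
    rw [xWord, sum2_map]
    refine sum2_congr _ _ _ fun P S _ => ?_
    change exSign k deg (xWord P) (twoFormWord S i J j) * c (twoFormWord S i J j ++ xWord P) = _
    congr 1
    rw [exSign, ideg_xWord, ideg_twoFormWord, fdeg_xWord]
    congr 1
    ring
  have e2 : sum2 (xWord J) (fun p t => exSign k deg (xWord I ++ .dx i :: p) (t ++ [.dx j]) *
      c ((t ++ [.dx j]) ++ (xWord I ++ .dx i :: p))) =
      -(-1 : k) ^ (((I.map deg).sum + deg i) * ((J.map deg).sum + deg j)) *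
        normalCoeff deg c J j I i := by
    rw [xWord, sum2_map, normalCoeff, ← sum2_mul]
    refine sum2_congr _ _ _ fun P S hJ => ?_
    subst hJ
    change exSign k deg (xWord I ++ .dx i :: xWord P) (xWord S ++ [.dx j]) * _ = _
    rw [← mul_assoc]
    congr 1
    · rw [neg_mul, sgn_mul]
      refine (neg_sgn_eq ?_).symm
      simp only [ideg_append, ideg_cons, ideg_xWord, fdeg_append, fdeg_cons, fdeg_xWord,
        Letter.ideg, Letter.fdeg, ideg_nil, fdeg_nil, List.map_append, List.sum_append]
      push_cast
      grind
    · congr 1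
      simp [twoFormWord, xWord]
  conv_rhs at h => rw [twoFormWord]
  rw [sum2_append_cons, sum2_snoc, e1, e2, exSign_nil_right] at h
  simp only [List.nil_append, one_mul] at h
  change _ = _ + (_ + c (twoFormWord I i J j)) at h
  linear_combination h

theorem cyc_eq_form_normalCoeff [CharZero k] {c : Series ι k} (hc : ∀ l, c l ≠ 0 → fdeg l = 2) :
    cyc k deg c = (normalCoeff deg c).form deg := by
  rw [← sub_eq_zero, TwoFormCoeff.form, cyc, cyc, ← map_sub]
  refine cyc_eq_zero_of_twoForm (fun l h => ?_) fun I i J j => ?_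
  · by_cases h0 : c l = 0
    · refine TwoFormCoeff.fdeg_of_series_ne_zero (normalCoeff deg c) fun h1 => h ?_
      simp [h0, h1]
    · exact hc l h0
  · rw [map_sub, Pi.sub_apply, rotNorm_twoFormWord, TwoFormCoeff.rotNorm_series, sub_self]

theorem TwoFormCoeff.series_add (C C' : TwoFormCoeff ι k) :
    (C + C').series = C.series + C'.series := by
  have h := TwoFormCoeff.series_sub (C + C') C'
  rw [add_sub_cancel_right] at h
  rw [h, sub_add_cancel]

theorem pureWord_xWord (I : List ι) : pureWord (xWord I) = some I := by
  induction I with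
  | nil => rfl
  | cons i I ih => rw [xWord_cons, pureWord, ih]; rfl

theorem pureWord_append_dx (I : List ι) (i : ι) (l : List (Letter ι)) :
    pureWord (xWord I ++ .dx i :: l) = none := by
  induction I with
  | nil => rfl
  | cons j I ih => rw [xWord_cons, List.cons_append, pureWord, ih]; rfl

theorem OddVectorField.onCoord_xWord (δ : OddVectorField k deg) (j : ι) (I : List ι) : δ.onCoord j
    (xWord I) = δ.comp j I := by
  rw [OddVectorField.onCoord, pureWord_xWord]

end NormalForm

/-! ### The Lie derivative of a two-form in normal form -/

section Contraction

variable {ι : Type w} {k : Type v} [Field k] {deg : ι → ℤ} [Fintype ι]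
  (δ : OddVectorField k deg)

namespace OddVectorField

theorem contract_xWord (S : List ι) (g : Letter ι → k) :
    δ.contract (xWord S) g = ∑ s, δ.comp s S * g (.x s) := by
  rw [contract]
  have h1 : ∀ j, δ.onLetter (.x j) (xWord S) = δ.comp j S := fun j => δ.onCoord_xWord j S
  have h2 : ∀ j, δ.onLetter (.dx j) (xWord S) = 0 := fun j => dCoeff_xWord S _
  simp only [h1, h2, zero_mul, Finset.sum_const_zero, add_zero]

/-- A block with exactly one differential can only come from a letter `dx_s`, by applying `d` to one
coordinate of a monomial of `δ x_s`. -/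
theorem contract_dx (S : List ι) (i : ι) (S' : List ι) (g : Letter ι → k) :
    δ.contract (xWord S ++ .dx i :: xWord S') g = ∑ s, δ.comp s (S ++ i :: S') * g (.dx s) := by
  rw [contract]
  have h1 : ∀ j, δ.onLetter (.x j) (xWord S ++ .dx i :: xWord S') = 0 := fun j => by
    change δ.onCoord j _ = 0
    rw [onCoord, pureWord_append_dx]
  have h2 : ∀ j, δ.onLetter (.dx j) (xWord S ++ .dx i :: xWord S') = δ.comp j (S ++ i :: S') :=
    fun j => by
      change dCoeff _ (δ.onCoord j) = _
      rw [dCoeff_xWord_append, dCoeff, dCoeff_xWord, sub_zero, ← δ.onCoord_xWord, xWord_append,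
        xWord_cons]
  simp only [h1, h2, zero_mul, Finset.sum_const_zero, zero_add]

theorem contract_eq_zero (s : List (Letter ι)) (g : Letter ι → k)
    (h : ∀ y : Letter ι, fdeg s = y.fdeg → g y = 0) : δ.contract s g = 0 := by
  rw [δ.contract_congr s g (fun y => 0 * g y) fun y _ hy => by rw [h y hy, zero_mul],
    contract_mul, zero_mul]

/-- The terms of `L_δ ω` in which the second differential is untouched. -/
def lieInner (C : TwoFormCoeff ι k) : TwoFormCoeff ι k := fun I i J j =>
  sum3 I (fun P S T => (-1 : k) ^ (P.map deg).sum * ∑ s, δ.comp s S * C (P ++ s :: T) i J j) +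
  sum2 I (fun P S => sum2 J (fun S' T => (-1 : k) ^ (P.map deg).sum *
    ∑ s, δ.comp s (S ++ i :: S') * C P s T j)) +
  sum3 J (fun P S T => (-1 : k) ^ ((I.map deg).sum + deg i + (P.map deg).sum) *
    ∑ s, δ.comp s S * C I i (P ++ s :: T) j)

/-- The terms of `L_δ ω` in which the second differential comes from a block around it. -/
def lieOuter (C : TwoFormCoeff ι k) : TwoFormCoeff ι k := fun I i J j =>
  sum2 I (fun P S => sum2 J (fun S' T => (-1 : k) ^ ((S.map deg).sum + deg i + (S'.map deg).sum +
      (P.map deg).sum * ((S.map deg).sum + deg i + (S'.map deg).sum + (T.map deg).sum + deg j)) *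
    ∑ s, δ.comp s (T ++ j :: P) * C S i S' s))

theorem lieSeries_eq_zero {C : TwoFormCoeff ι k} {l : List (Letter ι)} (hl : fdeg l ≠ 2) :
    δ.lieSeries C.series l = 0 := by
  rw [lieSeries_apply]
  refine sum2_eq_zero _ _ fun p r hr => sum2_eq_zero _ _ fun s t hs => ?_
  beta_reduce
  rw [δ.contract_eq_zero, mul_zero]
  intro y hy
  by_contra hne
  have h := C.fdeg_of_series_ne_zero hne
  rw [← hr, ← hs] at hl
  simp only [fdeg_append, fdeg_cons] at h hl
  omega

theorem lastPart_eq_zero {C : TwoFormCoeff ι k} {l : List (Letter ι)} (hl : fdeg l ≠ 2) :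
    δ.lastPart C.series l = 0 := by
  rw [lastPart_apply]
  refine sum2_eq_zero _ _ fun p s hs => ?_
  rw [δ.contract_eq_zero, mul_zero]
  intro y hy
  by_contra hne
  have h := C.fdeg_of_series_ne_zero hne
  rw [← hs] at hl
  simp only [fdeg_append, fdeg_cons, fdeg_nil] at h hl
  omega

theorem neg_one_zpow_neg (n : ℤ) : (-1 : k) ^ (-n) = (-1 : k) ^ n := sgn_congr ⟨-n, by ring⟩

/-- Without the terms whose block is final, the last letter of the word is the last letter of the
original one. It must be a differential, so these terms are already in normal form; the block lies
before, around or after `dx_i`. -/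
theorem lieSeries_sub_lastPart (C : TwoFormCoeff ι k) :
    δ.lieSeries C.series - δ.lastPart C.series = (δ.lieInner C).series := by
  funext l
  by_cases hl : fdeg l = 2
  swap
  · rw [Pi.sub_apply, δ.lieSeries_eq_zero hl, δ.lastPart_eq_zero hl, sub_zero]
    by_contra hne
    exact hl ((δ.lieInner C).fdeg_of_series_ne_zero (Ne.symm hne))
  rcases List.eq_nil_or_concat' l with rfl | ⟨l, a, rfl⟩
  · exact absurd hl (by simp [fdeg])
  rw [Pi.sub_apply, lieSeries_apply, lastPart_apply, sum3_snoc, add_sub_cancel_right]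
  cases a with
  | x a =>
    rw [TwoFormCoeff.series_append_x]
    refine sum2_eq_zero _ _ fun p r hr => sum2_eq_zero _ _ fun s t hs => ?_
    beta_reduce
    rw [δ.contract_eq_zero, mul_zero]
    intro y hy
    simpa using C.series_append_x (p ++ y :: t) a
  | dx j =>
    rw [fdeg_append, fdeg_cons, fdeg_nil, Letter.fdeg] at hl
    obtain ⟨I, i, r, rfl, hr⟩ := eq_of_fdeg_pos (l := l) (n := 1) (by norm_num) (by omega)
    obtain ⟨J, rfl⟩ := eq_xWord_of_fdeg_zero (l := r) (by omega)
    have e := (δ.lieInner C).series_twoFormWord I i J j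
    rw [twoFormWord] at e
    rw [List.append_assoc, List.cons_append, e, lieInner, sum3_append_cons]
    congr 1
    · congr 1
      · rw [xWord, sum3_map]
        refine sum3_congr _ _ _ fun P S T _ => ?_
        change (-1 : k) ^ ideg deg (xWord P) * δ.contract (xWord S) (fun y => _) = _
        rw [contract_xWord, ideg_xWord, neg_one_zpow_neg]
        congr 1
        refine Finset.sum_congr rfl fun s _ => ?_
        congr 1
        rw [← C.series_twoFormWord]
        congr 1
        simp [twoFormWord, xWord]
      · rw [xWord, xWord, sum2_map]
        simp only [sum2_map]
        refine sum2_congr _ _ _ fun P S _ => sum2_congr _ _ _ fun S' T _ => ?_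
        change (-1 : k) ^ ideg deg (xWord P) *
          δ.contract (xWord S ++ .dx i :: xWord S') (fun y => _) = _
        rw [contract_dx, ideg_xWord, neg_one_zpow_neg]
        congr 1
        refine Finset.sum_congr rfl fun s _ => ?_
        congr 1
        exact C.series_twoFormWord P s T j
    · rw [xWord, xWord, sum3_map]
      refine sum3_congr _ _ _ fun P S T _ => ?_
      change (-1 : k) ^ ideg deg (xWord I ++ .dx i :: xWord P) *
        δ.contract (xWord S) (fun y => _) = _
      rw [contract_xWord]
      have : ideg deg (xWord I ++ .dx i :: xWord P) =
          -((I.map deg).sum + deg i + (P.map deg).sum) := by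
        simp only [ideg_append, ideg_cons, ideg_xWord, Letter.ideg]
        ring
      rw [this, neg_one_zpow_neg]
      congr 1
      refine Finset.sum_congr rfl fun s _ => ?_
      congr 1
      rw [← C.series_twoFormWord]
      congr 1
      simp [twoFormWord, xWord]

/-- The final block comes from the last letter of a normal word, hence from a differential, and so
contains precisely the second differential of the given word. -/
theorem lastPart_twoFormWord_append (C : TwoFormCoeff ι k) (I : List ι) (i : ι) (J : List ι)
    (j : ι) (P : List ι) : δ.lastPart C.series (twoFormWord I i J j ++ xWord P) =
      sum2 J (fun S T => (-1 : k) ^ ((I.map deg).sum + deg i + (S.map deg).sum) *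
        ∑ s, δ.comp s (T ++ j :: P) * C I i S s) := by
  rw [lastPart_apply]
  have hz : ∀ p s : List (Letter ι), fdeg p ≠ 1 → fdeg p + fdeg s = 2 → (-1 : k) ^ ideg deg p *
      δ.contract s (fun y => C.series (p ++ [y])) = 0 := fun p s hp hps => by
    rw [δ.contract_eq_zero, mul_zero]
    intro y hy
    by_contra hne
    cases y with
    | x a => exact hne (C.series_append_x p a)
    | dx a =>
      rw [Letter.fdeg] at hy
      omega
  have hw : twoFormWord I i J j ++ xWord P = xWord I ++ .dx i :: (xWord J ++ .dx j :: xWord P) := by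
    simp [twoFormWord]
  rw [hw, sum2_append_cons, sum2_append_cons, sum2_eq_zero (xWord I), sum2_eq_zero (xWord P),
    zero_add, add_zero, xWord, xWord, sum2_map]
  · refine sum2_congr _ _ _ fun S T _ => ?_
    change (-1 : k) ^ ideg deg (xWord I ++ .dx i :: xWord S) *
      δ.contract (xWord T ++ .dx j :: xWord P) (fun y => _) = _
    have : ideg deg (xWord I ++ .dx i :: xWord S) =
        -((I.map deg).sum + deg i + (S.map deg).sum) := by
      simp only [ideg_append, ideg_cons, ideg_xWord, Letter.ideg]
      ring
    rw [contract_dx, this, neg_one_zpow_neg]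
    congr 1
    refine Finset.sum_congr rfl fun s _ => ?_
    congr 1
    rw [← C.series_twoFormWord]
    congr 1
    simp [twoFormWord, xWord]
  · intro p t hp
    have h0 : fdeg p + fdeg t = 0 := by rw [← fdeg_append, hp, fdeg_xWord]
    have h1 := fdeg_nonneg p
    have h2 := fdeg_nonneg t
    refine hz _ _ ?_ ?_ <;>
      simp only [fdeg_append, fdeg_cons, fdeg_xWord, Letter.fdeg, ne_eq] <;> omega
  · intro p t hp
    have h0 : fdeg p + fdeg t = 0 := by rw [← fdeg_append, hp, fdeg_xWord]
    have h1 := fdeg_nonneg p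
    have h2 := fdeg_nonneg t
    refine hz _ _ ?_ ?_ <;>
      simp only [fdeg_append, fdeg_cons, fdeg_xWord, Letter.fdeg, ne_eq] <;> omega

theorem normalCoeff_lastPart (C : TwoFormCoeff ι k) :
    normalCoeff deg (δ.lastPart C.series) = δ.lieOuter C := by
  funext I i J j
  rw [normalCoeff, lieOuter]
  refine sum2_congr _ _ _ fun P S _ => ?_
  rw [lastPart_twoFormWord_append, ← sum2_mul]
  refine sum2_congr _ _ _ fun S' T hJ => ?_
  rw [← mul_assoc, sgn_mul, ← hJ]
  congr 1
  refine sgn_eq ?_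
  simp only [List.map_append, List.sum_append]
  push_cast
  ring

theorem lieD_form [CharZero k] (C : TwoFormCoeff ι k) :
    δ.lieD (C.form deg) = (δ.lieInner C + δ.lieOuter C).form deg := by
  have h0 : δ.lieD (C.form deg) = cyc k deg (δ.lieSeries C.series) := rfl
  have h1 : cyc k deg (δ.lastPart C.series) = (δ.lieOuter C).form deg := by
    rw [← normalCoeff_lastPart]
    refine cyc_eq_form_normalCoeff fun l h => ?_
    by_contra hl
    exact h (δ.lastPart_eq_zero hl)
  rw [h0, TwoFormCoeff.form, TwoFormCoeff.series_add, ← lieSeries_sub_lastPart, cyc, cyc, map_add,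
    map_sub]
  have h2 : (commutators k deg).mkQ (δ.lieOuter C).series =
    (commutators k deg).mkQ (δ.lastPart C.series) := h1.symm
  rw [h2, sub_add_cancel]

/-- The sum over the values of a block on coordinates may be rearranged using the degree. -/
theorem sum_comp_congr (S : List ι) (r r' : k) (g g' : ι → k)
    (h : ∀ s, deg s = (S.map deg).sum + 1 → r * g s = r' * g' s) :
    r * ∑ s, δ.comp s S * g s = r' * ∑ s, δ.comp s S * g' s := by
  rw [Finset.mul_sum, Finset.mul_sum]
  refine Finset.sum_congr rfl fun s _ => ?_
  by_cases h0 : δ.comp s S = 0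
  · simp [h0]
  · have := δ.degree_one s S h0
    rw [mul_left_comm, h s (by omega), mul_left_comm]

/-- The exchange of `(I, i)` and `(J, j)` permutes the four kinds of terms: blocks before `dx_i`
with blocks before `dx_j` (`h13`), and blocks around `dx_i` with blocks around `dx_j` (`h24`). -/
theorem lie_isSkew {C : TwoFormCoeff ι k} (hC : C.IsSkew deg) :
    (δ.lieInner C + δ.lieOuter C).IsSkew deg := by
  have h13 : ∀ I i J j,
      sum3 J (fun P S T => (-1 : k) ^ ((I.map deg).sum + deg i + (P.map deg).sum) *
        ∑ s, δ.comp s S * C I i (P ++ s :: T) j) =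
      -(-1 : k) ^ (((I.map deg).sum + deg i) * ((J.map deg).sum + deg j)) *
        sum3 J (fun P S T => (-1 : k) ^ (P.map deg).sum *
          ∑ s, δ.comp s S * C (P ++ s :: T) j I i) := fun I i J j => by
    rw [← sum3_mul]
    refine sum3_congr _ _ _ fun P S T hJ => ?_
    rw [← mul_assoc]
    refine δ.sum_comp_congr _ _ _ _ _ fun s hs => ?_
    rw [hC (P ++ s :: T) j I i, neg_mul, neg_mul, mul_neg, neg_neg, ← mul_assoc, sgn_mul, sgn_mul,
      ← hJ]
    congr 1
    refine sgn_eq ?_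
    simp only [List.map_append, List.sum_append, List.map_cons, List.sum_cons, hs]
    push_cast
    grind
  have h24 : ∀ I i J j, δ.lieOuter C I i J j =
      -(-1 : k) ^ (((I.map deg).sum + deg i) * ((J.map deg).sum + deg j)) *
        sum2 J (fun P S => sum2 I (fun S' T => (-1 : k) ^ (P.map deg).sum *
          ∑ s, δ.comp s (S ++ j :: S') * C P s T i)) := fun I i J j => by
    rw [lieOuter, sum2_comm J I]
    simp only [← sum2_mul]
    refine sum2_congr _ _ _ fun P S hI => sum2_congr _ _ _ fun S' T hJ => ?_
    rw [← mul_assoc]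
    refine δ.sum_comp_congr _ _ _ _ _ fun s hs => ?_
    rw [hC S' s S i, neg_mul, neg_mul, mul_neg, neg_neg, ← mul_assoc, sgn_mul, sgn_mul, ← hI, ← hJ]
    congr 1
    refine sgn_eq ?_
    simp only [List.map_append, List.sum_append, List.map_cons, List.sum_cons] at hs ⊢
    rw [hs]
    push_cast
    grind
  intro I i J j
  have hs := sgn_mul_self (k := k) (((I.map deg).sum + deg i) * ((J.map deg).sum + deg j))
  have a1 := h13 I i J j
  have a2 := h13 J j I i
  have b1 := h24 I i J j
  have b2 := h24 J j I i
  rw [mul_comm ((J.map deg).sum + deg j)] at a2 b2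
  simp only [Pi.add_apply, lieInner]
  rw [a1, a2, b1, b2]
  linear_combination (-(sum3 I fun P S T => (-1 : k) ^ (P.map deg).sum *
      ∑ s, δ.comp s S * C (P ++ s :: T) i J j) -
    (sum2 I fun P S => sum2 J fun S' T => (-1 : k) ^ (P.map deg).sum *
      ∑ s, δ.comp s (S ++ i :: S') * C P s T j)) * hs

theorem lieD_form_eq_zero_iff [CharZero k] {C : TwoFormCoeff ι k} (hC : C.IsSkew deg) :
    δ.lieD (C.form deg) = 0 ↔ δ.lieInner C + δ.lieOuter C = 0 := by
  rw [lieD_form, (δ.lie_isSkew hC).form_eq_zero_iff]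

end OddVectorField

end Contraction

end AInfinity

namespace AInfinity

/-! ### The bimodule equation as invariance of the two-form -/

section Bimodule

variable {k : Type v} [Field k] {A : Type u} [AddCommGroup A] [Module k A]
  {𝒜 : ℤ → Submodule k A} {ι : Type w} [Fintype ι] (e : Module.Basis ι k A) {deg : ι → ℤ} {D : ℤ}

namespace PreBimoduleMap

variable (Φ : PreBimoduleMap 𝒜 D) (M : AInfAlgebra 𝒜)

/-- The component of `φ ∘ b̂`. -/
def compOp : TwoMarked 𝒜 := fun a x b y =>
  sum3 a (fun p s t => (-1 : k) ^ wdeg p *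
      Φ.φ.ap (vals p ++ M.m.ap (vals s) :: vals t) x.2 (vals b) y.2) +
  sum2 a (fun p s => sum2 b (fun s' t => (-1 : k) ^ wdeg p *
      Φ.φ.ap (vals p) (M.m.ap (vals s ++ (x.2 : A) :: vals s')) (vals t) y.2)) +
  sum3 b (fun p s t => (-1 : k) ^ (wdeg a + x.1 + wdeg p) *
      Φ.φ.ap (vals a) x.2 (vals p ++ M.m.ap (vals s) :: vals t) y.2)

/-- The component of `b^* ∘ φ̂`. -/
def opComp : TwoMarked 𝒜 := fun a x b y =>
  sum2 a (fun p s => sum2 b (fun s' t =>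
    dualOp M p (wdeg s + x.1 + wdeg s') (fun z => Φ.φ.ap (vals s) x.2 (vals s') z) t y))

theorem isBimoduleMap_iff_compOp : Φ.IsBimoduleMap M ↔ Φ.compOp M = Φ.opComp M := by
  constructor
  · intro h
    funext a x b y
    exact h a x b y
  · intro h a x b y
    exact congrFun (congrFun (congrFun (congrFun h a) x) b) y

theorem compOp_isMultilinear : TwoMarked.IsMultilinear (Φ.compOp M) where
  left x b y := by
    refine ((WLin.sum3 (fun s t => ?_) (fun p t => ?_) (fun p s => ?_)).add
      (WLin.sum2 (fun s => WLin.sum2_right _ fun s' t => ?_)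
        (fun p => WLin.sum2_right _ fun s' t => ?_))).add (WLin.sum3_right _ fun p s t => ?_)
    · refine WLin.mul_deg (fun d => (-1 : k) ^ d) ?_
      exact WLin.ap (𝒜 := 𝒜) (Φ.φ.left x.2 (vals b) y.2) [] (M.m.ap (vals s) :: vals t)
    · exact WLin.mul_deg (fun _ => (-1 : k) ^ wdeg p)
        ((WLin.ap_vals M.m).map ((Φ.φ.left x.2 (vals b) y.2).slot (vals p) (vals t)))
    · refine WLin.mul_deg (fun _ => (-1 : k) ^ wdeg p) ?_
      have := WLin.ap (𝒜 := 𝒜) (Φ.φ.left x.2 (vals b) y.2) (vals p ++ [M.m.ap (vals s)]) []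
      simp only [List.append_nil, List.append_assoc, List.singleton_append] at this
      exact this
    · exact WLin.mul_deg (fun d => (-1 : k) ^ d) (WLin.ap_vals (Φ.φ.left _ (vals t) y.2))
    · refine WLin.mul_deg (fun _ => (-1 : k) ^ wdeg p) (WLin.map (N := A) ?_
        (Φ.φ.mid (vals p) (vals t) y.2))
      simpa using WLin.ap (𝒜 := 𝒜) M.m [] ((x.2 : A) :: vals s')
    · exact WLin.mul_deg (fun d => (-1 : k) ^ (d + x.1 + wdeg p))
        (WLin.ap_vals (Φ.φ.left x.2 _ y.2))
  mid a b y := by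
    refine ((HLin.sum2 _ fun p r => HLin.sum2 _ fun s t => ?_).add
      (HLin.sum2 _ fun p s => HLin.sum2 _ fun s' t => ?_)).add
      (HLin.sum2 _ fun p r => HLin.sum2 _ fun s t => ?_)
    · exact HLin.mul_deg (fun _ => (-1 : k) ^ wdeg p) (HLin.of_linear (Φ.φ.mid _ (vals b) y.2))
    · exact HLin.mul_deg (fun _ => (-1 : k) ^ wdeg p)
        ((HLin.of_linear (M.m.slot (vals s) (vals s'))).map (Φ.φ.mid (vals p) (vals t) y.2))
    · exact HLin.mul_deg (fun d => (-1 : k) ^ (wdeg a + d + wdeg p))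
        (HLin.of_linear (Φ.φ.mid (vals a) _ y.2))
  right a x y := by
    refine ((WLin.sum3_right _ fun p s t => ?_).add
      (WLin.sum2_right _ fun p s => WLin.sum2 (fun t => ?_) (fun s' => ?_))).add
      (WLin.sum3 (fun s t => ?_) (fun p t => ?_) (fun p s => ?_))
    · exact WLin.mul_deg (fun _ => (-1 : k) ^ wdeg p) (WLin.ap_vals (Φ.φ.right _ x.2 y.2))
    · refine WLin.mul_deg (fun _ => (-1 : k) ^ wdeg p) (WLin.map (N := A) ?_
        (Φ.φ.mid (vals p) (vals t) y.2))
      simpa using WLin.ap (𝒜 := 𝒜) M.m (vals s ++ [(x.2 : A)]) []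
    · exact WLin.mul_deg (fun _ => (-1 : k) ^ wdeg p) (WLin.ap_vals (Φ.φ.right (vals p) _ y.2))
    · refine WLin.mul_deg (fun d => (-1 : k) ^ (wdeg a + x.1 + d)) ?_
      exact WLin.ap (𝒜 := 𝒜) (Φ.φ.right (vals a) x.2 y.2) [] (M.m.ap (vals s) :: vals t)
    · exact WLin.mul_deg (fun _ => (-1 : k) ^ (wdeg a + x.1 + wdeg p))
        ((WLin.ap_vals M.m).map ((Φ.φ.right (vals a) x.2 y.2).slot (vals p) (vals t)))
    · refine WLin.mul_deg (fun _ => (-1 : k) ^ (wdeg a + x.1 + wdeg p)) ?_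
      have := WLin.ap (𝒜 := 𝒜) (Φ.φ.right (vals a) x.2 y.2) (vals p ++ [M.m.ap (vals s)]) []
      simp only [List.append_nil, List.append_assoc, List.singleton_append] at this
      exact this
  last a x b := by
    refine ((HLin.sum2 _ fun p r => HLin.sum2 _ fun s t => ?_).add
      (HLin.sum2 _ fun p s => HLin.sum2 _ fun s' t => ?_)).add
      (HLin.sum2 _ fun p r => HLin.sum2 _ fun s t => ?_)
    · exact HLin.mul_deg (fun _ => (-1 : k) ^ wdeg p) (HLin.of_linear (Φ.φ.last _ x.2 (vals b)))
    · exact HLin.mul_deg (fun _ => (-1 : k) ^ wdeg p)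
        (HLin.of_linear (Φ.φ.last (vals p) _ (vals t)))
    · exact HLin.mul_deg (fun _ => (-1 : k) ^ (wdeg a + x.1 + wdeg p))
        (HLin.of_linear (Φ.φ.last (vals a) x.2 _))

theorem opComp_isMultilinear : TwoMarked.IsMultilinear (Φ.opComp M) where
  left x b y := by
    refine WLin.sum2 (fun s => WLin.sum2_right _ fun s' t => ?_)
      (fun p => WLin.sum2_right _ fun s' t => ?_)
    · refine WLin.mul_deg (fun d => (-1 : k) ^ (1 + (wdeg s + x.1 + wdeg s') +
        d * (wdeg s + x.1 + wdeg s' + wdeg t + y.1)))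
        (WLin.map (N := A) ?_ (Φ.φ.last (vals s) x.2 (vals s')))
      simpa using WLin.ap (𝒜 := 𝒜) M.m (vals t ++ [(y.2 : A)]) []
    · exact WLin.mul_deg (fun d => (-1 : k) ^ (1 + (d + x.1 + wdeg s') +
        wdeg p * (d + x.1 + wdeg s' + wdeg t + y.1)))
        (WLin.ap_vals (Φ.φ.left x.2 (vals s') _))
  mid a b y := HLin.sum2 _ fun p s => HLin.sum2 _ fun s' t =>
    HLin.mul_deg (fun d => (-1 : k) ^ (1 + (wdeg s + d + wdeg s') +
      wdeg p * (wdeg s + d + wdeg s' + wdeg t +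
          y.1))) (HLin.of_linear (Φ.φ.mid (vals s) (vals s') _))
  right a x y := by
    refine WLin.sum2_right _ fun p s => WLin.sum2 (fun t => ?_) (fun s' => ?_)
    · exact WLin.mul_deg (fun d => (-1 : k) ^ (1 + (wdeg s + x.1 + d) +
        wdeg p * (wdeg s + x.1 + d + wdeg t + y.1))) (WLin.ap_vals (Φ.φ.right (vals s) x.2 _))
    · refine WLin.mul_deg (fun d => (-1 : k) ^ (1 + (wdeg s + x.1 + wdeg s') +
        wdeg p * (wdeg s + x.1 + wdeg s' + d + y.1)))
        (WLin.map (N := A) ?_ (Φ.φ.last (vals s) x.2 (vals s')))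
      simpa using WLin.ap (𝒜 := 𝒜) M.m [] ((y.2 : A) :: vals p)
  last a x b := HLin.sum2 _ fun p s => HLin.sum2 _ fun s' t =>
    HLin.mul_deg (fun d => (-1 : k) ^ (1 + (wdeg s + x.1 + wdeg s') +
      wdeg p * (wdeg s + x.1 + wdeg s' + wdeg t + d)))
      ((HLin.of_linear (M.m.slot (vals t) (vals p))).map (Φ.φ.last (vals s) x.2 (vals s')))

theorem apply_eq_sum_repr {N : Type*} [AddCommGroup N] [Module k N] (g : A →ₗ[k] N) (a : A) :
    g a = ∑ j, e.repr a j • g (e j) := by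
  conv_lhs => rw [← e.sum_repr a, map_sum]
  simp only [map_smul]

variable (h𝒜 : DirectSum.IsInternal 𝒜) (hdeg : ∀ i, e i ∈ 𝒜 (deg i))

theorem compOp_basisElt (I : List ι) (i : ι) (J : List ι) (j : ι) :
    Φ.compOp M (I.map (basisElt e hdeg)) (basisElt e hdeg i) (J.map (basisElt e hdeg))
      (basisElt e hdeg j) =
    (homologicalField h𝒜 M e deg hdeg).lieInner (Φ.coeff e) I i J j := by
  simp only [compOp, OddVectorField.lieInner, sum2_map, sum3_map]
  congr 1
  · congr 1
    · refine sum3_congr _ _ _ fun P S T _ => ?_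
      simp only [wdeg_map_basisElt, vals_map_basisElt]
      congr 1
      refine (apply_eq_sum_repr e
        ((Φ.φ.left (e i) (J.map e) (e j)).slot (P.map e) (T.map e)) _).trans
        (Finset.sum_congr rfl fun s _ => ?_)
      rw [PreBimoduleMap.coeff, List.map_append, List.map_cons]
      rfl
    · refine sum2_congr _ _ _ fun P S _ => sum2_congr _ _ _ fun S' T _ => ?_
      simp only [wdeg_map_basisElt, vals_map_basisElt]
      congr 1
      refine (apply_eq_sum_repr e (Φ.φ.mid (P.map e) (T.map e) (e j)) _).trans
        (Finset.sum_congr rfl fun s _ => ?_)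
      change _ = e.repr (M.m.ap ((S ++ i :: S').map e)) s * _
      rw [List.map_append, List.map_cons]
      rfl
  · refine sum3_congr _ _ _ fun P S T _ => ?_
    simp only [wdeg_map_basisElt, vals_map_basisElt]
    congr 1
    refine (apply_eq_sum_repr e
      ((Φ.φ.right (I.map e) (e i) (e j)).slot (P.map e) (T.map e)) _).trans
      (Finset.sum_congr rfl fun s _ => ?_)
    rw [PreBimoduleMap.coeff, List.map_append, List.map_cons]
    rfl

/-- The constant `1` in the sign exponent of the dual bimodule structure produces the minus sign, so
that the bimodule equation reads `lieInner + lieOuter = 0`. -/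
theorem opComp_basisElt (I : List ι) (i : ι) (J : List ι) (j : ι) :
    Φ.opComp M (I.map (basisElt e hdeg)) (basisElt e hdeg i) (J.map (basisElt e hdeg))
      (basisElt e hdeg j) =
    -(homologicalField h𝒜 M e deg hdeg).lieOuter (Φ.coeff e) I i J j := by
  simp only [opComp, OddVectorField.lieOuter, sum2_map, ← sum2_neg]
  refine sum2_congr _ _ _ fun P S _ => sum2_congr _ _ _ fun S' T _ => ?_
  simp only [dualOp, wdeg_map_basisElt, vals_map_basisElt]
  rw [← neg_mul]
  congr 1
  · refine (neg_sgn_eq ?_).symm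
    simp only [basisElt]
    push_cast
    ring
  · refine (apply_eq_sum_repr e (Φ.φ.last (S.map e) (e i) (S'.map e)) _).trans
      (Finset.sum_congr rfl fun s _ => ?_)
    change _ = e.repr (M.m.ap ((T ++ j :: P).map e)) s * _
    rw [List.map_append, List.map_cons]
    rfl

variable {Φ} in
theorem IsSkew.isBimoduleMap_iff [CharZero k] (hΦ : Φ.IsSkew) : Φ.IsBimoduleMap M ↔
    (homologicalField h𝒜 M e deg hdeg).lieD (Φ.form e deg) = 0 := by
  rw [isBimoduleMap_iff_compOp]
  refine Iff.trans ?_ ((homologicalField h𝒜 M e deg hdeg).lieD_form_eq_zero_iff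
    ((Φ.isSkew_iff e hdeg h𝒜).mp hΦ)).symm
  constructor
  · intro h
    funext I i J j
    have := compOp_basisElt e Φ M h𝒜 hdeg I i J j
    rw [h, opComp_basisElt e Φ M h𝒜 hdeg] at this
    simp only [Pi.add_apply, Pi.zero_apply]
    linear_combination -this
  · intro h
    refine TwoMarked.IsMultilinear.ext_basis e hdeg h𝒜 (Φ.compOp_isMultilinear M)
      (Φ.opComp_isMultilinear M) fun I i J j => ?_
    rw [compOp_basisElt e Φ M h𝒜 hdeg, opComp_basisElt e Φ M h𝒜 hdeg]
    have := congrFun (congrFun (congrFun (congrFun h I) i) J) j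
    simp only [Pi.add_apply, Pi.zero_apply] at this
    linear_combination this

theorem bijOn_form [CharZero k] (h𝒜 : DirectSum.IsInternal 𝒜)
    (hdeg : ∀ i, e i ∈ 𝒜 (deg i)) (D : ℤ) : Set.BijOn
    (fun Φ : PreBimoduleMap 𝒜 D => Φ.form e deg) {Φ | Φ.IsSkew} (formsOfDegree k deg 2 D) := by
  refine ⟨fun Φ _ => ?_, fun Φ hΦ Ψ hΨ h => ?_, fun ω hω => ?_⟩
  · refine TwoFormCoeff.form_mem_formsOfDegree fun I i J j h => ?_
    rw [← Φ.ev_basisElt e hdeg] at h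
    have := Φ.degree _ _ _ _ h
    rwa [wdeg_map_basisElt, wdeg_map_basisElt] at this
  · exact ext_coeff e (((Φ.isSkew_iff e hdeg h𝒜).mp hΦ).form_injective
      ((Ψ.isSkew_iff e hdeg h𝒜).mp hΨ) h)
  · obtain ⟨C, hC, hd, rfl⟩ := exists_skew_of_mem_formsOfDegree hω
    let Φ : PreBimoduleMap 𝒜 D := ⟨biFamilyOfCoeff e C, biFamilyOfCoeff_degree e hdeg h𝒜 C hd⟩
    have hΦ : Φ.coeff e = C := by
      funext I i J j
      exact biFamilyOfCoeff_ap e C I i J j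
    refine ⟨Φ, (Φ.isSkew_iff e hdeg h𝒜).mpr (hΦ.symm ▸ hC), ?_⟩
    exact congrArg (TwoFormCoeff.form deg) hΦ

variable {Φ M} in
theorem IsBimoduleMap.isStrongHomotopyInnerProduct_iff [CharZero k]
    (h𝒜 : DirectSum.IsInternal 𝒜) (hdeg : ∀ i, e i ∈ 𝒜 (deg i)) (hΦ : Φ.IsBimoduleMap M) :
    Φ.IsStrongHomotopyInnerProduct M ∧ Φ.IsNondegenerate ↔
      Φ.IsSkew ∧ IsSymplectic D (Φ.form e deg) := by
  constructor
  · rintro ⟨h, hnd⟩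
    have hs := h.isSkew
    exact ⟨hs, (bijOn_form e h𝒜 hdeg D).mapsTo hs,
      (Φ.isClosed_iff_extD e hdeg h𝒜 hs).mp h.isClosed,
      (Φ.isNondegenerate_iff e hdeg h𝒜 hs).mp hnd⟩
  · rintro ⟨hs, hω⟩
    have hnd := (Φ.isNondegenerate_iff e hdeg h𝒜 hs).mpr hω.nondegenerate
    exact ⟨hΦ.isStrongHomotopyInnerProduct e h𝒜 hdeg hs
      ((Φ.isClosed_iff_extD e hdeg h𝒜 hs).mpr hω.closed) hnd, hnd⟩

end PreBimoduleMap

end Bimodule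

end AInfinity

/-! ### The correspondence between strong homotopy inner products and symplectic forms -/

theorem theorem6p1 {k : Type v} [Field k] [CharZero k] {A : Type u} [AddCommGroup A] [Module k A]
    (𝒜 : ℤ → Submodule k A) (h𝒜 : DirectSum.IsInternal 𝒜) (M : AInfinity.AInfAlgebra 𝒜)
    {ι : Type w} [Fintype ι] (e : Module.Basis ι k A) (deg : ι → ℤ)
    (hdeg : ∀ i, e i ∈ 𝒜 (deg i)) (D : ℤ) :
    -- strong homotopy inner products that are non-degenerate at chain level correspond
    -- bijectively to the symplectic forms that are invariant under the vector field of `A`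
    Set.BijOn (fun Φ : AInfinity.PreBimoduleMap 𝒜 D => Φ.form e deg)
      {Φ | Φ.IsStrongHomotopyInnerProduct M ∧ Φ.IsNondegenerate}
      {ω | AInfinity.IsSymplectic D ω ∧ (AInfinity.homologicalField h𝒜 M e deg hdeg).lieD ω = 0} ∧
    -- for a given bimodule map
    (∀ Φ : AInfinity.PreBimoduleMap 𝒜 D, Φ.IsBimoduleMap M →
      (Φ.IsStrongHomotopyInnerProduct M ∧ Φ.IsNondegenerate ↔
        (Φ.coeff e).IsSkew deg ∧ AInfinity.IsSymplectic D (Φ.form e deg))) ∧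
    -- skew symmetric families are the same as two-forms
    Set.BijOn (fun Φ : AInfinity.PreBimoduleMap 𝒜 D => Φ.form e deg)
      {Φ | Φ.IsSkew} (AInfinity.formsOfDegree k deg 2 D) ∧
    -- the conditions correspond to each other one by one
    (∀ Φ : AInfinity.PreBimoduleMap 𝒜 D, Φ.IsSkew ↔ (Φ.coeff e).IsSkew deg) ∧
    (∀ Φ : AInfinity.PreBimoduleMap 𝒜 D, Φ.IsSkew →
      (Φ.IsClosed ↔ AInfinity.extD k deg (Φ.form e deg) = 0) ∧
      (Φ.IsNondegenerate ↔ (AInfinity.originMatrix k deg (Φ.form e deg)).Nondegenerate) ∧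
      (Φ.IsBimoduleMap M ↔ (AInfinity.homologicalField h𝒜 M e deg hdeg).lieD (Φ.form e deg) = 0)) := by

  have hskew := fun Φ : AInfinity.PreBimoduleMap 𝒜 D => Φ.isSkew_iff e hdeg h𝒜
  have hbij := AInfinity.PreBimoduleMap.bijOn_form e h𝒜 hdeg D
  refine ⟨⟨?_, ?_, ?_⟩, fun Φ hΦ => ?_, hbij, hskew, fun Φ hΦ =>
    ⟨Φ.isClosed_iff_extD e hdeg h𝒜 hΦ, Φ.isNondegenerate_iff e hdeg h𝒜 hΦ,
      hΦ.isBimoduleMap_iff e M h𝒜 hdeg⟩⟩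
  · rintro Φ ⟨h, hnd⟩
    obtain ⟨hs, hω⟩ := (h.1.isStrongHomotopyInnerProduct_iff e h𝒜 hdeg).mp ⟨h, hnd⟩
    exact ⟨hω, (hs.isBimoduleMap_iff e M h𝒜 hdeg).mp h.1⟩
  · rintro Φ ⟨h, -⟩ Ψ ⟨h', -⟩ heq
    exact hbij.injOn h.isSkew h'.isSkew heq
  · rintro ω ⟨hω, hL⟩
    -- The preimage is sought among skew families; invariance of the form makes it a bimodule map,
    -- to which the Darboux theorem then applies.
    obtain ⟨Φ, hs, rfl⟩ := hbij.surjOn hω.mem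
    have hΦ := (AInfinity.PreBimoduleMap.IsSkew.isBimoduleMap_iff e M h𝒜 hdeg hs).mpr hL
    exact ⟨Φ, (hΦ.isStrongHomotopyInnerProduct_iff e h𝒜 hdeg).mpr ⟨hs, hω⟩, rfl⟩
  · rw [hΦ.isStrongHomotopyInnerProduct_iff e h𝒜 hdeg, hskew]
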